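/- Let $p,q\ge 1$, $n=p+q$, $r\in\mathbb C$, and let $M=S^p\times S^q\subset\mathbb R^{p+1}\times\mathbb R^{q+1}=\mathbb R^{p+1,q+1}$ carry the metric $-g_{S^p}+g_{S^q}$. Let $E(j)$ (resp. $F(k)$) be the space of complex spherical harmonics of order $j$ on $S^p$ (resp. of order $k$ on $S^q$), $\mathcal V(j,k)=E(j)\otimes F(k)$, and $\mathcal E=\bigoplus_{j,k\ge 0}\mathcal V(j,k)$ the space of $K$-finite functions on $M$, where $K=\mathrm{SO}(p+1)\times\mathrm{SO}(q+1)$. The Lie algebra $\mathfrak g=\mathfrak{so}(p+1,q+1)$ acts on $M$, the space of positive rays of the null cone of $\mathbb R^{p+1,q+1}$, by conformal vector fields; write $\mathcal L_X$ for the Lie derivative along the vector field of $X\in\mathfrak g$ and $\varpi_X$ for its conformal factor. An *intertwinor of order $2r$* is a $\mathbb C$-linear map $A:\mathcal E\to\mathcal E$ that commutes with $K$ and satisfies $$A\left(\mathcal L_X+\left(\tfrac n2-r\right)\varpi_X\right)=\left(\mathcal L_X+\left(\tfrac n2+r\right)\varpi_X\right)A\qquad\text{for all }X\in\mathfrak g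 .$$ **Theorem.** (a) If $p,q\ge 2$, every intertwinor of order $2r$ acts by a scalar on each $\mathcal V(j,k)$. (b) Let $\varepsilon\in\{0,1\}$, $J=j+\frac{p-1}2$, $K=k+\frac{q-1}2$, and $$Z_\varepsilon(r;j,k)=\frac{\Gamma(\frac12(K+J+1+r))\,\Gamma(\frac12(K-J+1+r))\,\Gamma(\frac12(\varepsilon-\frac{p-q}2+1-r))\,\Gamma(\frac12(\varepsilon+\frac{p+q}2-r))}{\Gamma(\frac12(K+J+1-r))\,\Gamma(\frac12(K-J+1-r))\,\Gamma(\frac12(\varepsilon-\frac{p-q}2+1+r))\,\Gamma(\frac12(\varepsilon+\frac{p+q}2+r))} .$$ Assume that for all $j,k\ge 0$ with $j+k\equiv\varepsilon \pmod 2$ none of the numbers $\frac12(K+J+1\pm r)$, $\frac12(K-J+1\pm r)$ is in $\{0,-1,-2,\dots\}$, i.e. that none of the Gamma functions is evaluated at a pole. Then $Z_\varepsilon(r;0,\varepsilon)=1$, and $Z_\varepsilon(r;\cdot,\cdot)$ is, up to normalization, the unique spectral function of intertwinors of order $2r$ on $\mathcal E^\varepsilon=\bigoplus_{j+k\equiv\varepsilon\,(2)}\mathcal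 V(j,k)$: for every intertwinor $A$ of order $2r$ there is a constant $c\in\mathbb C$ such that $A$ acts on each $\mathcal V(j,k)$ with $j+k\equiv\varepsilon\pmod 2$ as the scalar $c\,Z_\varepsilon(r;j,k)$; and for every $c\in\mathbb C$ there is an intertwinor of order $2r$ that acts in this way. -/

import Mathlib

noncomputable section

namespace SphereProduct

open MvPolynomial

/-- The unit sphere `S^d` in `ℝ^{d+1}`. -/
abbrev Sph (d : ℕ) : Type := Metric.sphere (0 : EuclideanSpace ℝ (Fin (d + 1))) 1

/-- `M = S^p × S^q`, inside `ℝ^{p+1} × ℝ^{q+1} = ℝ^{p+1,q+1}`. -/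
abbrev Prd (p q : ℕ) : Type := Sph p × Sph q

/-! ### Spherical harmonics and the K-types -/

/-- The Laplacian `∑ ∂ᵢ²` on complex polynomials in `x_0, …, x_d`. -/
def polyLaplacian (d : ℕ) :
    MvPolynomial (Fin (d + 1)) ℂ →ₗ[ℂ] MvPolynomial (Fin (d + 1)) ℂ :=
  ∑ i, (pderiv (R := ℂ) i).toLinearMap ∘ₗ (pderiv (R := ℂ) i).toLinearMap

/-- Restriction of a polynomial on `ℝ^{d+1}` to the sphere `S^d`. -/
def restrictSph (d : ℕ) : MvPolynomial (Fin (d + 1)) ℂ →ₗ[ℂ] (Sph d → ℂ) where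
  toFun P := fun x => eval (fun i => ((x.1 i : ℝ) : ℂ)) P
  map_add' P Q := by ext x; simp
  map_smul' c P := by ext x; simp [smul_eval]

/-- The space of spherical harmonics of order `j` on `S^d`: the restrictions to the sphere of the
complex homogeneous harmonic polynomials of degree `j` on `ℝ^{d+1}`. -/
def harmonics (d j : ℕ) : Submodule ℂ (Sph d → ℂ) :=
  (homogeneousSubmodule (Fin (d + 1)) ℂ j ⊓ LinearMap.ker (polyLaplacian d)).map (restrictSph d)

/-- The function `(u, v) ↦ f(u) g(v)` on `S^p × S^q`. -/
def tensorFun {p q : ℕ} (f : Sph p → ℂ) (g : Sph q → ℂ) : Prd p q → ℂ := fun z => f z.1 * g z.2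

/-- The K-type `V(j,k) = E(j) ⊗ F(k)`, as a space of functions on `S^p × S^q`. -/
def KType (p q j k : ℕ) : Submodule ℂ (Prd p q → ℂ) :=
  Submodule.span ℂ {φ | ∃ f ∈ harmonics p j, ∃ g ∈ harmonics q k, φ = tensorFun f g}

/-- The `(𝔤, K)`-module `⨁ V(j,k)` of `K`-finite functions on `S^p × S^q`. -/
def KFinite (p q : ℕ) : Submodule ℂ (Prd p q → ℂ) := ⨆ j, ⨆ k, KType p q j k

/-! ### The action of `K = SO(p+1) × SO(q+1)` -/

/-- The point `(k₁ u, k₂ v)`. -/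
def rotate {p q : ℕ} (k₁ : EuclideanSpace ℝ (Fin (p + 1)) ≃ₗᵢ[ℝ] EuclideanSpace ℝ (Fin (p + 1)))
    (k₂ : EuclideanSpace ℝ (Fin (q + 1)) ≃ₗᵢ[ℝ] EuclideanSpace ℝ (Fin (q + 1)))
    (z : Prd p q) : Prd p q :=
  (⟨k₁ z.1.1, by simp⟩, ⟨k₂ z.2.1, by simp⟩)

/-- The natural action on functions, `(k · φ)(z) = φ(k⁻¹ z)`. -/
def rotAct {p q : ℕ} (k₁ : EuclideanSpace ℝ (Fin (p + 1)) ≃ₗᵢ[ℝ] EuclideanSpace ℝ (Fin (p + 1)))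
    (k₂ : EuclideanSpace ℝ (Fin (q + 1)) ≃ₗᵢ[ℝ] EuclideanSpace ℝ (Fin (q + 1)))
    (φ : Prd p q → ℂ) : Prd p q → ℂ :=
  fun z => φ (rotate k₁.symm k₂.symm z)

/-! ### The action of `𝔤 = so(p+1,q+1)` by conformal vector fields

`𝔤` is Mathlib's `LieAlgebra.Orthogonal.so' (Fin (p+1)) (Fin (q+1)) ℝ`, the Lie algebra of the
matrices that are skew for the form `± (x_0² + ⋯ + x_p² - y_0² - ⋯ - y_q²)`. -/

/-- A matrix on `ℝ^{p+1,q+1}`. -/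
abbrev Mat (p q : ℕ) : Type := Matrix (Fin (p + 1) ⊕ Fin (q + 1)) (Fin (p + 1) ⊕ Fin (q + 1)) ℝ

/-- The value `X z` at `z = (u, v)` of the linear vector field of `X` on `ℝ^{p+1,q+1}`. -/
def linField {p q : ℕ} (X : Mat p q) (z : Prd p q) : Fin (p + 1) ⊕ Fin (q + 1) → ℝ :=
  X.mulVec (Sum.elim (fun i => z.1.1 i) (fun i => z.2.1 i))

/-- The same vector, as an element of `ℝ^{p+1} × ℝ^{q+1}`. -/
def linFieldProd {p q : ℕ} (X : Mat p q) (z : Prd p q) :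
    EuclideanSpace ℝ (Fin (p + 1)) × EuclideanSpace ℝ (Fin (q + 1)) :=
  (WithLp.toLp 2 fun i => linField X z (Sum.inl i), WithLp.toLp 2 fun i => linField X z (Sum.inr i))

/-- The function `(a, b) ↦ φ(a/|a|, b/|b|)` for `a, b ≠ 0` (and `0` elsewhere). On the null cone
`|a| = |b| ≠ 0` of `ℝ^{p+1,q+1}` it is the pullback of `φ` under the projection
`(a, b) ↦ (a, b)/|a|` of the cone onto `S^p × S^q`. -/
def radialExt {p q : ℕ} (φ : Prd p q → ℂ)
    (w : EuclideanSpace ℝ (Fin (p + 1)) × EuclideanSpace ℝ (Fin (q + 1))) : ℂ :=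
  open Classical in
  if h : w.1 ≠ 0 ∧ w.2 ≠ 0 then
    φ (⟨‖w.1‖⁻¹ • w.1, by simpa using norm_smul_inv_norm (𝕜 := ℝ) h.1⟩,
       ⟨‖w.2‖⁻¹ • w.2, by simpa using norm_smul_inv_norm (𝕜 := ℝ) h.2⟩)
  else 0

/-- The Lie derivative `𝓛_X φ` of a function on `S^p × S^q` along the conformal vector field that
`X ∈ 𝔤` induces on `S^p × S^q`, the projectivized null cone: at a point `z` of `S^p × S^q`, which
lies on the cone, differentiate the pullback of `φ` to the cone along the linear vector field
of `X`, which is tangent to the cone. -/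
def lieDeriv {p q : ℕ} (X : Mat p q) (φ : Prd p q → ℂ) (z : Prd p q) : ℂ :=
  lineDeriv ℝ (radialExt φ) (z.1.1, z.2.1) (linFieldProd X z)

/-- The conformal factor `ϖ_X(u,v) = -⟨u, (X(u,v))₁⟩` of the vector field that `X ∈ 𝔤` induces on
`S^p × S^q` with metric `g = -g_{S^p} + g_{S^q}`. That vector field is
`Y(z) = X z + ϖ_X(z) z`, the projection of `X z` along the radial direction of the null cone; as `X`
is skew and `z` is null and orthogonal to the cone at `z`, one has `𝓛_Y g = 2 ϖ_X g`. -/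
def confFactor {p q : ℕ} (X : Mat p q) (z : Prd p q) : ℝ :=
  -∑ i, z.1.1 i * linField X z (Sum.inl i)

/-- The representation `U_a(X) = 𝓛_X + a ϖ_X` of `𝔤` on functions. -/
def confAct {p q : ℕ} (a : ℂ) (X : Mat p q) (φ : Prd p q → ℂ) : Prd p q → ℂ :=
  fun z => lieDeriv X φ z + a * (confFactor X z : ℂ) * φ z

/-! ### The space of `K`-finite functions is stable under `K` and `𝔤` -/

/-- The coordinates of a point of `S^p × S^q`, as complex numbers. -/
def coords {p q : ℕ} (z : Prd p q) : Fin (p + 1) ⊕ Fin (q + 1) → ℂ :=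
  Sum.elim (fun i => ((z.1.1 i : ℝ) : ℂ)) (fun i => ((z.2.1 i : ℝ) : ℂ))

lemma polyLaplacian_apply (d : ℕ) (P : MvPolynomial (Fin (d + 1)) ℂ) :
    polyLaplacian d P = ∑ i, pderiv i (pderiv i P) := by
  simp [polyLaplacian]

lemma mem_harmonics {d j : ℕ} {f : Sph d → ℂ} : f ∈ harmonics d j ↔
    ∃ P : MvPolynomial (Fin (d + 1)) ℂ, P.IsHomogeneous j ∧ polyLaplacian d P = 0 ∧
      restrictSph d P = f := by
  simp [harmonics, and_assoc]

lemma sum_sq_sph {d : ℕ} (x : Sph d) : ∑ i, (((x.1 i : ℝ) : ℂ)) ^ 2 = 1 := by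
  have h : ‖x.1‖ = 1 := by simp
  have h2 : ∑ i, (x.1 i) ^ 2 = 1 := by
    have := EuclideanSpace.real_norm_sq_eq x.1
    rw [h] at this
    simpa using this.symm
  exact_mod_cast h2

lemma pderiv_comm' {d : ℕ} (i l : Fin (d + 1)) (P : MvPolynomial (Fin (d + 1)) ℂ) :
    pderiv i (pderiv l P) = pderiv l (pderiv i P) := by
  induction P using MvPolynomial.induction_on with
  | C a => simp
  | add P Q hP hQ => simp [hP, hQ]
  | mul_X P n h =>
    have hs : ∀ a b c : Fin (d + 1), pderiv a
        (Pi.single (M := fun _ => MvPolynomial (Fin (d + 1)) ℂ) b 1 c) = 0 := by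
      intro a b c
      by_cases hb : c = b
      · subst hb; simp
      · simp [hb]
    simp only [Derivation.leibniz, pderiv_X, smul_eq_mul, map_add, h, hs]
    ring

lemma laplacian_X_mul {d : ℕ} (i : Fin (d + 1)) (P : MvPolynomial (Fin (d + 1)) ℂ) :
    polyLaplacian d (X i * P) = X i * polyLaplacian d P + 2 * pderiv i P := by
  simp only [polyLaplacian_apply, Derivation.leibniz, pderiv_X, smul_eq_mul, map_add,
    Finset.mul_sum]
  have h : ∀ l : Fin (d + 1), pderiv l (Pi.single (M := fun _ => MvPolynomial (Fin (d + 1)) ℂ) l 1 i)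
      = 0 := by
    intro l
    by_cases hl : i = l
    · subst hl; simp
    · simp [hl]
  simp only [h, mul_zero]
  have : ∑ l : Fin (d + 1),
      Pi.single (M := fun _ => MvPolynomial (Fin (d + 1)) ℂ) l 1 i * pderiv l P = pderiv i P := by
    simp [Pi.single_apply]
  have h' : ∀ l : Fin (d + 1), pderiv l P *
      Pi.single (M := fun _ => MvPolynomial (Fin (d + 1)) ℂ) l 1 i =
      Pi.single (M := fun _ => MvPolynomial (Fin (d + 1)) ℂ) l 1 i * pderiv l P :=
    fun l => mul_comm _ _
  simp only [h', Finset.sum_add_distrib, this, Finset.sum_const_zero, ← Finset.mul_sum]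
  ring

lemma laplacian_sq_mul {d n : ℕ} {Q : MvPolynomial (Fin (d + 1)) ℂ} (hQ : Q.IsHomogeneous n)
    (h0 : polyLaplacian d Q = 0) :
    polyLaplacian d ((∑ i, X i ^ 2) * Q) = (2 * (d + 1) + 4 * n : ℂ) • Q := by
  have key : ∀ i : Fin (d + 1), polyLaplacian d (X i ^ 2 * Q) = 2 * Q + 4 * (X i * pderiv i Q) := by
    intro i
    rw [pow_two, mul_assoc, laplacian_X_mul, laplacian_X_mul, h0]
    simp only [Derivation.leibniz, pderiv_X_self, smul_eq_mul]
    ring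
  rw [Finset.sum_mul, map_sum, Finset.sum_congr rfl fun i _ => key i, Finset.sum_add_distrib,
    ← Finset.mul_sum Finset.univ (fun i => X i * pderiv i Q), hQ.sum_X_mul_pderiv]
  simp only [Finset.sum_const, Finset.card_univ, Fintype.card_fin, nsmul_eq_mul, smul_eq_C_mul,
    map_add, map_mul, map_natCast, map_ofNat, map_one]
  push_cast
  ring

/-- A coordinate function times a spherical harmonic is a sum of spherical harmonics. -/
lemma coord_mul_mem {d j : ℕ} (hd : 1 ≤ d) (i : Fin (d + 1)) {f : Sph d → ℂ}
    (hf : f ∈ harmonics d j) :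
    ∃ l m, ∃ f₁ ∈ harmonics d l, ∃ f₂ ∈ harmonics d m,
      (fun x : Sph d => ((x.1 i : ℝ) : ℂ) * f x) = f₁ + f₂ := by
  obtain ⟨P, hP, hL, rfl⟩ := mem_harmonics.1 hf
  have hD : polyLaplacian d (pderiv i P) = 0 := by
    have : polyLaplacian d (pderiv i P) = pderiv i (polyLaplacian d P) := by
      simp only [polyLaplacian_apply, map_sum]
      refine Finset.sum_congr rfl fun l _ => ?_
      rw [pderiv_comm' l i P, pderiv_comm' l i]
    rw [this, hL, map_zero]
  have hDh : (pderiv i P).IsHomogeneous (j - 1) := hP.pderiv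
  set c : ℂ := (d - 1 + 2 * j : ℂ) with hc
  have hr : (∑ l : Fin (d + 1), (X l : MvPolynomial (Fin (d + 1)) ℂ) ^ 2).IsHomogeneous 2 :=
    IsHomogeneous.sum _ _ _ fun l _ => by simpa using (isHomogeneous_X ℂ l).pow 2
  rcases Nat.eq_zero_or_pos j with rfl | hj
  · have h0 : pderiv i P = 0 := by
      obtain ⟨a, rfl⟩ : ∃ a, P = C a := ⟨_, (totalDegree_eq_zero_iff_eq_C.1 (by
        simpa using hP.totalDegree_le))⟩
      simp
    refine ⟨1, 0, restrictSph d (X i * P), mem_harmonics.2 ⟨X i * P, ?_, ?_, rfl⟩, 0,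
      Submodule.zero_mem _, ?_⟩
    · simpa using (isHomogeneous_X ℂ i).mul hP
    · rw [laplacian_X_mul, hL, h0]; simp
    · ext x; simp [restrictSph]
  · have hc0 : c ≠ 0 := by
      have : c = ((d - 1 + 2 * j : ℕ) : ℂ) := by rw [hc]; push_cast [hd]; ring
      rw [this]; exact_mod_cast (by omega)
    refine ⟨j + 1, j - 1,
      restrictSph d (X i * P - c⁻¹ • ((∑ l, X l ^ 2) * pderiv i P)),
      mem_harmonics.2 ⟨_, ?_, ?_, rfl⟩,
      restrictSph d (c⁻¹ • pderiv i P), mem_harmonics.2 ⟨_, ?_, ?_, rfl⟩, ?_⟩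
    · refine IsHomogeneous.sub ?_ ?_
      · have := (isHomogeneous_X ℂ i).mul hP
        rwa [add_comm 1 j] at this
      · rw [smul_eq_C_mul]
        have := (isHomogeneous_C (Fin (d + 1)) c⁻¹).mul (hr.mul hDh)
        have e : 0 + (2 + (j - 1)) = j + 1 := by omega
        rwa [e] at this
    · rw [map_sub, map_smul, laplacian_X_mul, hL, laplacian_sq_mul hDh hD, smul_smul]
      have : c⁻¹ * (2 * (d + 1) + 4 * ((j - 1 : ℕ) : ℂ)) = 2 := by
        rw [inv_mul_eq_iff_eq_mul₀ hc0, hc]; push_cast [hj]; ring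
      rw [this, smul_eq_C_mul, map_ofNat]; simp
    · rw [smul_eq_C_mul]
      simpa using (isHomogeneous_C (Fin (d + 1)) c⁻¹).mul hDh
    · rw [map_smul, hD, smul_zero]
    · ext x
      simp [restrictSph, smul_eval, sum_sq_sph]

lemma tensor_mem {p q j k : ℕ} {f : Sph p → ℂ} {g : Sph q → ℂ} (hf : f ∈ harmonics p j)
    (hg : g ∈ harmonics q k) : tensorFun f g ∈ KFinite p q :=
  Submodule.mem_iSup_of_mem j (Submodule.mem_iSup_of_mem k
    (Submodule.subset_span ⟨f, hf, g, hg, rfl⟩))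

lemma KFinite_induction {p q : ℕ} {C : (Prd p q → ℂ) → Prop} (h0 : C 0)
    (hadd : ∀ φ ψ, C φ → C ψ → C (φ + ψ)) (hsmul : ∀ (c : ℂ) φ, C φ → C (c • φ))
    (ht : ∀ j k, ∀ f ∈ harmonics p j, ∀ g ∈ harmonics q k, C (tensorFun f g))
    {φ : Prd p q → ℂ} (hφ : φ ∈ KFinite p q) : C φ := by
  let S : Submodule ℂ (Prd p q → ℂ) :=
    { carrier := {φ | C φ}
      add_mem' := fun h h' => hadd _ _ h h'
      zero_mem' := h0
      smul_mem' := fun c _ h => hsmul c _ h }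
  have : KFinite p q ≤ S := by
    refine iSup_le fun j => iSup_le fun k => Submodule.span_le.2 ?_
    rintro _ ⟨f, hf, g, hg, rfl⟩
    exact ht j k f hf g hg
  exact this hφ

lemma coords_mul_mem {p q : ℕ} (hp : 1 ≤ p) (hq : 1 ≤ q) (s : Fin (p + 1) ⊕ Fin (q + 1))
    {φ : Prd p q → ℂ} (hφ : φ ∈ KFinite p q) : (fun z => coords z s * φ z) ∈ KFinite p q := by
  refine KFinite_induction (C := fun φ => (fun z => coords z s * φ z) ∈ KFinite p q)
    ?_ ?_ ?_ ?_ hφ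
  · have := (KFinite p q).zero_mem
    convert this using 1
    ext z; simp
  · intro φ ψ h h'
    have := Submodule.add_mem _ h h'
    convert this using 1
    ext z; simp [mul_add]
  · intro c φ h
    have := Submodule.smul_mem _ c h
    convert this using 1
    ext z; simp; ring
  · intro j k f hf g hg
    rcases s with i | i
    · obtain ⟨l, m, f₁, h₁, f₂, h₂, e⟩ := coord_mul_mem hp i hf
      have := Submodule.add_mem _ (tensor_mem h₁ hg) (tensor_mem h₂ hg)
      convert this using 1
      ext z
      have := congrFun e z.1
      simp only [Pi.add_apply] at this
      simp [tensorFun, coords, ← add_mul, ← this, mul_assoc]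
    · obtain ⟨l, m, g₁, h₁, g₂, h₂, e⟩ := coord_mul_mem hq i hg
      have := Submodule.add_mem _ (tensor_mem hf h₁) (tensor_mem hf h₂)
      convert this using 1
      ext z
      have := congrFun e z.2
      simp only [Pi.add_apply] at this
      simp only [tensorFun, coords, Sum.elim_inr, Pi.add_apply, ← mul_add, ← this]
      ring

/-- The `K`-finite functions are exactly the polynomial functions. -/
lemma mem_KFinite_iff {p q : ℕ} (hp : 1 ≤ p) (hq : 1 ≤ q) {φ : Prd p q → ℂ} :
    φ ∈ KFinite p q ↔ ∃ P : MvPolynomial (Fin (p + 1) ⊕ Fin (q + 1)) ℂ,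
      ∀ z, φ z = eval (coords z) P := by
  constructor
  · refine fun h => KFinite_induction (C := fun φ => ∃ P : MvPolynomial _ ℂ,
      ∀ z, φ z = eval (coords z) P) ⟨0, by simp⟩ ?_ ?_ ?_ h
    · rintro φ ψ ⟨P, hP⟩ ⟨Q, hQ⟩
      exact ⟨P + Q, fun z => by simp [hP, hQ]⟩
    · rintro c φ ⟨P, hP⟩
      exact ⟨c • P, fun z => by simp [hP, smul_eval]⟩
    · intro j k f hf g hg
      obtain ⟨P, -, -, rfl⟩ := mem_harmonics.1 hf
      obtain ⟨Q, -, -, rfl⟩ := mem_harmonics.1 hg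
      refine ⟨rename Sum.inl P * rename Sum.inr Q, fun z => ?_⟩
      simp only [tensorFun, restrictSph, map_mul, eval_rename]
      rfl
  · rintro ⟨P, hP⟩
    obtain rfl : φ = fun z => eval (coords z) P := funext hP
    clear hP
    induction P using MvPolynomial.induction_on with
    | C a =>
      have h1 : ∀ d, (fun _ => 1 : Sph d → ℂ) ∈ harmonics d 0 := fun d =>
        mem_harmonics.2 ⟨1, isHomogeneous_one _ _, by simp [polyLaplacian_apply],
          by ext x; simp [restrictSph]⟩
      have := Submodule.smul_mem _ a (tensor_mem (h1 p) (h1 q))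
      convert this using 1
      ext z; simp [tensorFun]
    | add P Q hP hQ =>
      have := Submodule.add_mem _ hP hQ
      convert this using 1
      ext z; simp
    | mul_X P s h =>
      have := coords_mul_mem hp hq s h
      convert this using 1
      ext z; simp [mul_comm]

lemma rotAct_mem {p q : ℕ} (hp : 1 ≤ p) (hq : 1 ≤ q)
    (k₁ : EuclideanSpace ℝ (Fin (p + 1)) ≃ₗᵢ[ℝ] EuclideanSpace ℝ (Fin (p + 1)))
    (k₂ : EuclideanSpace ℝ (Fin (q + 1)) ≃ₗᵢ[ℝ] EuclideanSpace ℝ (Fin (q + 1)))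
    {φ : Prd p q → ℂ} (hφ : φ ∈ KFinite p q) : rotAct k₁ k₂ φ ∈ KFinite p q := by
  have lin : ∀ (d : ℕ) (L : EuclideanSpace ℝ (Fin (d + 1)) ≃ₗᵢ[ℝ] EuclideanSpace ℝ (Fin (d + 1)))
      (x : EuclideanSpace ℝ (Fin (d + 1))) (i : Fin (d + 1)),
      L x i = ∑ l, x l * L (EuclideanSpace.single l 1) i := by
    intro d L x i
    have hx : x = ∑ l, x l • EuclideanSpace.single l (1 : ℝ) := by
      ext m; simp [Finset.sum_apply, Pi.single_apply]
    conv_lhs => rw [hx]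
    simp
  obtain ⟨P, hP⟩ := (mem_KFinite_iff hp hq).1 hφ
  refine (mem_KFinite_iff hp hq).2 ⟨bind₁ (Sum.elim
    (fun i => ∑ l, C ((k₁.symm (EuclideanSpace.single l 1) i : ℝ) : ℂ) * X (Sum.inl l))
    (fun i => ∑ l, C ((k₂.symm (EuclideanSpace.single l 1) i : ℝ) : ℂ) * X (Sum.inr l))) P,
    fun z => ?_⟩
  rw [rotAct, hP, ← coe_aeval_eq_eval, ← coe_aeval_eq_eval, RingHom.coe_coe, RingHom.coe_coe,
    aeval_bind₁]
  congr 2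
  ext s
  rcases s with i | i
  · have := lin p k₁.symm z.1.1 i
    simp only [coords, rotate, Sum.elim_inl, map_sum, map_mul, aeval_X, algHom_C]
    rw [this]
    push_cast
    exact Finset.sum_congr rfl fun l _ => mul_comm _ _
  · have := lin q k₂.symm z.2.1 i
    simp only [coords, rotate, Sum.elim_inr, map_sum, map_mul, aeval_X, algHom_C]
    rw [this]
    push_cast
    exact Finset.sum_congr rfl fun l _ => mul_comm _ _

/-- `X z`, with polynomial entries. -/
def linPoly {p q : ℕ} (A : Mat p q) (s : Fin (p + 1) ⊕ Fin (q + 1)) :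
    MvPolynomial (Fin (p + 1) ⊕ Fin (q + 1)) ℂ :=
  ∑ t, C ((A s t : ℝ) : ℂ) * X t

lemma eval_linPoly {p q : ℕ} (A : Mat p q) (s : Fin (p + 1) ⊕ Fin (q + 1)) (z : Prd p q) :
    eval (coords z) (linPoly A s) = ((linField A z s : ℝ) : ℂ) := by
  simp [linPoly, linField, Matrix.mulVec, dotProduct, coords]

/-- Derivative of a normalized coordinate along a line through a unit vector. -/
lemma hasDerivAt_normalize {d : ℕ} (x : Sph d) (w : EuclideanSpace ℝ (Fin (d + 1)))
    (i : Fin (d + 1)) :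
    HasDerivAt (fun t : ℝ => (((‖x.1 + t • w‖⁻¹ * (x.1 + t • w) i : ℝ)) : ℂ))
      ((w i - (∑ l, x.1 l * w l) * x.1 i : ℝ) : ℂ) 0 := by
  have hx : ‖x.1‖ = 1 := by simp
  have hl : HasDerivAt (fun t : ℝ => x.1 + t • w) w 0 := by
    simpa using ((hasDerivAt_id (0 : ℝ)).smul_const w).const_add x.1
  have hsq := hl.norm_sq
  have hn : HasDerivAt (fun t : ℝ => ‖x.1 + t • w‖) (∑ l, x.1 l * w l) 0 := by
    have h := hsq.sqrt (by simp [hx])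
    have e : (fun t : ℝ => √(‖x.1 + t • w‖ ^ 2)) = fun t => ‖x.1 + t • w‖ := by
      ext t; exact Real.sqrt_sq (norm_nonneg _)
    rw [e] at h
    convert h using 1
    simp [hx, PiLp.inner_apply, mul_comm]
  have hi := hn.inv (by simp [hx])
  have hc : HasDerivAt (fun t : ℝ => (x.1 + t • w) i) (w i) 0 := by
    simpa using ((hasDerivAt_id (0 : ℝ)).mul_const (w i)).const_add (x.1 i)
  have := (hi.mul hc).ofReal_comp
  refine this.congr_deriv (congrArg _ ?_)
  simp only [Pi.inv_apply, zero_smul, add_zero, hx]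
  ring

lemma radialExt_line {p q : ℕ} (φ : Prd p q → ℂ) (z : Prd p q)
    (P : MvPolynomial (Fin (p + 1) ⊕ Fin (q + 1)) ℂ) (hP : ∀ z, φ z = eval (coords z) P)
    (w : EuclideanSpace ℝ (Fin (p + 1)) × EuclideanSpace ℝ (Fin (q + 1))) :
    (fun t : ℝ => radialExt φ ((z.1.1, z.2.1) + t • w)) =ᶠ[nhds 0] fun t => eval (Sum.elim
      (fun i => (((‖z.1.1 + t • w.1‖⁻¹ * (z.1.1 + t • w.1) i : ℝ)) : ℂ))
      (fun i => (((‖z.2.1 + t • w.2‖⁻¹ * (z.2.1 + t • w.2) i : ℝ)) : ℂ))) P := by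
  have key : ∀ (d : ℕ) (x : Sph d) (v : EuclideanSpace ℝ (Fin (d + 1))),
      ∀ᶠ t : ℝ in nhds 0, x.1 + t • v ≠ 0 := by
    intro d x v
    have hc : ContinuousAt (fun t : ℝ => x.1 + t • v) 0 := by fun_prop
    refine hc.eventually_ne ?_
    have hx : ‖x.1‖ = 1 := by simp
    intro h
    simp only [zero_smul, add_zero] at h
    simp [h] at hx
  filter_upwards [key p z.1 w.1, key q z.2 w.2] with t h1 h2
  rw [radialExt, dif_pos ⟨by simpa using h1, by simpa using h2⟩, hP]
  rfl

lemma exists_lieDeriv {p q : ℕ} (A : Mat p q) (P : MvPolynomial (Fin (p + 1) ⊕ Fin (q + 1)) ℂ) :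
    ∃ Q : MvPolynomial (Fin (p + 1) ⊕ Fin (q + 1)) ℂ, ∀ z : Prd p q,
      HasDerivAt (fun t : ℝ => eval (Sum.elim
        (fun i => (((‖z.1.1 + t • (linFieldProd A z).1‖⁻¹ *
          (z.1.1 + t • (linFieldProd A z).1) i : ℝ)) : ℂ))
        (fun i => (((‖z.2.1 + t • (linFieldProd A z).2‖⁻¹ *
          (z.2.1 + t • (linFieldProd A z).2) i : ℝ)) : ℂ))) P) (eval (coords z) Q) 0 := by
  induction P using MvPolynomial.induction_on with
  | C a => exact ⟨0, fun z => by simpa using hasDerivAt_const (0 : ℝ) a⟩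
  | add P Q hP hQ =>
    obtain ⟨P', hP⟩ := hP
    obtain ⟨Q', hQ⟩ := hQ
    exact ⟨P' + Q', fun z => by simp only [map_add]; exact (hP z).add (hQ z)⟩
  | mul_X P s h =>
    obtain ⟨P', h⟩ := h
    have hz1 : ∀ z : Prd p q, ‖z.1.1‖ = 1 := fun z => by simp
    have hz2 : ∀ z : Prd p q, ‖z.2.1‖ = 1 := fun z => by simp
    rcases s with i | i
    · refine ⟨P' * X (Sum.inl i) + P * (linPoly A (Sum.inl i) -
        (∑ l, X (Sum.inl l) * linPoly A (Sum.inl l)) * X (Sum.inl i)), fun z => ?_⟩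
      have := (h z).mul (hasDerivAt_normalize z.1 (linFieldProd A z).1 i)
      simp only [map_mul, eval_X, Sum.elim_inl]
      refine this.congr_deriv ?_
      simp only [map_add, map_mul, map_sub, map_sum, eval_X, eval_linPoly, linFieldProd, zero_smul,
        add_zero, hz1, hz2, inv_one, one_mul]
      push_cast
      simp only [coords, Sum.elim_inl]
    · refine ⟨P' * X (Sum.inr i) + P * (linPoly A (Sum.inr i) -
        (∑ l, X (Sum.inr l) * linPoly A (Sum.inr l)) * X (Sum.inr i)), fun z => ?_⟩
      have := (h z).mul (hasDerivAt_normalize z.2 (linFieldProd A z).2 i)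
      simp only [map_mul, eval_X, Sum.elim_inr]
      refine this.congr_deriv ?_
      simp only [map_add, map_mul, map_sub, map_sum, eval_X, eval_linPoly, linFieldProd, zero_smul,
        add_zero, hz1, hz2, inv_one, one_mul]
      push_cast
      simp only [coords, Sum.elim_inr]

lemma confAct_mem {p q : ℕ} (hp : 1 ≤ p) (hq : 1 ≤ q) (a : ℂ) (A : Mat p q)
    {φ : Prd p q → ℂ} (hφ : φ ∈ KFinite p q) : confAct a A φ ∈ KFinite p q := by
  obtain ⟨P, hP⟩ := (mem_KFinite_iff hp hq).1 hφ
  obtain ⟨Q, hQ⟩ := exists_lieDeriv A P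
  refine (mem_KFinite_iff hp hq).2
    ⟨Q + C a * (-∑ i, X (Sum.inl i) * linPoly A (Sum.inl i)) * P, fun z => ?_⟩
  have h1 : lieDeriv A φ z = eval (coords z) Q := by
    rw [lieDeriv, lineDeriv]
    exact ((hQ z).congr_of_eventuallyEq
      (radialExt_line φ z P hP (linFieldProd A z))).deriv
  rw [confAct, h1, hP]
  simp only [map_add, map_mul, map_neg, map_sum, eval_X, eval_C, eval_linPoly, confFactor]
  push_cast
  simp only [coords, Sum.elim_inl]

/-! ### Intertwinors and the spectral function -/

/-- `A` is an intertwinor of order `2r` on the `(𝔤, K)`-module of `K`-finite functions on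
`S^p × S^q`: it commutes with `K = SO(p+1) × SO(q+1)`, and with `n = p + q`
`A (𝓛_X + (n/2 - r) ϖ_X) = (𝓛_X + (n/2 + r) ϖ_X) A` for all `X ∈ 𝔤 = so(p+1,q+1)`. -/
structure IsIntertwinor {p q : ℕ} (hp : 1 ≤ p) (hq : 1 ≤ q) (r : ℂ)
    (A : KFinite p q →ₗ[ℂ] KFinite p q) : Prop where
  comm_K : ∀ (k₁ : EuclideanSpace ℝ (Fin (p + 1)) ≃ₗᵢ[ℝ] EuclideanSpace ℝ (Fin (p + 1)))
    (k₂ : EuclideanSpace ℝ (Fin (q + 1)) ≃ₗᵢ[ℝ] EuclideanSpace ℝ (Fin (q + 1))),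
    LinearMap.det (k₁.toLinearEquiv : EuclideanSpace ℝ (Fin (p + 1)) →ₗ[ℝ] _) = 1 →
    LinearMap.det (k₂.toLinearEquiv : EuclideanSpace ℝ (Fin (q + 1)) →ₗ[ℝ] _) = 1 →
    ∀ φ : KFinite p q,
      A ⟨rotAct k₁ k₂ φ, rotAct_mem hp hq k₁ k₂ φ.2⟩ =
        ⟨rotAct k₁ k₂ (A φ), rotAct_mem hp hq k₁ k₂ (A φ).2⟩
  comm_g : ∀ X ∈ LieAlgebra.Orthogonal.so' (Fin (p + 1)) (Fin (q + 1)) ℝ, ∀ φ : KFinite p q,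
    A ⟨confAct (((p : ℂ) + q) / 2 - r) X φ, confAct_mem hp hq _ X φ.2⟩ =
      ⟨confAct (((p : ℂ) + q) / 2 + r) X (A φ), confAct_mem hp hq _ X (A φ).2⟩

/-- `J = j + (p-1)/2`, and likewise `K = k + (q-1)/2` is `shift q k`. -/
def shift (p j : ℕ) : ℂ := j + ((p : ℂ) - 1) / 2

/-- The numerator of the spectral function. -/
def spectralNum (p q ε : ℕ) (r : ℂ) (j k : ℕ) : ℂ :=
  Complex.Gamma ((shift q k + shift p j + 1 + r) / 2) *
  Complex.Gamma ((shift q k - shift p j + 1 + r) / 2) *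
  Complex.Gamma ((ε - ((p : ℂ) - q) / 2 + 1 - r) / 2) *
  Complex.Gamma ((ε + ((p : ℂ) + q) / 2 - r) / 2)

/-- The spectral function `Z_ε(r; j, k)`; its denominator is the numerator at `-r`. -/
def spectralZ (p q ε : ℕ) (r : ℂ) (j k : ℕ) : ℂ :=
  spectralNum p q ε r j k / spectralNum p q ε (-r) j k

/-- On the parity `ε`, no Gamma function in the numerator or the denominator of `Z_ε(r; j, k)` is
evaluated at one of its poles `0, -1, -2, …`. (The values at `(j, k) = (0, ε)` include those of the
Gamma factors that do not depend on `(j, k)`.) -/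
def NoPole (p q ε : ℕ) (r : ℂ) : Prop :=
  ∀ j k : ℕ, (j + k) % 2 = ε → ∀ m : ℕ,
    (shift q k + shift p j + 1 + r) / 2 ≠ -m ∧ (shift q k + shift p j + 1 - r) / 2 ≠ -m ∧
    (shift q k - shift p j + 1 + r) / 2 ≠ -m ∧ (shift q k - shift p j + 1 - r) / 2 ≠ -m

end SphereProduct

end

open SphereProduct

/-!
Throughout, `P` and `Q` are homogeneous harmonic polynomials of degrees `j` and `k`, and `P ⊗ Q` is
the function `P(u) Q(v)` on `S^p × S^q`. On the sphere a coordinate times a harmonic polynomial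
splits as `x_i P = P_i⁺ + P_i⁻`, with `P_i⁻ = (d - 1 + 2j)⁻¹ ∂_i P` of degree `j - 1` and `P_i⁺` of
degree `j + 1` (`raisePoly`, `lowerPoly`, `restrictSph_X_mul`). Consequently `U_a(X)` is explicit
(`confOp_tens`): the compact blocks of `X` rotate the two factors, and the boost in the plane of
`u_i`, `v_l` sends `P ⊗ Q` to the four components of `(u_i P) ⊗ (v_l Q)`, with coefficients affine
in `j`, `k` and `a`. The Casimir operators of the two rotation algebras separate the K-types
(`eigenspace_casimirOp`), so the sum of the `V(j,k)` is direct and every intertwinor preserves each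
of them.

*Existence.* An operator that acts by scalars `μ(j,k)` intertwines as soon as `μ` satisfies two
first order recurrences, one for each diagonal direction (`exists_isIntertwinor`). For the Gamma
quotient these are `Γ(s + 1) = s Γ(s)`.

*Uniqueness away from the poles.* No irreducibility is needed, which covers the circles `p = 1` and
`q = 1` as well. An intertwinor is a scalar on `V(0,ε)`: that space is one-dimensional for `ε = 0`,
and for `ε = 1` the `V(1,0)`-component of the boosts pins down the matrix on linear functions
(`IsIntertwinor.exists_scalar_base`). Subtracting a multiple of the intertwinor already constructed
gives an intertwinor that vanishes on `V(0,ε)`. Its kernel is stable under the boosts, whose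
coefficients are non-zero away from the poles, and the `P_i^±` span the harmonics of degree `j ± 1`;
hence it vanishes on all K-types of parity `ε` (`IsIntertwinor.kTypeSub_le_ker`).

*Scalars for `p, q ≥ 2`, all `r`.* This is Schur's lemma for harmonic polynomials on `ℝ^{d+1}`,
`d ≥ 2` (`exists_scalar_of_comm_angular`), applied in each variable separately. With
`z = x_s + i x_t`, the only vectors killed by the operators `z ∂_m - 2 x_m ∂_z̄` are the multiples
of `z ^ j` (`exists_eq_smul_of_weightRaise`), so that every non-zero invariant subspace contains
`z ^ j`. If `T` commutes with rotations then `T z^j = c z^j`; were the image of `T - c` non-zero, it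
would contain `z ^ j` although `T - c` kills the whole one-dimensional weight space of `z ^ j`.
-/

noncomputable section

namespace SphereProduct

open MvPolynomial

/-! ### Ladder operators on harmonic polynomials -/

/-- The homogeneous harmonic polynomials of degree `j` in `x_0, …, x_d`. -/
def harmPoly (d j : ℕ) : Submodule ℂ (MvPolynomial (Fin (d + 1)) ℂ) :=
  homogeneousSubmodule (Fin (d + 1)) ℂ j ⊓ LinearMap.ker (polyLaplacian d)

lemma mem_harmPoly {d j : ℕ} {P : MvPolynomial (Fin (d + 1)) ℂ} :
    P ∈ harmPoly d j ↔ P.IsHomogeneous j ∧ polyLaplacian d P = 0 := by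
  simp [harmPoly]

lemma restrictSph_mem {d j : ℕ} {P : MvPolynomial (Fin (d + 1)) ℂ} (hP : P ∈ harmPoly d j) :
    restrictSph d P ∈ harmonics d j :=
  Submodule.mem_map_of_mem hP

lemma restrictSph_apply {d : ℕ} (P : MvPolynomial (Fin (d + 1)) ℂ) (x : Sph d) :
    restrictSph d P x = eval (fun i => ((x.1 i : ℝ) : ℂ)) P := rfl

lemma pderiv_eq_zero_of_degree_zero {d : ℕ} {P : MvPolynomial (Fin (d + 1)) ℂ}
    (hP : P.IsHomogeneous 0) (i : Fin (d + 1)) : pderiv i P = 0 := by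
  obtain ⟨a, rfl⟩ : ∃ a, P = C a := ⟨_, (totalDegree_eq_zero_iff_eq_C.1 (by
    simpa using hP.totalDegree_le))⟩
  simp

lemma polyLaplacian_pderiv {d : ℕ} (i : Fin (d + 1)) (P : MvPolynomial (Fin (d + 1)) ℂ) :
    polyLaplacian d (pderiv i P) = pderiv i (polyLaplacian d P) := by
  simp only [polyLaplacian_apply, map_sum]
  refine Finset.sum_congr rfl fun l _ => ?_
  rw [pderiv_comm' l i P, pderiv_comm' l i]

lemma pderiv_mem_harmPoly {d j : ℕ} {P : MvPolynomial (Fin (d + 1)) ℂ} (hP : P ∈ harmPoly d j)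
    (i : Fin (d + 1)) : pderiv i P ∈ harmPoly d (j - 1) := by
  rw [mem_harmPoly] at hP ⊢
  exact ⟨hP.1.pderiv, by rw [polyLaplacian_pderiv, hP.2, map_zero]⟩

/-- The constant `d - 1 + 2j` relating `∂ᵢ` to the degree-lowering part of multiplication by `xᵢ` on
harmonic polynomials of degree `j`. -/
def ladderConst (d j : ℕ) : ℂ := d - 1 + 2 * j

lemma ladderConst_ne_zero {d j : ℕ} (hd : 1 ≤ d) (hj : 0 < j) : ladderConst d j ≠ 0 := by
  have : ladderConst d j = ((d - 1 + 2 * j : ℕ) : ℂ) := by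
    rw [ladderConst]; push_cast [hd]; ring
  rw [this]; exact_mod_cast (by omega)

/-- On the sphere, the component of degree `j - 1` of `xᵢ P`, for `P` harmonic of degree `j`.
(For `d = 1`, `j = 0` the constant vanishes, but so does `∂ᵢ P`.) -/
def lowerPoly (d j : ℕ) (i : Fin (d + 1)) (P : MvPolynomial (Fin (d + 1)) ℂ) :
    MvPolynomial (Fin (d + 1)) ℂ := (ladderConst d j)⁻¹ • pderiv i P

/-- On the sphere, the component of degree `j + 1` of `xᵢ P`, for `P` harmonic of degree `j`. -/
def raisePoly (d j : ℕ) (i : Fin (d + 1)) (P : MvPolynomial (Fin (d + 1)) ℂ) :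
    MvPolynomial (Fin (d + 1)) ℂ := X i * P - (∑ l, X l ^ 2) * lowerPoly d j i P

lemma lowerPoly_mem {d j : ℕ} {P : MvPolynomial (Fin (d + 1)) ℂ} (hP : P ∈ harmPoly d j)
    (i : Fin (d + 1)) : lowerPoly d j i P ∈ harmPoly d (j - 1) :=
  Submodule.smul_mem _ _ (pderiv_mem_harmPoly hP i)

lemma lowerPoly_zero {d : ℕ} {P : MvPolynomial (Fin (d + 1)) ℂ} (hP : P ∈ harmPoly d 0)
    (i : Fin (d + 1)) : lowerPoly d 0 i P = 0 := by
  rw [lowerPoly, pderiv_eq_zero_of_degree_zero (mem_harmPoly.1 hP).1, smul_zero]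

lemma pderiv_eq_smul_lowerPoly {d j : ℕ} (hd : 1 ≤ d) {P : MvPolynomial (Fin (d + 1)) ℂ}
    (hP : P ∈ harmPoly d j) (i : Fin (d + 1)) :
    pderiv i P = ladderConst d j • lowerPoly d j i P := by
  rcases Nat.eq_zero_or_pos j with rfl | hj
  · rw [lowerPoly_zero hP, pderiv_eq_zero_of_degree_zero (mem_harmPoly.1 hP).1, smul_zero]
  · rw [lowerPoly, smul_inv_smul₀ (ladderConst_ne_zero hd hj)]

lemma isHomogeneous_sum_sq (d : ℕ) :
    (∑ l : Fin (d + 1), (X l : MvPolynomial (Fin (d + 1)) ℂ) ^ 2).IsHomogeneous 2 :=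
  IsHomogeneous.sum _ _ _ fun l _ => by simpa using (isHomogeneous_X ℂ l).pow 2

lemma raisePoly_mem {d j : ℕ} (hd : 1 ≤ d) {P : MvPolynomial (Fin (d + 1)) ℂ}
    (hP : P ∈ harmPoly d j) (i : Fin (d + 1)) : raisePoly d j i P ∈ harmPoly d (j + 1) := by
  have hl := lowerPoly_mem hP i
  have hX : (X i * P).IsHomogeneous (j + 1) := by
    have := (isHomogeneous_X ℂ i).mul (mem_harmPoly.1 hP).1
    rwa [add_comm 1 j] at this
  rw [mem_harmPoly] at hl ⊢
  rcases Nat.eq_zero_or_pos j with rfl | hj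
  · rw [raisePoly, lowerPoly_zero hP, mul_zero, sub_zero, laplacian_X_mul, (mem_harmPoly.1 hP).2,
      pderiv_eq_zero_of_degree_zero (mem_harmPoly.1 hP).1]
    exact ⟨hX, by simp⟩
  · refine ⟨hX.sub ?_, ?_⟩
    · have := (isHomogeneous_sum_sq d).mul hl.1
      have e : 2 + (j - 1) = j + 1 := by omega
      rwa [e] at this
    · rw [raisePoly, map_sub, laplacian_X_mul, (mem_harmPoly.1 hP).2, laplacian_sq_mul hl.1 hl.2,
        pderiv_eq_smul_lowerPoly hd hP]
      have : (2 * (d + 1) + 4 * ((j - 1 : ℕ) : ℂ)) = 2 * ladderConst d j := by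
        rw [ladderConst]; push_cast [hj]; ring
      rw [this, mul_smul, two_smul ℂ]
      ring

/-- On the sphere, `xᵢ P` is the sum of its two harmonic components. -/
lemma restrictSph_X_mul {d : ℕ} (j : ℕ) (i : Fin (d + 1)) (P : MvPolynomial (Fin (d + 1)) ℂ) :
    restrictSph d (X i * P) =
      restrictSph d (raisePoly d j i P) + restrictSph d (lowerPoly d j i P) := by
  ext x
  simp [restrictSph_apply, raisePoly, sum_sq_sph]

/-- Every harmonic polynomial of degree `j + 1` is a combination of raised ones. -/
lemma sum_raisePoly {d j : ℕ} {P : MvPolynomial (Fin (d + 1)) ℂ} (hP : P ∈ harmPoly d (j + 1)) :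
    ∑ i, raisePoly d j i (pderiv i P) = ((j : ℂ) + 1) • P := by
  rw [mem_harmPoly] at hP
  simp only [raisePoly, lowerPoly, Finset.sum_sub_distrib, ← Finset.mul_sum, ← Finset.smul_sum]
  rw [← polyLaplacian_apply, hP.2, hP.1.sum_X_mul_pderiv]
  simp [← Nat.cast_smul_eq_nsmul ℂ, smul_eq_C_mul]

lemma pderiv_sum_sq {d : ℕ} (i : Fin (d + 1)) :
    pderiv i (∑ l, X l ^ 2 : MvPolynomial (Fin (d + 1)) ℂ) = 2 * X i := by
  rw [map_sum, Finset.sum_eq_single i]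
  · simp
  · intro l _ hl
    simp [Derivation.leibniz_pow, pderiv_X_of_ne hl]
  · simp

/-- Every harmonic polynomial of degree `j` is a combination of lowered ones. -/
lemma exists_sum_lowerPoly {d j : ℕ} (hd : 1 ≤ d) {P : MvPolynomial (Fin (d + 1)) ℂ}
    (hP : P ∈ harmPoly d j) :
    ∃ c : ℂ, c ≠ 0 ∧ ∑ i, lowerPoly d (j + 1) i (raisePoly d j i P) = c • P := by
  have hP' := mem_harmPoly.1 hP
  have h1 : ∑ i, pderiv i (X i * P) = ((d : ℂ) + 1 + j) • P := by
    simp only [Derivation.leibniz, pderiv_X_self, smul_eq_mul, mul_one, Finset.sum_add_distrib]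
    rw [hP'.1.sum_X_mul_pderiv]
    simp [← Nat.cast_smul_eq_nsmul ℂ, smul_eq_C_mul]
    ring
  have h2 : ∑ i, pderiv i ((∑ l, X l ^ 2) * lowerPoly d j i P) =
      (2 * j * (ladderConst d j)⁻¹) • P := by
    have hL : ∑ i, pderiv i (lowerPoly d j i P) = 0 := by
      simp only [lowerPoly, Derivation.map_smul, ← Finset.smul_sum]
      rw [← polyLaplacian_apply, hP'.2, smul_zero]
    simp only [Derivation.leibniz, smul_eq_mul, Finset.sum_add_distrib, ← Finset.mul_sum, hL,
      pderiv_sum_sq, mul_zero, zero_add]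
    have : ∀ i, lowerPoly d j i P * (2 * X i) = (2 * (ladderConst d j)⁻¹) • (X i * pderiv i P) := by
      intro i
      simp only [lowerPoly, smul_eq_C_mul, map_mul, map_ofNat]
      ring
    simp only [this, ← Finset.smul_sum]
    rw [hP'.1.sum_X_mul_pderiv, ← Nat.cast_smul_eq_nsmul ℂ, smul_smul]
    congr 1
    ring
  refine ⟨(ladderConst d (j + 1))⁻¹ * ((d : ℂ) + 1 + j - 2 * j * (ladderConst d j)⁻¹), ?_, ?_⟩
  · refine mul_ne_zero (inv_ne_zero (ladderConst_ne_zero hd j.succ_pos)) ?_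
    rcases Nat.eq_zero_or_pos j with rfl | hj
    · simp; exact_mod_cast (by omega : d + 1 ≠ 0)
    · have hc := ladderConst_ne_zero hd hj
      intro h
      have h' : ((d : ℂ) + 1 + j) * ladderConst d j = 2 * j := by
        field_simp at h
        linear_combination h
      obtain ⟨e, rfl⟩ : ∃ e, d = e + 1 := ⟨d - 1, by omega⟩
      have h3 : (e + 1 + 1 + j) * (e + 2 * j) = 2 * j := by
        have : ((e : ℂ) + 1 + 1 + j) * (e + 2 * j) = 2 * j := by
          rw [ladderConst] at h'
          push_cast at h'
          linear_combination h'
        exact_mod_cast this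
      nlinarith
  · simp only [lowerPoly, raisePoly, ← Finset.smul_sum, map_sub, Finset.sum_sub_distrib]
    rw [h1]
    have := h2
    simp only [lowerPoly] at this
    rw [this, ← sub_smul, smul_smul]

/-! ### Infinitesimal rotations of polynomials -/

/-- The derivation `x_m ∂ᵢ - xᵢ ∂_m` of the polynomial ring, an infinitesimal rotation. -/
def angular {d : ℕ} (i m : Fin (d + 1)) :
    Derivation ℂ (MvPolynomial (Fin (d + 1)) ℂ) (MvPolynomial (Fin (d + 1)) ℂ) :=
  X (R := ℂ) m • pderiv i - X (R := ℂ) i • pderiv m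

lemma angular_apply {d : ℕ} (i m : Fin (d + 1)) (P : MvPolynomial (Fin (d + 1)) ℂ) :
    angular i m P = X m * pderiv i P - X i * pderiv m P := by
  simp [angular]

/-- The linear vector field of the matrix `a` acting on polynomials. -/
def rotPoly {d : ℕ} (a : Matrix (Fin (d + 1)) (Fin (d + 1)) ℝ)
    (P : MvPolynomial (Fin (d + 1)) ℂ) : MvPolynomial (Fin (d + 1)) ℂ :=
  ∑ i, ∑ m, C ((a i m : ℝ) : ℂ) * (X m * pderiv i P)

lemma IsHomogeneous.X_mul_pderiv {d j : ℕ} {P : MvPolynomial (Fin (d + 1)) ℂ}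
    (hP : P.IsHomogeneous j) (i m : Fin (d + 1)) : (X m * pderiv i P).IsHomogeneous j := by
  rcases Nat.eq_zero_or_pos j with rfl | hj
  · rw [pderiv_eq_zero_of_degree_zero hP, mul_zero]; exact isHomogeneous_zero _ _ _
  · have := (isHomogeneous_X ℂ m).mul (hP.pderiv (i := i))
    rwa [show 1 + (j - 1) = j by omega] at this

lemma rotPoly_mem {d j : ℕ} {a : Matrix (Fin (d + 1)) (Fin (d + 1)) ℝ}
    (ha : ∀ i m, a i m = -a m i) {P : MvPolynomial (Fin (d + 1)) ℂ} (hP : P ∈ harmPoly d j) :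
    rotPoly a P ∈ harmPoly d j := by
  rw [mem_harmPoly] at hP ⊢
  refine ⟨IsHomogeneous.sum _ _ _ fun i _ => IsHomogeneous.sum _ _ _ fun m _ => ?_, ?_⟩
  · simpa using (isHomogeneous_C (Fin (d + 1)) _).mul (IsHomogeneous.X_mul_pderiv hP.1 i m)
  · have h1 : ∀ i m, polyLaplacian d (C ((a i m : ℝ) : ℂ) * (X m * pderiv i P)) =
        C ((a i m : ℝ) : ℂ) * (2 * pderiv m (pderiv i P)) := by
      intro i m
      rw [← smul_eq_C_mul, map_smul, laplacian_X_mul, polyLaplacian_pderiv, hP.2, smul_eq_C_mul]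
      simp
    simp only [rotPoly, map_sum, h1]
    -- the sum of a skew against a symmetric matrix equals its own negative
    have key : ∑ i, ∑ m, C ((a i m : ℝ) : ℂ) * (2 * pderiv m (pderiv i P)) =
        -∑ i, ∑ m, C ((a i m : ℝ) : ℂ) * (2 * pderiv m (pderiv i P)) := by
      conv_lhs => rw [Finset.sum_comm]
      simp only [← Finset.sum_neg_distrib]
      refine Finset.sum_congr rfl fun m _ => Finset.sum_congr rfl fun i _ => ?_
      rw [ha i m, pderiv_comm' m i]
      simp
    exact self_eq_neg.1 key

lemma angular_mem {d j : ℕ} (i m : Fin (d + 1)) {P : MvPolynomial (Fin (d + 1)) ℂ}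
    (hP : P ∈ harmPoly d j) : angular i m P ∈ harmPoly d j := by
  rw [mem_harmPoly] at hP ⊢
  rw [angular_apply]
  refine ⟨(IsHomogeneous.X_mul_pderiv hP.1 i m).sub (IsHomogeneous.X_mul_pderiv hP.1 m i), ?_⟩
  rw [map_sub, laplacian_X_mul, laplacian_X_mul, polyLaplacian_pderiv, polyLaplacian_pderiv, hP.2,
    pderiv_comm' i m]
  simp

/-- The Casimir operator of `so(d+1)` on harmonic polynomials of degree `j`. -/
lemma sum_angular_angular {d j : ℕ} {P : MvPolynomial (Fin (d + 1)) ℂ} (hP : P ∈ harmPoly d j) :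
    ∑ i, ∑ m, angular i m (angular i m P) = (-2 * (j * (j + d - 1)) : ℂ) • P := by
  have hP' := mem_harmPoly.1 hP
  set E := ∑ i, X i * pderiv i P with hE
  have hE' : E = (j : ℂ) • P := by
    rw [hE, hP'.1.sum_X_mul_pderiv, Nat.cast_smul_eq_nsmul]
  have hEE : ∑ i, ∑ m, X i * (X m * pderiv i (pderiv m P)) = ((j : ℂ) * (j - 1)) • P := by
    have : ∀ i, ∑ m, X i * (X m * pderiv i (pderiv m P)) = ((j : ℂ) - 1) • (X i * pderiv i P) := by
      intro i
      rw [← Finset.mul_sum]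
      simp only [pderiv_comm' i]
      rw [(hP'.1.pderiv (i := i)).sum_X_mul_pderiv, ← Nat.cast_smul_eq_nsmul ℂ]
      rcases Nat.eq_zero_or_pos j with rfl | hj
      · rw [pderiv_eq_zero_of_degree_zero hP'.1]; simp
      · rw [mul_smul_comm]; congr 1; push_cast [hj]; ring
    simp only [this, ← Finset.smul_sum]
    rw [← hE, hE', smul_smul, mul_comm]
  have hs : ∀ i m : Fin (d + 1),
      angular i m (angular i m P) = X m * (X m * pderiv i (pderiv i P)) +
        X i * (X i * pderiv m (pderiv m P)) - X m * pderiv m P - X i * pderiv i P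
        - X i * (X m * pderiv i (pderiv m P)) - X m * (X i * pderiv m (pderiv i P)) +
        (if i = m then X m * pderiv i P + X i * pderiv m P else 0) := by
    intro i m
    by_cases h : i = m
    · subst h; simp [angular_apply]; ring
    · simp only [angular_apply, map_sub, Derivation.leibniz, pderiv_X_self, smul_eq_mul,
        pderiv_X_of_ne h, pderiv_X_of_ne (Ne.symm h), if_neg h, pderiv_comm' m i]
      ring
  simp only [hs, Finset.sum_add_distrib, Finset.sum_sub_distrib, Finset.sum_ite_eq,
    Finset.mem_univ, if_true]
  have hL : ∀ i : Fin (d + 1), ∑ m, X i * (X i * pderiv m (pderiv m P)) = 0 := by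
    intro i
    rw [← Finset.mul_sum, ← Finset.mul_sum, ← polyLaplacian_apply, hP'.2]; simp
  have hL2 : ∑ i : Fin (d + 1), ∑ m, X m * (X m * pderiv i (pderiv i P)) = 0 := by
    rw [Finset.sum_comm]; simp [hL]
  have hEE2 : ∑ i, ∑ m, X m * (X i * pderiv m (pderiv i P)) = ((j : ℂ) * (j - 1)) • P := by
    rw [Finset.sum_comm]; exact hEE
  have h1 : ∑ _i : Fin (d + 1), ∑ m, X m * pderiv m P = (((d : ℂ) + 1) * j) • P := by
    rw [← hE, hE', Finset.sum_const, Finset.card_univ, Fintype.card_fin,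
      ← Nat.cast_smul_eq_nsmul ℂ, smul_smul]
    push_cast; rfl
  have h2 : ∑ i, ∑ _m : Fin (d + 1), X i * pderiv i P = (((d : ℂ) + 1) * j) • P := by
    rw [Finset.sum_comm]; exact h1
  rw [hL2, hEE, hEE2, h1, h2]
  simp only [hL, ← hE, hE', Finset.sum_const_zero]
  module

lemma rotPoly_single {d : ℕ} (i m : Fin (d + 1)) (P : MvPolynomial (Fin (d + 1)) ℂ) :
    rotPoly (Matrix.single i m 1 - Matrix.single m i 1) P = angular i m P := by
  simp only [rotPoly, angular_apply, Matrix.sub_apply, Matrix.single_apply]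
  push_cast
  simp only [map_sub, sub_mul, Finset.sum_sub_distrib, ite_and, apply_ite C, apply_ite (Complex.ofReal)]
  simp

section

/-! ### The Lie derivative on tensor products of harmonic polynomials -/

variable {p q : ℕ}

lemma tensorFun_restrictSph_mem (hp : 1 ≤ p) (hq : 1 ≤ q) (P : MvPolynomial (Fin (p + 1)) ℂ)
    (Q : MvPolynomial (Fin (q + 1)) ℂ) :
    tensorFun (restrictSph p P) (restrictSph q Q) ∈ KFinite p q := by
  refine (mem_KFinite_iff hp hq).2 ⟨rename Sum.inl P * rename Sum.inr Q, fun z => ?_⟩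
  simp only [tensorFun, restrictSph_apply, map_mul, eval_rename]
  rfl

/-- The bilinear map sending polynomials `P`, `Q` to the `K`-finite function `P(u) Q(v)`. -/
def tens (hp : 1 ≤ p) (hq : 1 ≤ q) : MvPolynomial (Fin (p + 1)) ℂ →ₗ[ℂ]
    MvPolynomial (Fin (q + 1)) ℂ →ₗ[ℂ] KFinite p q :=
  LinearMap.mk₂ ℂ (fun P Q => ⟨tensorFun (restrictSph p P) (restrictSph q Q),
    tensorFun_restrictSph_mem hp hq P Q⟩)
    (fun P P' Q => Subtype.ext <| funext fun z => by
      change restrictSph p (P + P') z.1 * restrictSph q Q z.2 =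
        restrictSph p P z.1 * restrictSph q Q z.2 + restrictSph p P' z.1 * restrictSph q Q z.2
      rw [map_add, Pi.add_apply, add_mul])
    (fun c P Q => Subtype.ext <| funext fun z => by
      change restrictSph p (c • P) z.1 * restrictSph q Q z.2 =
        c * (restrictSph p P z.1 * restrictSph q Q z.2)
      rw [map_smul, Pi.smul_apply, smul_eq_mul, mul_assoc])
    (fun P Q Q' => Subtype.ext <| funext fun z => by
      change restrictSph p P z.1 * restrictSph q (Q + Q') z.2 =
        restrictSph p P z.1 * restrictSph q Q z.2 + restrictSph p P z.1 * restrictSph q Q' z.2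
      rw [map_add, Pi.add_apply, mul_add])
    (fun c P Q => Subtype.ext <| funext fun z => by
      change restrictSph p P z.1 * restrictSph q (c • Q) z.2 =
        c * (restrictSph p P z.1 * restrictSph q Q z.2)
      rw [map_smul, Pi.smul_apply, smul_eq_mul, mul_left_comm])

lemma tens_apply (hp : 1 ≤ p) (hq : 1 ≤ q) (P : MvPolynomial (Fin (p + 1)) ℂ)
    (Q : MvPolynomial (Fin (q + 1)) ℂ) (z : Prd p q) :
    (tens hp hq P Q : Prd p q → ℂ) z = restrictSph p P z.1 * restrictSph q Q z.2 := rfl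

/-- The derivative of a polynomial along a radially normalized line through a point of the sphere. -/
lemma hasDerivAt_eval_normalize {d : ℕ} (P : MvPolynomial (Fin (d + 1)) ℂ) (x : Sph d)
    (w : EuclideanSpace ℝ (Fin (d + 1))) :
    HasDerivAt (fun t : ℝ => eval (fun i => (((‖x.1 + t • w‖⁻¹ * (x.1 + t • w) i : ℝ)) : ℂ)) P)
      (∑ i, restrictSph d (pderiv i P) x * ((w i - (∑ l, x.1 l * w l) * x.1 i : ℝ) : ℂ)) 0 := by
  have hx : ‖x.1‖ = 1 := by simp
  induction P using MvPolynomial.induction_on with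
  | C a => simpa using hasDerivAt_const (0 : ℝ) a
  | add P Q hP hQ =>
    simp only [map_add, Pi.add_apply, add_mul, Finset.sum_add_distrib]
    exact hP.add hQ
  | mul_X P s h =>
    have := h.mul (hasDerivAt_normalize x w s)
    simp only [map_mul, eval_X]
    refine this.congr_deriv ?_
    simp only [zero_smul, add_zero, hx, inv_one, one_mul, Derivation.leibniz, smul_eq_mul, map_add,
      restrictSph_apply, map_mul, eval_X, add_mul, Finset.sum_add_distrib]
    rw [add_comm]
    congr 1
    · refine Eq.symm ((Finset.sum_eq_single s ?_ ?_).trans ?_)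
      · intro l _ hl
        rw [pderiv_X_of_ne (Ne.symm hl)]; simp
      · simp
      · simp
    · rw [Finset.sum_mul]
      exact Finset.sum_congr rfl fun i _ => by ring

/-- Every `K`-finite function has directional derivatives after radial extension. -/
lemma exists_hasDerivAt_radialExt (hp : 1 ≤ p) (hq : 1 ≤ q) (X : Mat p q) {φ : Prd p q → ℂ}
    (hφ : φ ∈ KFinite p q) (z : Prd p q) :
    HasDerivAt (fun t : ℝ => radialExt φ ((z.1.1, z.2.1) + t • linFieldProd X z))
      (lieDeriv X φ z) 0 := by
  obtain ⟨P, hP⟩ := (mem_KFinite_iff hp hq).1 hφ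
  obtain ⟨Q, hQ⟩ := exists_lieDeriv X P
  have := (hQ z).congr_of_eventuallyEq (radialExt_line φ z P hP (linFieldProd X z))
  rw [lieDeriv, lineDeriv, this.deriv]
  exact this

lemma radialExt_add (φ ψ : Prd p q → ℂ) (w) :
    radialExt (φ + ψ) w = radialExt φ w + radialExt ψ w := by
  unfold radialExt
  split_ifs <;> simp

lemma radialExt_smul (c : ℂ) (φ : Prd p q → ℂ) (w) :
    radialExt (c • φ) w = c * radialExt φ w := by
  unfold radialExt
  split_ifs <;> simp

/-- The operator `U_a(X)` on `K`-finite functions, as a linear map. -/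
def confOp (hp : 1 ≤ p) (hq : 1 ≤ q) (a : ℂ) (X : Mat p q) : KFinite p q →ₗ[ℂ] KFinite p q where
  toFun φ := ⟨confAct a X φ, confAct_mem hp hq a X φ.2⟩
  map_add' φ ψ := by
    ext z
    have h := ((exists_hasDerivAt_radialExt hp hq X φ.2 z).add
      (exists_hasDerivAt_radialExt hp hq X ψ.2 z))
    have e : lieDeriv X (φ.1 + ψ.1) z = lieDeriv X φ.1 z + lieDeriv X ψ.1 z := by
      rw [← h.deriv, lieDeriv, lineDeriv]
      simp only [radialExt_add]
      rfl
    simp only [confAct, Submodule.coe_add, Pi.add_apply, e]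
    ring
  map_smul' c φ := by
    ext z
    have h := (exists_hasDerivAt_radialExt hp hq X φ.2 z).const_mul c
    have e : lieDeriv X (c • φ.1) z = c * lieDeriv X φ.1 z := by
      rw [← h.deriv, lieDeriv, lineDeriv]
      simp only [radialExt_smul]
    simp only [confAct, Submodule.coe_smul, Pi.smul_apply, e, smul_eq_mul, RingHom.id_apply]
    ring

/-- The Lie derivative of a product `P(u) Q(v)`. -/
lemma lieDeriv_tens (hp : 1 ≤ p) (hq : 1 ≤ q) (X : Mat p q) (P : MvPolynomial (Fin (p + 1)) ℂ)
    (Q : MvPolynomial (Fin (q + 1)) ℂ) (z : Prd p q) :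
    lieDeriv X (tens hp hq P Q : Prd p q → ℂ) z =
      (∑ i, restrictSph p (pderiv i P) z.1 * ((linField X z (Sum.inl i) -
        (∑ l, z.1.1 l * linField X z (Sum.inl l)) * z.1.1 i : ℝ) : ℂ)) * restrictSph q Q z.2 +
      restrictSph p P z.1 * (∑ i, restrictSph q (pderiv i Q) z.2 * ((linField X z (Sum.inr i) -
        (∑ l, z.2.1 l * linField X z (Sum.inr l)) * z.2.1 i : ℝ) : ℂ)) := by
  have h := radialExt_line (tens hp hq P Q : Prd p q → ℂ) z
    (rename Sum.inl P * rename Sum.inr Q) (fun z => by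
      simp only [tens_apply, restrictSph_apply, map_mul, eval_rename]; rfl) (linFieldProd X z)
  have hd := (hasDerivAt_eval_normalize P z.1 (linFieldProd X z).1).mul
    (hasDerivAt_eval_normalize Q z.2 (linFieldProd X z).2)
  rw [lieDeriv, lineDeriv]
  have := (hd.congr_of_eventuallyEq (h.trans (Filter.Eventually.of_forall fun t => by
    simp only [map_mul, eval_rename]; rfl))).deriv
  rw [this]
  have h1 : ‖z.1.1‖ = 1 := by simp
  have h2 : ‖z.2.1‖ = 1 := by simp
  simp only [zero_smul, add_zero, h1, h2, inv_one, one_mul, linFieldProd]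
  rfl

/-! ### The action of `so(p+1,q+1)` on the K-types -/

/-- The blocks of an element of `so(p+1,q+1)`: the diagonal ones are skew, the off-diagonal ones are
transposes of each other. -/
lemma so'_entries {X : Mat p q} (hX : X ∈ LieAlgebra.Orthogonal.so' (Fin (p + 1)) (Fin (q + 1)) ℝ) :
    (∀ i m, X (Sum.inl i) (Sum.inl m) = -X (Sum.inl m) (Sum.inl i)) ∧
    (∀ i m, X (Sum.inr i) (Sum.inr m) = -X (Sum.inr m) (Sum.inr i)) ∧
    (∀ i m, X (Sum.inr m) (Sum.inl i) = X (Sum.inl i) (Sum.inr m)) := by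
  have h : X.transpose * LieAlgebra.Orthogonal.indefiniteDiagonal (Fin (p + 1)) (Fin (q + 1)) ℝ =
      LieAlgebra.Orthogonal.indefiniteDiagonal (Fin (p + 1)) (Fin (q + 1)) ℝ * (-X) := by
    simpa [LieAlgebra.Orthogonal.so', Matrix.IsSkewAdjoint, Matrix.IsAdjointPair] using hX
  have h' := fun s t => congrFun (congrFun h s) t
  simp only [LieAlgebra.Orthogonal.indefiniteDiagonal, Matrix.mul_diagonal, Matrix.diagonal_mul,
    Matrix.transpose_apply, Matrix.neg_apply] at h'
  refine ⟨fun i m => ?_, fun i m => ?_, fun i m => ?_⟩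
  · have := h' (Sum.inl m) (Sum.inl i); simp at this; linarith
  · have := h' (Sum.inr m) (Sum.inr i); simp at this; linarith
  · have := h' (Sum.inl i) (Sum.inr m); simp at this; linarith

lemma mem_so'_of_entries {X : Mat p q}
    (h1 : ∀ i m, X (Sum.inl i) (Sum.inl m) = -X (Sum.inl m) (Sum.inl i))
    (h2 : ∀ i m, X (Sum.inr i) (Sum.inr m) = -X (Sum.inr m) (Sum.inr i))
    (h3 : ∀ i m, X (Sum.inr m) (Sum.inl i) = X (Sum.inl i) (Sum.inr m)) :
    X ∈ LieAlgebra.Orthogonal.so' (Fin (p + 1)) (Fin (q + 1)) ℝ := by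
  suffices h : X.transpose *
      LieAlgebra.Orthogonal.indefiniteDiagonal (Fin (p + 1)) (Fin (q + 1)) ℝ =
      LieAlgebra.Orthogonal.indefiniteDiagonal (Fin (p + 1)) (Fin (q + 1)) ℝ * (-X) by
    simpa [LieAlgebra.Orthogonal.so', Matrix.IsSkewAdjoint, Matrix.IsAdjointPair] using h
  ext s t
  simp only [LieAlgebra.Orthogonal.indefiniteDiagonal, Matrix.mul_diagonal, Matrix.diagonal_mul,
    Matrix.transpose_apply, Matrix.neg_apply]
  rcases s with i | i <;> rcases t with m | m
  · simp [h1 m i]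
  · simp [h3]
  · simp [h3]
  · simp [h2 m i]

/-- The effect of the boost in the plane of `u_i` and `v_l` on `P ⊗ Q`: the four components of
the product of `u_i P` and `v_l Q`, with their coefficients. -/
def boostTerm (hp : 1 ≤ p) (hq : 1 ≤ q) (a : ℂ) (j k : ℕ) (i : Fin (p + 1)) (l : Fin (q + 1))
    (P : MvPolynomial (Fin (p + 1)) ℂ) (Q : MvPolynomial (Fin (q + 1)) ℂ) : KFinite p q :=
  (-(j + k + a) : ℂ) • tens hp hq (raisePoly p j i P) (raisePoly q k l Q) +
  (k + q - 1 - j - a : ℂ) • tens hp hq (raisePoly p j i P) (lowerPoly q k l Q) +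
  (j + p - 1 - k - a : ℂ) • tens hp hq (lowerPoly p j i P) (raisePoly q k l Q) +
  (j + p - 1 + k + q - 1 - a : ℂ) • tens hp hq (lowerPoly p j i P) (lowerPoly q k l Q)

lemma boostTerm_apply (hp : 1 ≤ p) (hq : 1 ≤ q) (a : ℂ) {j k : ℕ} (i : Fin (p + 1))
    (l : Fin (q + 1)) {P : MvPolynomial (Fin (p + 1)) ℂ} {Q : MvPolynomial (Fin (q + 1)) ℂ}
    (hP : P ∈ harmPoly p j) (hQ : Q ∈ harmPoly q k) (z : Prd p q) :
    (boostTerm hp hq a j k i l P Q : Prd p q → ℂ) z =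
      ((z.2.1 l : ℝ) : ℂ) * restrictSph p (pderiv i P) z.1 * restrictSph q Q z.2 +
      ((z.1.1 i : ℝ) : ℂ) * restrictSph p P z.1 * restrictSph q (pderiv l Q) z.2 -
      (j + k + a) * (((z.1.1 i : ℝ) : ℂ) * ((z.2.1 l : ℝ) : ℂ)) *
        (restrictSph p P z.1 * restrictSph q Q z.2) := by
  have h1 : ((z.1.1 i : ℝ) : ℂ) * restrictSph p P z.1 =
      restrictSph p (raisePoly p j i P) z.1 + restrictSph p (lowerPoly p j i P) z.1 := by
    have := congrFun (restrictSph_X_mul j i P) z.1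
    simpa [restrictSph_apply] using this
  have h2 : ((z.2.1 l : ℝ) : ℂ) * restrictSph q Q z.2 =
      restrictSph q (raisePoly q k l Q) z.2 + restrictSph q (lowerPoly q k l Q) z.2 := by
    have := congrFun (restrictSph_X_mul k l Q) z.2
    simpa [restrictSph_apply] using this
  simp only [boostTerm, Submodule.coe_add, Submodule.coe_smul, Pi.add_apply, Pi.smul_apply,
    tens_apply, smul_eq_mul]
  rw [pderiv_eq_smul_lowerPoly hp hP, pderiv_eq_smul_lowerPoly hq hQ, map_smul, map_smul,
    Pi.smul_apply, Pi.smul_apply, smul_eq_mul, smul_eq_mul, ladderConst, ladderConst]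
  generalize restrictSph p (raisePoly p j i P) z.1 = P1 at *
  generalize restrictSph p (lowerPoly p j i P) z.1 = P2 at *
  generalize restrictSph q (raisePoly q k l Q) z.2 = Q1 at *
  generalize restrictSph q (lowerPoly q k l Q) z.2 = Q2 at *
  linear_combination (-((p : ℂ) - 1 + 2 * j) * P2 + (j + k + a) * (P1 + P2)) * h2 +
    (-((q : ℂ) - 1 + 2 * k) * Q2 + (j + k + a) * ((z.2.1 l : ℝ) : ℂ) * restrictSph q Q z.2) * h1

/-- The action of `so(p+1,q+1)` on a tensor product of harmonic polynomials: the compact blocks act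
by rotations, the boosts map `V(j,k)` to the four neighbours `V(j ± 1, k ± 1)`. -/
lemma confOp_tens (hp : 1 ≤ p) (hq : 1 ≤ q) (a : ℂ) {X : Mat p q}
    (hX : X ∈ LieAlgebra.Orthogonal.so' (Fin (p + 1)) (Fin (q + 1)) ℝ) {j k : ℕ}
    {P : MvPolynomial (Fin (p + 1)) ℂ} {Q : MvPolynomial (Fin (q + 1)) ℂ}
    (hP : P ∈ harmPoly p j) (hQ : Q ∈ harmPoly q k) :
    confOp hp hq a X (tens hp hq P Q) = tens hp hq (rotPoly X.toBlocks₁₁ P) Q +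
      tens hp hq P (rotPoly X.toBlocks₂₂ Q) +
      ∑ i, ∑ l, ((X (Sum.inl i) (Sum.inr l) : ℝ) : ℂ) • boostTerm hp hq a j k i l P Q := by
  obtain ⟨h1, h2, h3⟩ := so'_entries hX
  ext z
  have skew : ∀ {d : ℕ} (b : Matrix (Fin (d + 1)) (Fin (d + 1)) ℝ) (x : Fin (d + 1) → ℝ),
      (∀ i m, b i m = -b m i) → ∑ i, x i * ∑ m, b i m * x m = 0 := by
    intro d b x hb
    have : ∑ i, x i * ∑ m, b i m * x m = -∑ i, x i * ∑ m, b i m * x m := by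
      simp only [Finset.mul_sum]
      conv_lhs => rw [Finset.sum_comm]
      simp only [← Finset.sum_neg_distrib]
      refine Finset.sum_congr rfl fun i _ => Finset.sum_congr rfl fun m _ => ?_
      rw [hb m i]; ring
    linarith
  have hw1 : ∀ i, linField X z (Sum.inl i) = ∑ m, X (Sum.inl i) (Sum.inl m) * z.1.1 m +
      ∑ l, X (Sum.inl i) (Sum.inr l) * z.2.1 l := by
    intro i; simp [linField, Matrix.mulVec, dotProduct]
  have hw2 : ∀ l, linField X z (Sum.inr l) = ∑ m, X (Sum.inr l) (Sum.inr m) * z.2.1 m +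
      ∑ i, X (Sum.inl i) (Sum.inr l) * z.1.1 i := by
    intro i; simp [linField, Matrix.mulVec, dotProduct, h3]; ring
  set s : ℝ := ∑ i, ∑ l, X (Sum.inl i) (Sum.inr l) * (z.1.1 i * z.2.1 l) with hs
  have hs1 : ∑ i, z.1.1 i * linField X z (Sum.inl i) = s := by
    simp only [hw1, mul_add, Finset.sum_add_distrib]
    rw [skew (fun i m => X (Sum.inl i) (Sum.inl m)) (fun i => z.1.1 i) h1, zero_add, hs]
    simp only [Finset.mul_sum]
    exact Finset.sum_congr rfl fun i _ => Finset.sum_congr rfl fun m _ => by ring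
  have hs2 : ∑ l, z.2.1 l * linField X z (Sum.inr l) = s := by
    simp only [hw2, mul_add, Finset.sum_add_distrib]
    rw [skew (fun i m => X (Sum.inr i) (Sum.inr m)) (fun i => z.2.1 i) h2, zero_add, hs,
      Finset.sum_comm]
    simp only [Finset.mul_sum]
    exact Finset.sum_congr rfl fun i _ => Finset.sum_congr rfl fun m _ => by ring
  have euler : ∀ {d n : ℕ} {R : MvPolynomial (Fin (d + 1)) ℂ} (x : Sph d), R ∈ harmPoly d n →
      ∑ i, restrictSph d (pderiv i R) x * ((x.1 i : ℝ) : ℂ) = n * restrictSph d R x := by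
    intro d n R x hR
    have := congrArg (fun R => restrictSph d R x) (mem_harmPoly.1 hR).1.sum_X_mul_pderiv
    simpa [restrictSph_apply, mul_comm] using this
  have hD : ∀ {d n : ℕ} {R : MvPolynomial (Fin (d + 1)) ℂ} (x : Sph d) (w : Fin (d + 1) → ℝ)
      (_ : R ∈ harmPoly d n), ∑ i, restrictSph d (pderiv i R) x * ((w i - s * x.1 i : ℝ) : ℂ) =
      ∑ i, restrictSph d (pderiv i R) x * ((w i : ℝ) : ℂ) - n * s * restrictSph d R x := by
    intro d n R x w hR
    have := euler x hR
    push_cast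
    simp only [mul_sub, Finset.sum_sub_distrib, mul_left_comm _ (s : ℂ), ← Finset.mul_sum, this]
    ring
  have hr : ∀ {d : ℕ} (b : Matrix (Fin (d + 1)) (Fin (d + 1)) ℝ)
      (R : MvPolynomial (Fin (d + 1)) ℂ) (x : Sph d), restrictSph d (rotPoly b R) x =
      ∑ i, restrictSph d (pderiv i R) x * ((∑ m, b i m * x.1 m : ℝ) : ℂ) := by
    intro d b R x
    simp only [rotPoly, restrictSph_apply, map_sum, map_mul, eval_C, eval_X]
    push_cast
    simp only [Finset.mul_sum]
    exact Finset.sum_congr rfl fun i _ => Finset.sum_congr rfl fun m _ => by ring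
  have hb : (∑ i, ∑ l, ((X (Sum.inl i) (Sum.inr l) : ℝ) : ℂ) •
      boostTerm hp hq a j k i l P Q : Prd p q → ℂ) z =
      ∑ i, ∑ l, ((X (Sum.inl i) (Sum.inr l) : ℝ) : ℂ) *
        (boostTerm hp hq a j k i l P Q : Prd p q → ℂ) z := by
    simp [Finset.sum_apply]
  have hsC : (s : ℂ) = ∑ i, ∑ l, ((X (Sum.inl i) (Sum.inr l) : ℝ) : ℂ) *
      (((z.1.1 i : ℝ) : ℂ) * ((z.2.1 l : ℝ) : ℂ)) := by
    rw [hs]; push_cast; rfl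
  have hL : (confOp hp hq a X (tens hp hq P Q) : Prd p q → ℂ) z =
      lieDeriv X (tens hp hq P Q : Prd p q → ℂ) z +
        a * (confFactor X z : ℂ) * (tens hp hq P Q : Prd p q → ℂ) z := rfl
  rw [hL, lieDeriv_tens, hs1, hs2, hD z.1 _ hP, hD z.2 _ hQ, confFactor, hs1]
  simp only [Submodule.coe_add, Pi.add_apply, tens_apply, hr, AddSubmonoidClass.coe_finsetSum,
    Submodule.coe_smul, hb, Matrix.toBlocks₁₁, Matrix.toBlocks₂₂, Matrix.of_apply,
    boostTerm_apply hp hq a _ _ hP hQ, hw1, hw2]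
  push_cast
  simp only [mul_add, mul_sub, Finset.sum_add_distrib, Finset.sum_sub_distrib]
  have e1 : ∑ i, ∑ l, ((X (Sum.inl i) (Sum.inr l) : ℝ) : ℂ) *
      ((j + k + a) * (((z.1.1 i : ℝ) : ℂ) * ((z.2.1 l : ℝ) : ℂ)) *
        (restrictSph p P z.1 * restrictSph q Q z.2)) =
      (j + k + a) * s * (restrictSph p P z.1 * restrictSph q Q z.2) := by
    rw [hsC]
    simp only [Finset.mul_sum, Finset.sum_mul]
    exact Finset.sum_congr rfl fun i _ => Finset.sum_congr rfl fun m _ => by ring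
  have e2 : ∑ i, ∑ l, ((X (Sum.inl i) (Sum.inr l) : ℝ) : ℂ) *
      (((z.2.1 l : ℝ) : ℂ) * restrictSph p (pderiv i P) z.1 * restrictSph q Q z.2) =
      (∑ i, restrictSph p (pderiv i P) z.1 * ∑ l, ((X (Sum.inl i) (Sum.inr l) : ℝ) : ℂ) *
        ((z.2.1 l : ℝ) : ℂ)) * restrictSph q Q z.2 := by
    simp only [Finset.mul_sum, Finset.sum_mul]
    exact Finset.sum_congr rfl fun i _ => Finset.sum_congr rfl fun m _ => by ring
  have e3 : ∑ i, ∑ l, ((X (Sum.inl i) (Sum.inr l) : ℝ) : ℂ) *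
      (((z.1.1 i : ℝ) : ℂ) * restrictSph p P z.1 * restrictSph q (pderiv l Q) z.2) =
      restrictSph p P z.1 * (∑ l, restrictSph q (pderiv l Q) z.2 *
        ∑ i, ((X (Sum.inl i) (Sum.inr l) : ℝ) : ℂ) * ((z.1.1 i : ℝ) : ℂ)) := by
    rw [Finset.sum_comm]
    simp only [Finset.mul_sum]
    exact Finset.sum_congr rfl fun i _ => Finset.sum_congr rfl fun m _ => by ring
  rw [e1, e2, e3]
  ring

end

section

variable {p q : ℕ}

/-! ### The decomposition into K-types -/

/-- The K-type `V(j,k)`, as a subspace of the space of `K`-finite functions. -/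
def kTypeSub (p q : ℕ) (i : ℕ × ℕ) : Submodule ℂ (KFinite p q) :=
  (KType p q i.1 i.2).comap (KFinite p q).subtype

lemma tens_mem_kTypeSub (hp : 1 ≤ p) (hq : 1 ≤ q) {j k : ℕ} {P : MvPolynomial (Fin (p + 1)) ℂ}
    {Q : MvPolynomial (Fin (q + 1)) ℂ} (hP : P ∈ harmPoly p j) (hQ : Q ∈ harmPoly q k) :
    tens hp hq P Q ∈ kTypeSub p q (j, k) :=
  Submodule.subset_span ⟨_, restrictSph_mem hP, _, restrictSph_mem hQ, rfl⟩

lemma kTypeSub_le (hp : 1 ≤ p) (hq : 1 ≤ q) {j k : ℕ} {N : Submodule ℂ (KFinite p q)}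
    (h : ∀ P ∈ harmPoly p j, ∀ Q ∈ harmPoly q k, tens hp hq P Q ∈ N) :
    kTypeSub p q (j, k) ≤ N := by
  intro φ hφ
  have : KType p q j k ≤ N.map (KFinite p q).subtype := by
    refine Submodule.span_le.2 ?_
    rintro _ ⟨_, ⟨P, hP, rfl⟩, _, ⟨Q, hQ, rfl⟩, rfl⟩
    exact ⟨_, h P hP Q hQ, rfl⟩
  obtain ⟨ψ, hψ, e⟩ := this hφ
  rwa [← Subtype.ext e]

lemma iSup_kTypeSub (p q : ℕ) : ⨆ i, kTypeSub p q i = ⊤ := by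
  refine eq_top_iff.2 fun φ _ => ?_
  have : KFinite p q ≤ (⨆ i, kTypeSub p q i).map (KFinite p q).subtype := by
    refine iSup_le fun j => iSup_le fun k => ?_
    refine le_trans ?_ (Submodule.map_mono (le_iSup (kTypeSub p q) (j, k)))
    intro ψ hψ
    exact ⟨⟨ψ, Submodule.mem_iSup_of_mem j (Submodule.mem_iSup_of_mem k hψ)⟩, hψ, rfl⟩
  obtain ⟨ψ, hψ, e⟩ := this φ.2
  rwa [← Subtype.ext e]

/-- Linear maps on `K`-finite functions are determined by their values on products of harmonic
polynomials. -/
lemma linearMap_ext_tens (hp : 1 ≤ p) (hq : 1 ≤ q) {A B : KFinite p q →ₗ[ℂ] KFinite p q}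
    (h : ∀ j k, ∀ P ∈ harmPoly p j, ∀ Q ∈ harmPoly q k,
      A (tens hp hq P Q) = B (tens hp hq P Q)) : A = B := by
  have : ⨆ i, kTypeSub p q i ≤ LinearMap.eqLocus A B :=
    iSup_le fun i => kTypeSub_le hp hq fun P hP Q hQ => h _ _ P hP Q hQ
  rw [iSup_kTypeSub] at this
  exact LinearMap.ext fun φ => this (Submodule.mem_top)

/-- The infinitesimal rotations of the first sphere. -/
def rotLeft (p q : ℕ) (i m : Fin (p + 1)) : Mat p q :=
  Matrix.fromBlocks (Matrix.single i m 1 - Matrix.single m i 1) 0 0 0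

/-- The infinitesimal rotations of the second sphere. -/
def rotRight (p q : ℕ) (i m : Fin (q + 1)) : Mat p q :=
  Matrix.fromBlocks 0 0 0 (Matrix.single i m 1 - Matrix.single m i 1)

lemma single_sub_single_skew {d : ℕ} (i m s t : Fin (d + 1)) :
    (Matrix.single i m 1 - Matrix.single m i 1 : Matrix (Fin (d + 1)) (Fin (d + 1)) ℝ) s t =
      -(Matrix.single i m 1 - Matrix.single m i 1 : Matrix (Fin (d + 1)) (Fin (d + 1)) ℝ) t s := by
  simp only [Matrix.sub_apply, Matrix.single_apply]
  rw [neg_sub]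
  congr 1 <;> simp only [and_comm]

lemma rotLeft_mem (i m : Fin (p + 1)) :
    rotLeft p q i m ∈ LieAlgebra.Orthogonal.so' (Fin (p + 1)) (Fin (q + 1)) ℝ :=
  mem_so'_of_entries (fun s t => single_sub_single_skew i m s t) (fun s t => by simp [rotLeft])
    (fun s t => by simp [rotLeft])

lemma rotRight_mem (i m : Fin (q + 1)) :
    rotRight p q i m ∈ LieAlgebra.Orthogonal.so' (Fin (p + 1)) (Fin (q + 1)) ℝ :=
  mem_so'_of_entries (fun s t => by simp [rotRight]) (fun s t => single_sub_single_skew i m s t)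
    (fun s t => by simp [rotRight])

lemma rotPoly_zero {d : ℕ} (P : MvPolynomial (Fin (d + 1)) ℂ) : rotPoly 0 P = 0 := by
  simp [rotPoly]

lemma confOp_rotLeft (hp : 1 ≤ p) (hq : 1 ≤ q) (a : ℂ) (i m : Fin (p + 1)) {j k : ℕ}
    {P : MvPolynomial (Fin (p + 1)) ℂ} {Q : MvPolynomial (Fin (q + 1)) ℂ}
    (hP : P ∈ harmPoly p j) (hQ : Q ∈ harmPoly q k) :
    confOp hp hq a (rotLeft p q i m) (tens hp hq P Q) = tens hp hq (angular i m P) Q := by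
  rw [confOp_tens hp hq a (rotLeft_mem i m) hP hQ, rotLeft, Matrix.toBlocks_fromBlocks₁₁,
    Matrix.toBlocks_fromBlocks₂₂, rotPoly_single, rotPoly_zero]
  simp

lemma confOp_rotRight (hp : 1 ≤ p) (hq : 1 ≤ q) (a : ℂ) (i m : Fin (q + 1)) {j k : ℕ}
    {P : MvPolynomial (Fin (p + 1)) ℂ} {Q : MvPolynomial (Fin (q + 1)) ℂ}
    (hP : P ∈ harmPoly p j) (hQ : Q ∈ harmPoly q k) :
    confOp hp hq a (rotRight p q i m) (tens hp hq P Q) = tens hp hq P (angular i m Q) := by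
  rw [confOp_tens hp hq a (rotRight_mem i m) hP hQ, rotRight, Matrix.toBlocks_fromBlocks₁₁,
    Matrix.toBlocks_fromBlocks₂₂, rotPoly_single, rotPoly_zero]
  simp

/-- The combination `C₁ + i C₂` of the Casimir operators of `so(p+1)` and `so(q+1)`. Their
eigenvalues are real, so that this single operator separates the K-types. -/
def casimirOp (hp : 1 ≤ p) (hq : 1 ≤ q) : Module.End ℂ (KFinite p q) :=
  ∑ i, ∑ m, confOp hp hq 0 (rotLeft p q i m) ∘ₗ confOp hp hq 0 (rotLeft p q i m) +
    Complex.I • ∑ i, ∑ m, confOp hp hq 0 (rotRight p q i m) ∘ₗ confOp hp hq 0 (rotRight p q i m)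

/-- The eigenvalue of `casimirOp` on `V(j,k)`. -/
def casimirEigenvalue (p q : ℕ) (i : ℕ × ℕ) : ℂ :=
  -2 * (i.1 * (i.1 + p - 1)) + Complex.I * (-2 * (i.2 * (i.2 + q - 1)))

lemma casimirOp_tens (hp : 1 ≤ p) (hq : 1 ≤ q) {j k : ℕ} {P : MvPolynomial (Fin (p + 1)) ℂ}
    {Q : MvPolynomial (Fin (q + 1)) ℂ} (hP : P ∈ harmPoly p j) (hQ : Q ∈ harmPoly q k) :
    casimirOp hp hq (tens hp hq P Q) = casimirEigenvalue p q (j, k) • tens hp hq P Q := by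
  have h1 : ∀ i m, confOp hp hq 0 (rotLeft p q i m) (confOp hp hq 0 (rotLeft p q i m)
      (tens hp hq P Q)) = tens hp hq (angular i m (angular i m P)) Q := fun i m => by
    rw [confOp_rotLeft hp hq 0 i m hP hQ, confOp_rotLeft hp hq 0 i m (angular_mem i m hP) hQ]
  have h2 : ∀ i m, confOp hp hq 0 (rotRight p q i m) (confOp hp hq 0 (rotRight p q i m)
      (tens hp hq P Q)) = tens hp hq P (angular i m (angular i m Q)) := fun i m => by
    rw [confOp_rotRight hp hq 0 i m hP hQ, confOp_rotRight hp hq 0 i m hP (angular_mem i m hQ)]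
  have h3 : ∑ i, ∑ m, tens hp hq (angular i m (angular i m P)) Q =
      tens hp hq (∑ i, ∑ m, angular i m (angular i m P)) Q := by
    simp only [map_sum, LinearMap.sum_apply]
  have h4 : ∑ i, ∑ m, tens hp hq P (angular i m (angular i m Q)) =
      tens hp hq P (∑ i, ∑ m, angular i m (angular i m Q)) := by
    simp only [map_sum]
  simp only [casimirOp, LinearMap.add_apply, LinearMap.sum_apply, LinearMap.smul_apply,
    LinearMap.comp_apply, h1, h2]
  rw [h3, h4, sum_angular_angular hP, sum_angular_angular hQ, map_smul, map_smul,
    LinearMap.smul_apply, smul_smul, ← add_smul]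
  rfl

lemma kTypeSub_le_eigenspace (hp : 1 ≤ p) (hq : 1 ≤ q) (i : ℕ × ℕ) :
    kTypeSub p q i ≤ (casimirOp hp hq).eigenspace (casimirEigenvalue p q i) :=
  kTypeSub_le hp hq fun _ hP _ hQ => Module.End.mem_eigenspace_iff.2 (casimirOp_tens hp hq hP hQ)

lemma casimirEigenvalue_injective (hp : 1 ≤ p) (hq : 1 ≤ q) :
    Function.Injective (casimirEigenvalue p q) := by
  have key : ∀ {d a b : ℕ}, 1 ≤ d → (a : ℝ) * (a + d - 1) = b * (b + d - 1) → a = b := by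
    intro d a b hd h
    obtain ⟨e, rfl⟩ : ∃ e, d = e + 1 := ⟨d - 1, by omega⟩
    have h' : (a : ℝ) * (a + e) = b * (b + e) := by push_cast at h; linear_combination h
    have h' : a * (a + e) = b * (b + e) := by exact_mod_cast h'
    rcases lt_trichotomy a b with hl | hl | hl
    · nlinarith
    · exact hl
    · nlinarith
  rintro ⟨a, b⟩ ⟨a', b'⟩ h
  have hre := congrArg Complex.re h
  have him := congrArg Complex.im h
  simp [casimirEigenvalue] at hre him
  refine Prod.ext (key hp ?_) (key hq ?_) <;> simp <;> tauto

lemma iSupIndep_eigenspace_casimirOp (hp : 1 ≤ p) (hq : 1 ≤ q) :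
    iSupIndep (fun i => (casimirOp hp hq).eigenspace (casimirEigenvalue p q i)) :=
  (Module.End.eigenspaces_iSupIndep _).comp (casimirEigenvalue_injective hp hq)

lemma iSupIndep_kTypeSub (hp : 1 ≤ p) (hq : 1 ≤ q) : iSupIndep (kTypeSub p q) :=
  (iSupIndep_eigenspace_casimirOp hp hq).mono (kTypeSub_le_eigenspace hp hq)

/-- The K-types are exactly the eigenspaces of `casimirOp`. -/
lemma eigenspace_casimirOp (hp : 1 ≤ p) (hq : 1 ≤ q) (i : ℕ × ℕ) :
    (casimirOp hp hq).eigenspace (casimirEigenvalue p q i) = kTypeSub p q i := by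
  refine le_antisymm ?_ (kTypeSub_le_eigenspace hp hq i)
  set E := fun i => (casimirOp hp hq).eigenspace (casimirEigenvalue p q i) with hE
  set R := ⨆ (m) (_ : m ≠ i), kTypeSub p q m with hR
  have h1 : E i ⊓ R = ⊥ := by
    have := (iSupIndep_eigenspace_casimirOp hp hq) i
    refine (this.mono_right ?_).eq_bot
    exact iSup₂_mono fun m _ => kTypeSub_le_eigenspace hp hq m
  have h2 : kTypeSub p q i ⊔ R = ⊤ := by
    rw [← iSup_kTypeSub p q, hR]
    refine le_antisymm (sup_le (le_iSup _ i) (iSup₂_le fun m _ => le_iSup _ m)) ?_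
    refine iSup_le fun m => ?_
    by_cases h : m = i
    · subst h; exact le_sup_left
    · exact le_sup_of_le_right (le_iSup₂_of_le m h le_rfl)
  have h3 : kTypeSub p q i ⊔ E i ⊓ R = (kTypeSub p q i ⊔ R) ⊓ E i := by
    rw [inf_comm, sup_inf_assoc_of_le R (kTypeSub_le_eigenspace hp hq i)]
  rw [h1, h2, top_inf_eq, sup_bot_eq] at h3
  exact h3.ge

/-- There is a linear operator with prescribed scalars on the K-types. -/
lemma exists_scalar_on_kTypes (hp : 1 ≤ p) (hq : 1 ≤ q) (μ : ℕ × ℕ → ℂ) :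
    ∃ A : KFinite p q →ₗ[ℂ] KFinite p q, ∀ i, ∀ φ ∈ kTypeSub p q i, A φ = μ i • φ := by
  have hI : DirectSum.IsInternal (kTypeSub p q) :=
    (DirectSum.isInternal_submodule_iff_iSupIndep_and_iSup_eq_top _).2
      ⟨iSupIndep_kTypeSub hp hq, iSup_kTypeSub p q⟩
  let e := LinearEquiv.ofBijective (DirectSum.coeLinearMap (kTypeSub p q)) hI
  refine ⟨(DirectSum.toModule ℂ _ _ fun i => μ i • (kTypeSub p q i).subtype) ∘ₗ
    e.symm.toLinearMap, fun i φ hφ => ?_⟩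
  have : e.symm φ = DirectSum.lof ℂ _ (fun i => kTypeSub p q i) i ⟨φ, hφ⟩ := by
    rw [LinearEquiv.symm_apply_eq]
    exact (DirectSum.coeLinearMap_lof (kTypeSub p q) i ⟨φ, hφ⟩).symm
  simp [this]

/-! ### Intertwinors preserve the K-types -/

lemma IsIntertwinor.comm_confOp {hp : 1 ≤ p} {hq : 1 ≤ q} {r : ℂ}
    {A : KFinite p q →ₗ[ℂ] KFinite p q} (hA : IsIntertwinor hp hq r A) {X : Mat p q}
    (hX : X ∈ LieAlgebra.Orthogonal.so' (Fin (p + 1)) (Fin (q + 1)) ℝ) (φ : KFinite p q) :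
    A (confOp hp hq (((p : ℂ) + q) / 2 - r) X φ) =
      confOp hp hq (((p : ℂ) + q) / 2 + r) X (A φ) :=
  hA.comm_g X hX φ

lemma confOp_rotLeft_eq (hp : 1 ≤ p) (hq : 1 ≤ q) (a : ℂ) (i m : Fin (p + 1)) :
    confOp hp hq a (rotLeft p q i m) = confOp hp hq 0 (rotLeft p q i m) :=
  linearMap_ext_tens hp hq fun j k P hP Q hQ => by
    rw [confOp_rotLeft hp hq _ i m hP hQ, confOp_rotLeft hp hq _ i m hP hQ]

lemma confOp_rotRight_eq (hp : 1 ≤ p) (hq : 1 ≤ q) (a : ℂ) (i m : Fin (q + 1)) :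
    confOp hp hq a (rotRight p q i m) = confOp hp hq 0 (rotRight p q i m) :=
  linearMap_ext_tens hp hq fun j k P hP Q hQ => by
    rw [confOp_rotRight hp hq _ i m hP hQ, confOp_rotRight hp hq _ i m hP hQ]

variable {hp : 1 ≤ p} {hq : 1 ≤ q} {r : ℂ} {A : KFinite p q →ₗ[ℂ] KFinite p q}

lemma IsIntertwinor.comm_rotLeft (hA : IsIntertwinor hp hq r A) (i m : Fin (p + 1))
    (φ : KFinite p q) : A (confOp hp hq 0 (rotLeft p q i m) φ) =
      confOp hp hq 0 (rotLeft p q i m) (A φ) := by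
  have := hA.comm_confOp (rotLeft_mem i m) φ
  rwa [confOp_rotLeft_eq hp hq (_ - r), confOp_rotLeft_eq hp hq (_ + r)] at this

lemma IsIntertwinor.comm_rotRight (hA : IsIntertwinor hp hq r A) (i m : Fin (q + 1))
    (φ : KFinite p q) : A (confOp hp hq 0 (rotRight p q i m) φ) =
      confOp hp hq 0 (rotRight p q i m) (A φ) := by
  have := hA.comm_confOp (rotRight_mem i m) φ
  rwa [confOp_rotRight_eq hp hq (_ - r), confOp_rotRight_eq hp hq (_ + r)] at this

lemma IsIntertwinor.map_kTypeSub (hA : IsIntertwinor hp hq r A) {i : ℕ × ℕ} {φ : KFinite p q}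
    (hφ : φ ∈ kTypeSub p q i) : A φ ∈ kTypeSub p q i := by
  rw [← eigenspace_casimirOp hp hq, Module.End.mem_eigenspace_iff] at hφ ⊢
  rw [← map_smul, ← hφ]
  simp only [casimirOp, LinearMap.add_apply, LinearMap.sum_apply, LinearMap.smul_apply,
    LinearMap.comp_apply, map_add, map_sum, map_smul, hA.comm_rotLeft, hA.comm_rotRight]

end

section

variable {p q : ℕ}

/-! ### Rotations preserve the K-types -/

/-- The polynomial `P ∘ L`, for a linear isometry `L` of `ℝ^{d+1}` (see `eval_substPoly`). -/
def substPoly {d : ℕ} (L : EuclideanSpace ℝ (Fin (d + 1)) ≃ₗᵢ[ℝ] EuclideanSpace ℝ (Fin (d + 1))) :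
    MvPolynomial (Fin (d + 1)) ℂ →ₐ[ℂ] MvPolynomial (Fin (d + 1)) ℂ :=
  aeval fun i => ∑ l, C (((L (EuclideanSpace.single l 1) i : ℝ)) : ℂ) * X l

lemma isometry_apply_eq_sum {d : ℕ}
    (L : EuclideanSpace ℝ (Fin (d + 1)) ≃ₗᵢ[ℝ] EuclideanSpace ℝ (Fin (d + 1)))
    (x : EuclideanSpace ℝ (Fin (d + 1))) (i : Fin (d + 1)) :
    L x i = ∑ l, x l * L (EuclideanSpace.single l 1) i := by
  have hx : x = ∑ l, x l • EuclideanSpace.single l (1 : ℝ) := by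
    ext m; simp [Finset.sum_apply, Pi.single_apply]
  conv_lhs => rw [hx]
  simp

lemma isometry_orthogonal {d : ℕ}
    (L : EuclideanSpace ℝ (Fin (d + 1)) ≃ₗᵢ[ℝ] EuclideanSpace ℝ (Fin (d + 1)))
    (i m : Fin (d + 1)) :
    ∑ l, L (EuclideanSpace.single l 1) i * L (EuclideanSpace.single l 1) m =
      if i = m then 1 else 0 := by
  have h : ∀ l i, L (EuclideanSpace.single l (1 : ℝ)) i =
      L.symm (EuclideanSpace.single i (1 : ℝ)) l := by
    intro l i
    have h1 : L (EuclideanSpace.single l (1 : ℝ)) i =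
        inner ℝ (EuclideanSpace.single i (1 : ℝ)) (L (EuclideanSpace.single l (1 : ℝ))) := by
      simp [EuclideanSpace.inner_single_left]
    have h2 : L.symm (EuclideanSpace.single i (1 : ℝ)) l =
        inner ℝ (L.symm (EuclideanSpace.single i (1 : ℝ))) (EuclideanSpace.single l (1 : ℝ)) := by
      simp [EuclideanSpace.inner_single_right]
    rw [h1, h2, ← L.symm.inner_map_map, L.symm_apply_apply]
  have h3 : inner ℝ (L.symm (EuclideanSpace.single i (1 : ℝ)))
      (L.symm (EuclideanSpace.single m (1 : ℝ))) = (if i = m then 1 else 0 : ℝ) := by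
    rw [L.symm.inner_map_map]
    simp [EuclideanSpace.inner_single_left]
  rw [← h3]
  simp only [h, PiLp.inner_apply]
  simp [mul_comm]

lemma eval_substPoly {d : ℕ}
    (L : EuclideanSpace ℝ (Fin (d + 1)) ≃ₗᵢ[ℝ] EuclideanSpace ℝ (Fin (d + 1)))
    (P : MvPolynomial (Fin (d + 1)) ℂ) (x : EuclideanSpace ℝ (Fin (d + 1))) :
    eval (fun i => ((x i : ℝ) : ℂ)) (substPoly L P) = eval (fun i => ((L x i : ℝ) : ℂ)) P := by
  induction P using MvPolynomial.induction_on with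
  | C a => simp [substPoly]
  | add P Q hP hQ => simp [hP, hQ]
  | mul_X P i h =>
    rw [map_mul, map_mul, h, map_mul]
    congr 1
    rw [eval_X, isometry_apply_eq_sum L x i]
    simp [substPoly, mul_comm]

lemma pderiv_substPoly {d : ℕ}
    (L : EuclideanSpace ℝ (Fin (d + 1)) ≃ₗᵢ[ℝ] EuclideanSpace ℝ (Fin (d + 1)))
    (P : MvPolynomial (Fin (d + 1)) ℂ) (m : Fin (d + 1)) :
    pderiv m (substPoly L P) = ∑ i, C (((L (EuclideanSpace.single m 1) i : ℝ)) : ℂ) *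
      substPoly L (pderiv i P) := by
  induction P using MvPolynomial.induction_on with
  | C a => simp [substPoly]
  | add P Q hP hQ => simp [hP, hQ, mul_add, Finset.sum_add_distrib]
  | mul_X P s h =>
    have hX : pderiv m (substPoly L (X s)) = C (((L (EuclideanSpace.single m 1) s : ℝ)) : ℂ) := by
      rw [substPoly, aeval_X, map_sum, Finset.sum_eq_single m]
      · simp
      · intro l _ hl
        simp [pderiv_X_of_ne hl]
      · simp
    have hs : ∑ i, C (((L (EuclideanSpace.single m 1) i : ℝ)) : ℂ) *
        (substPoly L P * substPoly L (pderiv i (X s))) =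
        C (((L (EuclideanSpace.single m 1) s : ℝ)) : ℂ) * substPoly L P := by
      rw [Finset.sum_eq_single s]
      · simp
      · intro l _ hl
        simp [pderiv_X_of_ne (Ne.symm hl)]
      · simp
    have hi : ∀ i, C (((L (EuclideanSpace.single m 1) i : ℝ)) : ℂ) *
        substPoly L (pderiv i (P * X s)) =
        C (((L (EuclideanSpace.single m 1) i : ℝ)) : ℂ) *
          (substPoly L P * substPoly L (pderiv i (X s))) +
        substPoly L (X s) * (C (((L (EuclideanSpace.single m 1) i : ℝ)) : ℂ) *
          substPoly L (pderiv i P)) := by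
      intro i
      rw [Derivation.leibniz, map_add, smul_eq_mul, smul_eq_mul, map_mul, map_mul]
      ring
    simp only [hi, Finset.sum_add_distrib, hs, ← Finset.mul_sum]
    rw [map_mul, Derivation.leibniz, hX, h, smul_eq_mul, smul_eq_mul, mul_comm (substPoly L P)]

/-- Composition with an isometry preserves harmonicity, by the orthogonality of its matrix. -/
lemma substPoly_mem {d j : ℕ}
    (L : EuclideanSpace ℝ (Fin (d + 1)) ≃ₗᵢ[ℝ] EuclideanSpace ℝ (Fin (d + 1)))
    {P : MvPolynomial (Fin (d + 1)) ℂ} (hP : P ∈ harmPoly d j) : substPoly L P ∈ harmPoly d j := by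
  rw [mem_harmPoly] at hP ⊢
  constructor
  · have := hP.1.aeval (fun i => ∑ l, C (((L (EuclideanSpace.single l 1) i : ℝ)) : ℂ) * X l)
      (n := 1) fun i => IsHomogeneous.sum _ _ _ fun l _ => by
        simpa using (isHomogeneous_C (Fin (d + 1)) _).mul (isHomogeneous_X ℂ l)
    rw [one_mul] at this
    exact this
  · have h1 : ∀ m, pderiv m (pderiv m (substPoly L P)) = ∑ i, ∑ s,
        C ((((L (EuclideanSpace.single m 1) i * L (EuclideanSpace.single m 1) s : ℝ)) : ℂ)) *
          substPoly L (pderiv s (pderiv i P)) := by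
      intro m
      rw [pderiv_substPoly, map_sum]
      refine Finset.sum_congr rfl fun i _ => ?_
      rw [← smul_eq_C_mul, Derivation.map_smul, pderiv_substPoly, smul_eq_C_mul, Finset.mul_sum]
      refine Finset.sum_congr rfl fun s _ => ?_
      push_cast
      rw [C_mul, mul_assoc]
    have h2 : polyLaplacian d (substPoly L P) = ∑ i, ∑ s,
        C (((∑ m, L (EuclideanSpace.single m 1) i * L (EuclideanSpace.single m 1) s : ℝ) : ℂ)) *
          substPoly L (pderiv s (pderiv i P)) := by
      rw [polyLaplacian_apply]
      simp only [h1]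
      rw [Finset.sum_comm]
      refine Finset.sum_congr rfl fun i _ => ?_
      rw [Finset.sum_comm]
      refine Finset.sum_congr rfl fun s _ => ?_
      rw [← Finset.sum_mul, ← map_sum]
      push_cast; rfl
    rw [h2]
    simp only [isometry_orthogonal]
    have : ∑ i, substPoly L (pderiv i (pderiv i P)) = 0 := by
      rw [← map_sum, ← polyLaplacian_apply, hP.2, map_zero]
    rw [← this]
    refine Finset.sum_congr rfl fun i _ => ?_
    rw [Finset.sum_eq_single i]
    · simp
    · intro s _ hs
      simp [Ne.symm hs]
    · simp

/-- The action of a pair of isometries on `K`-finite functions, as a linear map. -/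
def rotOp (hp : 1 ≤ p) (hq : 1 ≤ q)
    (k₁ : EuclideanSpace ℝ (Fin (p + 1)) ≃ₗᵢ[ℝ] EuclideanSpace ℝ (Fin (p + 1)))
    (k₂ : EuclideanSpace ℝ (Fin (q + 1)) ≃ₗᵢ[ℝ] EuclideanSpace ℝ (Fin (q + 1))) :
    KFinite p q →ₗ[ℂ] KFinite p q where
  toFun φ := ⟨rotAct k₁ k₂ φ, rotAct_mem hp hq k₁ k₂ φ.2⟩
  map_add' _ _ := rfl
  map_smul' _ _ := rfl

lemma rotOp_tens (hp : 1 ≤ p) (hq : 1 ≤ q)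
    (k₁ : EuclideanSpace ℝ (Fin (p + 1)) ≃ₗᵢ[ℝ] EuclideanSpace ℝ (Fin (p + 1)))
    (k₂ : EuclideanSpace ℝ (Fin (q + 1)) ≃ₗᵢ[ℝ] EuclideanSpace ℝ (Fin (q + 1)))
    (P : MvPolynomial (Fin (p + 1)) ℂ) (Q : MvPolynomial (Fin (q + 1)) ℂ) :
    rotOp hp hq k₁ k₂ (tens hp hq P Q) =
      tens hp hq (substPoly k₁.symm P) (substPoly k₂.symm Q) := by
  ext z
  rw [tens_apply, restrictSph_apply, restrictSph_apply, eval_substPoly, eval_substPoly]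
  rfl

/-! ### Intertwinors from solutions of the ladder recurrences -/

/-- Scalars on the K-types that satisfy the recurrences along the two diagonal directions define an
intertwinor. -/
lemma exists_isIntertwinor (hp : 1 ≤ p) (hq : 1 ≤ q) {r : ℂ} {μ : ℕ × ℕ → ℂ}
    (h1 : ∀ j k : ℕ, (j + k + (((p : ℂ) + q) / 2 - r)) * μ (j + 1, k + 1) =
      (j + k + (((p : ℂ) + q) / 2 + r)) * μ (j, k))
    (h2 : ∀ j k : ℕ, (k + q - j - (((p : ℂ) + q) / 2 - r)) * μ (j + 1, k) =
      (k + q - j - (((p : ℂ) + q) / 2 + r)) * μ (j, k + 1)) :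
    ∃ A : KFinite p q →ₗ[ℂ] KFinite p q, IsIntertwinor hp hq r A ∧
      ∀ i, ∀ φ ∈ kTypeSub p q i, A φ = μ i • φ := by
  obtain ⟨A, hA⟩ := exists_scalar_on_kTypes hp hq μ
  have hA' : ∀ {j k : ℕ} {P : MvPolynomial (Fin (p + 1)) ℂ} {Q : MvPolynomial (Fin (q + 1)) ℂ},
      P ∈ harmPoly p j → Q ∈ harmPoly q k → A (tens hp hq P Q) = μ (j, k) • tens hp hq P Q :=
    fun hP hQ => hA _ _ (tens_mem_kTypeSub hp hq hP hQ)
  refine ⟨A, ⟨fun k₁ k₂ _ _ φ => ?_, fun X hX φ => ?_⟩, hA⟩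
  · have : A ∘ₗ rotOp hp hq k₁ k₂ = rotOp hp hq k₁ k₂ ∘ₗ A :=
      linearMap_ext_tens hp hq fun j k P hP Q hQ => by
        rw [LinearMap.comp_apply, LinearMap.comp_apply, rotOp_tens, hA' hP hQ, map_smul,
          rotOp_tens, hA' (substPoly_mem _ hP) (substPoly_mem _ hQ)]
    exact LinearMap.congr_fun this φ
  · have : A ∘ₗ confOp hp hq (((p : ℂ) + q) / 2 - r) X =
        confOp hp hq (((p : ℂ) + q) / 2 + r) X ∘ₗ A := by
      refine linearMap_ext_tens hp hq fun j k P hP Q hQ => ?_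
      obtain ⟨e1, e2, -⟩ := so'_entries hX
      have hb : ∀ i l, A (boostTerm hp hq (((p : ℂ) + q) / 2 - r) j k i l P Q) =
          μ (j, k) • boostTerm hp hq (((p : ℂ) + q) / 2 + r) j k i l P Q := by
        intro i l
        simp only [boostTerm, map_add, map_smul, smul_add, smul_smul]
        congr 1
        · congr 1
          · congr 1
            · rw [hA' (raisePoly_mem hp hP i) (raisePoly_mem hq hQ l), smul_smul]
              congr 1
              linear_combination -h1 j k
            · rcases k with - | k
              · simp [lowerPoly_zero hQ]
              · rw [hA' (raisePoly_mem hp hP i) (lowerPoly_mem hQ l), smul_smul]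
                congr 1
                have := h2 j k
                push_cast [Nat.add_sub_cancel]
                linear_combination this
          · rcases j with - | j
            · simp [lowerPoly_zero hP]
            · rw [hA' (lowerPoly_mem hP i) (raisePoly_mem hq hQ l), smul_smul]
              congr 1
              have := h2 j k
              push_cast [Nat.add_sub_cancel]
              linear_combination this
        · rcases j with - | j
          · simp [lowerPoly_zero hP]
          rcases k with - | k
          · simp [lowerPoly_zero hQ]
          rw [hA' (lowerPoly_mem hP i) (lowerPoly_mem hQ l), smul_smul]
          congr 1
          have := h1 j k
          push_cast [Nat.add_sub_cancel]
          linear_combination -this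
      rw [LinearMap.comp_apply, LinearMap.comp_apply, hA' hP hQ, map_smul,
        confOp_tens hp hq _ hX hP hQ, confOp_tens hp hq _ hX hP hQ]
      simp only [map_add, map_sum, map_smul, hb, hA' (rotPoly_mem (a := X.toBlocks₁₁) e1 hP) hQ,
        hA' hP (rotPoly_mem (a := X.toBlocks₂₂) e2 hQ), smul_add, Finset.smul_sum]
      simp only [smul_comm (μ (j, k))]
    exact LinearMap.congr_fun this φ

end

section

variable {p q : ℕ}

/-! ### Comparing the components of boosts -/

/-- The boost in the plane of `u_i` and `v_l`. -/
def boost (i : Fin (p + 1)) (l : Fin (q + 1)) : Mat p q :=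
  Matrix.fromBlocks 0 (Matrix.single i l 1) (Matrix.single l i 1) 0

lemma boost_mem (i : Fin (p + 1)) (l : Fin (q + 1)) :
    boost i l ∈ LieAlgebra.Orthogonal.so' (Fin (p + 1)) (Fin (q + 1)) ℝ :=
  mem_so'_of_entries (fun s t => by simp [boost]) (fun s t => by simp [boost])
    (fun s t => by simp [boost, Matrix.single_apply, and_comm])

lemma confOp_boost (hp : 1 ≤ p) (hq : 1 ≤ q) (a : ℂ) (i : Fin (p + 1)) (l : Fin (q + 1)) {j k : ℕ}
    {P : MvPolynomial (Fin (p + 1)) ℂ} {Q : MvPolynomial (Fin (q + 1)) ℂ}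
    (hP : P ∈ harmPoly p j) (hQ : Q ∈ harmPoly q k) :
    confOp hp hq a (boost i l) (tens hp hq P Q) = boostTerm hp hq a j k i l P Q := by
  rw [confOp_tens hp hq a (boost_mem i l) hP hQ, boost, Matrix.toBlocks_fromBlocks₁₁,
    Matrix.toBlocks_fromBlocks₂₂, rotPoly_zero, rotPoly_zero, map_zero, map_zero,
    LinearMap.zero_apply, zero_add, zero_add]
  simp only [Matrix.fromBlocks_apply₁₂, Matrix.single_apply]
  rw [Finset.sum_eq_single i, Finset.sum_eq_single l]
  · simp
  · intro m _ hm; simp [Ne.symm hm]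
  · simp
  · intro m _ hm; simp [Ne.symm hm]
  · simp

/-- An operator that preserves the K-types and relates two boost terms relates their components. -/
lemma components_of_boostTerm (hp : 1 ≤ p) (hq : 1 ≤ q) {A : KFinite p q →ₗ[ℂ] KFinite p q}
    (hA : ∀ i, ∀ φ ∈ kTypeSub p q i, A φ ∈ kTypeSub p q i) {a b : ℂ} {j k : ℕ} {i : Fin (p + 1)}
    {l : Fin (q + 1)} {P P' : MvPolynomial (Fin (p + 1)) ℂ} {Q Q' : MvPolynomial (Fin (q + 1)) ℂ}
    (hP : P ∈ harmPoly p j) (hP' : P' ∈ harmPoly p j) (hQ : Q ∈ harmPoly q k)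
    (hQ' : Q' ∈ harmPoly q k)
    (h : A (boostTerm hp hq a j k i l P Q) = boostTerm hp hq b j k i l P' Q') :
    (-(j + k + a) : ℂ) • A (tens hp hq (raisePoly p j i P) (raisePoly q k l Q)) =
      (-(j + k + b) : ℂ) • tens hp hq (raisePoly p j i P') (raisePoly q k l Q') ∧
    (k + q - 1 - j - a : ℂ) • A (tens hp hq (raisePoly p j i P) (lowerPoly q k l Q)) =
      (k + q - 1 - j - b : ℂ) • tens hp hq (raisePoly p j i P') (lowerPoly q k l Q') ∧
    (j + p - 1 - k - a : ℂ) • A (tens hp hq (lowerPoly p j i P) (raisePoly q k l Q)) =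
      (j + p - 1 - k - b : ℂ) • tens hp hq (lowerPoly p j i P') (raisePoly q k l Q') := by
  -- project onto one K-type; the four targets are distinct even when `j - 1` or `k - 1` truncates
  have key : ∀ s : ℕ × ℕ, ∃ π : KFinite p q →ₗ[ℂ] KFinite p q,
      (∀ i, ∀ φ ∈ kTypeSub p q i, π φ = (if i = s then 1 else 0 : ℂ) • φ) ∧
      (∀ φ, π (A φ) = A (π φ)) := by
    intro s
    obtain ⟨π, hπ⟩ := exists_scalar_on_kTypes hp hq fun i => if i = s then 1 else 0
    refine ⟨π, hπ, fun φ => ?_⟩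
    have : π ∘ₗ A = A ∘ₗ π := linearMap_ext_tens hp hq fun j k P hP Q hQ => by
      have ht := tens_mem_kTypeSub hp hq hP hQ
      rw [LinearMap.comp_apply, LinearMap.comp_apply, hπ _ _ ht, hπ _ _ (hA _ _ ht), map_smul]
    exact LinearMap.congr_fun this φ
  have comp : ∀ {π : KFinite p q →ₗ[ℂ] KFinite p q} {s : ℕ × ℕ},
      (∀ i, ∀ φ ∈ kTypeSub p q i, π φ = (if i = s then 1 else 0 : ℂ) • φ) →
      ∀ (c : ℂ) {P Q}, P ∈ harmPoly p j → Q ∈ harmPoly q k →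
      π (boostTerm hp hq c j k i l P Q) =
      (-(j + k + c) : ℂ) • (if (j + 1, k + 1) = s then 1 else 0 : ℂ) •
        tens hp hq (raisePoly p j i P) (raisePoly q k l Q) +
      (k + q - 1 - j - c : ℂ) • (if (j + 1, k - 1) = s then 1 else 0 : ℂ) •
        tens hp hq (raisePoly p j i P) (lowerPoly q k l Q) +
      (j + p - 1 - k - c : ℂ) • (if (j - 1, k + 1) = s then 1 else 0 : ℂ) •
        tens hp hq (lowerPoly p j i P) (raisePoly q k l Q) +
      (j + p - 1 + k + q - 1 - c : ℂ) • (if (j - 1, k - 1) = s then 1 else 0 : ℂ) •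
        tens hp hq (lowerPoly p j i P) (lowerPoly q k l Q) := by
    intro π s hπ c P Q hP hQ
    rw [boostTerm, map_add, map_add, map_add, map_smul, map_smul, map_smul, map_smul,
      hπ _ _ (tens_mem_kTypeSub hp hq (raisePoly_mem hp hP i) (raisePoly_mem hq hQ l)),
      hπ _ _ (tens_mem_kTypeSub hp hq (raisePoly_mem hp hP i) (lowerPoly_mem hQ l)),
      hπ _ _ (tens_mem_kTypeSub hp hq (lowerPoly_mem hP i) (raisePoly_mem hq hQ l)),
      hπ _ _ (tens_mem_kTypeSub hp hq (lowerPoly_mem hP i) (lowerPoly_mem hQ l))]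
  have h1 : j - 1 ≠ j + 1 := by omega
  have h2 : k - 1 ≠ k + 1 := by omega
  refine ⟨?_, ?_, ?_⟩
  · obtain ⟨π, hπ, hc⟩ := key (j + 1, k + 1)
    have := congrArg π h
    rw [hc, comp hπ a hP hQ, comp hπ b hP' hQ'] at this
    simpa [h1, h2, Prod.ext_iff, -neg_add_rev, -neg_smul] using this
  · obtain ⟨π, hπ, hc⟩ := key (j + 1, k - 1)
    have := congrArg π h
    rw [hc, comp hπ a hP hQ, comp hπ b hP' hQ'] at this
    simpa [h1, h2.symm, Prod.ext_iff] using this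
  · obtain ⟨π, hπ, hc⟩ := key (j - 1, k + 1)
    have := congrArg π h
    rw [hc, comp hπ a hP hQ, comp hπ b hP' hQ'] at this
    simpa [h1.symm, h2, Prod.ext_iff] using this

/-- The product of two combinations `P`, `Q` lies in a subspace that contains all products of the
terms. -/
lemma tens_mem_of_sums (hp : 1 ≤ p) (hq : 1 ≤ q) {N : Submodule ℂ (KFinite p q)}
    {P : MvPolynomial (Fin (p + 1)) ℂ} {Q : MvPolynomial (Fin (q + 1)) ℂ}
    {f : Fin (p + 1) → MvPolynomial (Fin (p + 1)) ℂ}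
    {g : Fin (q + 1) → MvPolynomial (Fin (q + 1)) ℂ} {c c' : ℂ} (hc : c ≠ 0) (hc' : c' ≠ 0)
    (hf : ∑ i, f i = c • P) (hg : ∑ l, g l = c' • Q) (h : ∀ i l, tens hp hq (f i) (g l) ∈ N) :
    tens hp hq P Q ∈ N := by
  have h1 : tens hp hq (c • P) (c' • Q) ∈ N := by
    rw [← hf, ← hg]
    simp only [map_sum, LinearMap.sum_apply]
    exact N.sum_mem fun i _ => N.sum_mem fun l _ => h _ _
  rw [map_smul, map_smul, LinearMap.smul_apply] at h1
  exact (N.smul_mem_iff hc).1 ((N.smul_mem_iff hc').1 h1)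

/-! ### Uniqueness of the spectral function -/

section Unique

variable {hp : 1 ≤ p} {hq : 1 ≤ q} {r : ℂ} {S : KFinite p q →ₗ[ℂ] KFinite p q}

lemma IsIntertwinor.sub_smul {A B : KFinite p q →ₗ[ℂ] KFinite p q} (hA : IsIntertwinor hp hq r A)
    (hB : IsIntertwinor hp hq r B) (c : ℂ) : IsIntertwinor hp hq r (A - c • B) where
  comm_K k₁ k₂ h₁ h₂ φ := by
    have e : (⟨rotAct k₁ k₂ ((A - c • B) φ : KFinite p q), rotAct_mem hp hq k₁ k₂
        ((A - c • B) φ).2⟩ : KFinite p q) = rotOp hp hq k₁ k₂ (A φ - c • B φ) := rfl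
    rw [e, map_sub, map_smul, LinearMap.sub_apply, LinearMap.smul_apply, hA.comm_K k₁ k₂ h₁ h₂,
      hB.comm_K k₁ k₂ h₁ h₂]
    rfl
  comm_g X hX φ := by
    have e : (⟨confAct (((p : ℂ) + q) / 2 + r) X ((A - c • B) φ : KFinite p q), confAct_mem hp hq _
        X ((A - c • B) φ).2⟩ : KFinite p q) =
        confOp hp hq (((p : ℂ) + q) / 2 + r) X (A φ - c • B φ) := rfl
    rw [e, map_sub, map_smul, LinearMap.sub_apply, LinearMap.smul_apply, hA.comm_g X hX,
      hB.comm_g X hX]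
    rfl

/-- The image of a boost of a vector in the kernel of an intertwinor. -/
lemma IsIntertwinor.components_eq_zero (hS : IsIntertwinor hp hq r S) {j k : ℕ}
    (h : kTypeSub p q (j, k) ≤ LinearMap.ker S) (i : Fin (p + 1)) (l : Fin (q + 1))
    {P : MvPolynomial (Fin (p + 1)) ℂ} {Q : MvPolynomial (Fin (q + 1)) ℂ}
    (hP : P ∈ harmPoly p j) (hQ : Q ∈ harmPoly q k) :
    (-(j + k + (((p : ℂ) + q) / 2 - r)) : ℂ) •
      S (tens hp hq (raisePoly p j i P) (raisePoly q k l Q)) = 0 ∧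
    (k + q - 1 - j - (((p : ℂ) + q) / 2 - r) : ℂ) •
      S (tens hp hq (raisePoly p j i P) (lowerPoly q k l Q)) = 0 ∧
    (j + p - 1 - k - (((p : ℂ) + q) / 2 - r) : ℂ) •
      S (tens hp hq (lowerPoly p j i P) (raisePoly q k l Q)) = 0 := by
  have h0 : S (tens hp hq P Q) = 0 := h (tens_mem_kTypeSub hp hq hP hQ)
  have h1 := hS.comm_confOp (boost_mem i l) (tens hp hq P Q)
  rw [h0, map_zero, confOp_boost hp hq _ i l hP hQ] at h1
  have h2 : (0 : KFinite p q) = boostTerm hp hq (((p : ℂ) + q) / 2 + r) j k i l 0 0 := by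
    simp [boostTerm, raisePoly, lowerPoly]
  have := components_of_boostTerm hp hq (fun i φ hφ => hS.map_kTypeSub hφ) hP
    (Submodule.zero_mem _) hQ (Submodule.zero_mem _) (h1.trans h2)
  simpa [raisePoly, lowerPoly, -neg_add_rev, -neg_smul] using this

/-- The kernel of an intertwinor is closed under the step `(j, k) → (j + 1, k + 1)`. -/
lemma IsIntertwinor.ker_step_up (hS : IsIntertwinor hp hq r S) {j k : ℕ}
    (hc : (j + k + (((p : ℂ) + q) / 2 - r)) ≠ 0) (h : kTypeSub p q (j, k) ≤ LinearMap.ker S) :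
    kTypeSub p q (j + 1, k + 1) ≤ LinearMap.ker S :=
  kTypeSub_le hp hq fun _ hP _ hQ => tens_mem_of_sums hp hq (Nat.cast_add_one_ne_zero j)
    (Nat.cast_add_one_ne_zero k) (sum_raisePoly hP) (sum_raisePoly hQ) fun i l =>
      (smul_eq_zero.1 (hS.components_eq_zero h i l (pderiv_mem_harmPoly hP i)
        (pderiv_mem_harmPoly hQ l)).1).resolve_left (neg_ne_zero.2 hc)

/-- The kernel of an intertwinor is closed under the step `(j, k + 1) → (j + 1, k)`. -/
lemma IsIntertwinor.ker_step_right (hS : IsIntertwinor hp hq r S) {j k : ℕ}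
    (hc : (k + q - j - (((p : ℂ) + q) / 2 - r)) ≠ 0)
    (h : kTypeSub p q (j, k + 1) ≤ LinearMap.ker S) :
    kTypeSub p q (j + 1, k) ≤ LinearMap.ker S :=
  kTypeSub_le hp hq fun P hP Q hQ => by
    obtain ⟨c, hc0, hs⟩ := exists_sum_lowerPoly hq hQ
    refine tens_mem_of_sums hp hq (Nat.cast_add_one_ne_zero j) hc0 (sum_raisePoly hP) hs
      fun i l => (smul_eq_zero.1 (hS.components_eq_zero h i l (pderiv_mem_harmPoly hP i)
        (raisePoly_mem hq hQ l)).2.1).resolve_left ?_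
    intro h0
    apply hc
    push_cast at h0
    linear_combination h0

/-- The kernel of an intertwinor is closed under the step `(j + 1, k) → (j, k + 1)`. -/
lemma IsIntertwinor.ker_step_left (hS : IsIntertwinor hp hq r S) {j k : ℕ}
    (hc : (j + p - k - (((p : ℂ) + q) / 2 - r)) ≠ 0)
    (h : kTypeSub p q (j + 1, k) ≤ LinearMap.ker S) :
    kTypeSub p q (j, k + 1) ≤ LinearMap.ker S :=
  kTypeSub_le hp hq fun P hP Q hQ => by
    obtain ⟨c, hc0, hs⟩ := exists_sum_lowerPoly hp hP
    refine tens_mem_of_sums hp hq hc0 (Nat.cast_add_one_ne_zero k) hs (sum_raisePoly hQ)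
      fun i l => (smul_eq_zero.1 (hS.components_eq_zero h i l (raisePoly_mem hp hP i)
        (pderiv_mem_harmPoly hQ l)).2.2).resolve_left ?_
    intro h0
    apply hc
    push_cast at h0
    linear_combination h0

variable {ε : ℕ}

/-- The coefficients of the step `(j, k) → (j + 1, k + 1)` do not vanish away from the poles. -/
lemma NoPole.up (h : NoPole p q ε r) {j k : ℕ} (hjk : (j + k) % 2 = ε) :
    (j + k + (((p : ℂ) + q) / 2 - r)) ≠ 0 ∧ (j + k + (((p : ℂ) + q) / 2 + r)) ≠ 0 := by
  obtain ⟨h1, h2, -, -⟩ := h j k hjk 0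
  constructor
  · intro h0
    apply h2
    simp only [shift, Nat.cast_zero]
    linear_combination h0 / 2
  · intro h0
    apply h1
    simp only [shift, Nat.cast_zero]
    linear_combination h0 / 2

/-- The coefficients of the steps between `(j, k + 1)` and `(j + 1, k)` do not vanish away from the
poles. -/
lemma NoPole.right (h : NoPole p q ε r) {j k : ℕ} (hjk : (j + 1 + k) % 2 = ε) :
    (k + q - j - (((p : ℂ) + q) / 2 - r)) ≠ 0 ∧ (k + q - j - (((p : ℂ) + q) / 2 + r)) ≠ 0 := by
  obtain ⟨-, -, h1, h2⟩ := h (j + 1) k hjk 0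
  constructor
  · intro h0
    apply h1
    simp only [shift, Nat.cast_zero]
    push_cast
    linear_combination h0 / 2
  · intro h0
    apply h2
    simp only [shift, Nat.cast_zero]
    push_cast
    linear_combination h0 / 2

/-- Away from the poles, an intertwinor that vanishes on `V(0,ε)` vanishes on all K-types of
parity `ε`. -/
lemma IsIntertwinor.kTypeSub_le_ker (hS : IsIntertwinor hp hq r S)
    (hr : NoPole p q ε r) (h0 : kTypeSub p q (0, ε) ≤ LinearMap.ker S) {j k : ℕ}
    (hjk : (j + k) % 2 = ε) : kTypeSub p q (j, k) ≤ LinearMap.ker S := by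
  -- along an antidiagonal one moves to the right
  have hrow : ∀ N, N % 2 = ε → kTypeSub p q (0, N) ≤ LinearMap.ker S →
      ∀ j k, j + k = N → kTypeSub p q (j, k) ≤ LinearMap.ker S := by
    intro N hN h j
    induction j with
    | zero => rintro k rfl; simpa using h
    | succ j ih =>
      intro k hk
      exact hS.ker_step_right (hr.right (by omega)).1 (ih (k + 1) (by omega))
  -- and `(0, N) → (1, N + 1) → (0, N + 2)` leads to the next one
  have hcol : ∀ n, kTypeSub p q (0, 2 * n + ε) ≤ LinearMap.ker S := by
    intro n
    induction n with
    | zero => simpa using h0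
    | succ n ih =>
      have h1 := hS.ker_step_up (hr.up (by omega)).1 ih
      have := hS.ker_step_left (j := 0) (k := 2 * n + ε + 1) ?_ h1
      · have e : 2 * (n + 1) + ε = 2 * n + ε + 1 + 1 := by ring
        rwa [e]
      · have := (hr.right (j := 0) (k := 2 * n + ε + 1) (by omega)).2
        intro h0
        apply this
        push_cast at h0 ⊢
        linear_combination -h0
  have e : j + k = 2 * ((j + k) / 2) + ε := by omega
  exact hrow (j + k) hjk (e ▸ hcol _) j k rfl

lemma one_mem_harmPoly (d : ℕ) : (1 : MvPolynomial (Fin (d + 1)) ℂ) ∈ harmPoly d 0 :=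
  mem_harmPoly.2 ⟨isHomogeneous_one _ _, by simp [polyLaplacian_apply]⟩

lemma exists_smul_one {d : ℕ} {P : MvPolynomial (Fin (d + 1)) ℂ} (hP : P ∈ harmPoly d 0) :
    ∃ a : ℂ, P = a • 1 := by
  obtain ⟨a, rfl⟩ : ∃ a, P = C a := ⟨_, (totalDegree_eq_zero_iff_eq_C.1 (by
    simpa using (mem_harmPoly.1 hP).1.totalDegree_le))⟩
  exact ⟨a, by rw [smul_eq_C_mul, mul_one]⟩

lemma exists_eq_tens_one {k : ℕ} {φ : KFinite p q} (hφ : φ ∈ kTypeSub p q (0, k)) :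
    ∃ Q ∈ harmPoly q k, φ = tens hp hq 1 Q := by
  have : kTypeSub p q (0, k) ≤ (harmPoly q k).map (tens hp hq 1) :=
    kTypeSub_le hp hq fun P hP Q hQ => by
      obtain ⟨a, rfl⟩ := exists_smul_one hP
      refine ⟨a • Q, Submodule.smul_mem _ a hQ, ?_⟩
      rw [map_smul, map_smul, LinearMap.smul_apply]
  obtain ⟨Q, hQ, e⟩ := this hφ
  exact ⟨Q, hQ, e.symm⟩

lemma X_mem_harmPoly {d : ℕ} (i : Fin (d + 1)) :
    (X i : MvPolynomial (Fin (d + 1)) ℂ) ∈ harmPoly d 1 := by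
  have := laplacian_X_mul i (1 : MvPolynomial (Fin (d + 1)) ℂ)
  exact mem_harmPoly.2 ⟨isHomogeneous_X ℂ i, by simpa [polyLaplacian_apply] using this⟩

lemma tens_X_one_ne_zero : tens hp hq (X 0) 1 ≠ 0 := by
  intro h
  have := congrFun (congrArg Subtype.val h)
    (⟨EuclideanSpace.single 0 1, by simp⟩, ⟨EuclideanSpace.single 0 1, by simp⟩)
  simp [tens_apply, restrictSph_apply] at this

/-- Away from the poles, every intertwinor acts by a scalar on `V(0,ε)`: for `ε = 0` this space is
one-dimensional, for `ε = 1` one compares with the `V(1,0)`-component of the boosts. -/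
lemma IsIntertwinor.exists_scalar_base (hS : IsIntertwinor hp hq r S) (hε : ε = 0 ∨ ε = 1)
    (hr : NoPole p q ε r) : ∃ c : ℂ, ∀ φ ∈ kTypeSub p q (0, ε), S φ = c • φ := by
  rcases hε with rfl | rfl
  · obtain ⟨Q, hQ, e⟩ := exists_eq_tens_one (hp := hp) (hq := hq) (hS.map_kTypeSub
      (tens_mem_kTypeSub hp hq (one_mem_harmPoly p) (one_mem_harmPoly q)))
    obtain ⟨c, rfl⟩ := exists_smul_one hQ
    refine ⟨c, fun φ hφ => ?_⟩
    obtain ⟨Q', hQ', rfl⟩ := exists_eq_tens_one (hp := hp) (hq := hq) hφ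
    obtain ⟨b, rfl⟩ := exists_smul_one hQ'
    rw [map_smul, map_smul, e, map_smul, smul_comm]
  -- compare the components of boosts of `1 ⊗ Q` in `V(1,0)`, for `Q` linear: they are
  -- multiples of `x_0 ⊗ ∂_l Q`
  · set a₁ : ℂ := q - (((p : ℂ) + q) / 2 - r) with ha₁
    set a₂ : ℂ := q - (((p : ℂ) + q) / 2 + r) with ha₂
    have hn := hr.right (j := 0) (k := 0) rfl
    have h₁ : a₁ ≠ 0 := by simpa [ha₁] using hn.1
    have h₂ : a₂ ≠ 0 := by simpa [ha₂] using hn.2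
    have hl := ladderConst_ne_zero hq one_pos
    have key : ∀ Q ∈ harmPoly q 1, ∀ Q' ∈ harmPoly q 1, S (tens hp hq 1 Q) = tens hp hq 1 Q' →
        ∀ l, a₁ • S (tens hp hq (X 0) (pderiv l Q)) = a₂ • tens hp hq (X 0) (pderiv l Q') := by
      intro Q hQ Q' hQ' e l
      have h1 := hS.comm_confOp (boost_mem 0 l) (tens hp hq 1 Q)
      rw [e, confOp_boost hp hq _ 0 l (one_mem_harmPoly p) hQ,
        confOp_boost hp hq _ 0 l (one_mem_harmPoly p) hQ'] at h1
      have h2 := (components_of_boostTerm hp hq (fun i φ hφ => hS.map_kTypeSub hφ)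
        (one_mem_harmPoly p) (one_mem_harmPoly p) hQ hQ' h1).2.1
      have hX : raisePoly p 0 0 1 = X 0 := by simp [raisePoly, lowerPoly]
      have e1 : ∀ t : ℂ, ((1 : ℕ) : ℂ) + q - 1 - (0 : ℕ) - t = q - t := fun t => by
        push_cast; ring
      rw [hX, lowerPoly, lowerPoly, map_smul, map_smul, map_smul, e1, e1, smul_comm,
        smul_comm _ (ladderConst q 1)⁻¹] at h2
      exact smul_right_injective _ (inv_ne_zero hl) h2
    obtain ⟨Q₀, hQ₀, e₀⟩ := exists_eq_tens_one (hp := hp) (hq := hq) (hS.map_kTypeSub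
      (tens_mem_kTypeSub hp hq (one_mem_harmPoly p) (X_mem_harmPoly 0)))
    have hX0 := key _ (X_mem_harmPoly 0) _ hQ₀ e₀ 0
    obtain ⟨c, hc⟩ := exists_smul_one (pderiv_mem_harmPoly hQ₀ 0)
    rw [pderiv_X_self, hc, map_smul] at hX0
    refine ⟨c, fun φ hφ => ?_⟩
    obtain ⟨Q, hQ, rfl⟩ := exists_eq_tens_one (hp := hp) (hq := hq) hφ
    obtain ⟨Q', hQ', e⟩ := exists_eq_tens_one (hp := hp) (hq := hq) (hS.map_kTypeSub hφ)
    have hd : ∀ l, pderiv l Q' = c • pderiv l Q := by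
      intro l
      have h3 := key _ hQ _ hQ' e l
      obtain ⟨b, hb⟩ := exists_smul_one (pderiv_mem_harmPoly hQ l)
      obtain ⟨b', hb'⟩ := exists_smul_one (pderiv_mem_harmPoly hQ' l)
      rw [hb, hb', map_smul, map_smul, map_smul, smul_comm, hX0, smul_comm,
        smul_smul, smul_smul, smul_smul] at h3
      have h4 := smul_left_injective ℂ tens_X_one_ne_zero h3
      have h5 : b' = c * b := by
        have : a₂ * (b' - c * b) = 0 := by linear_combination -h4
        exact sub_eq_zero.1 ((mul_eq_zero.1 this).resolve_left h₂)
      rw [hb, hb', h5, mul_smul]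
    have hQQ : Q' = c • Q := by
      have e1 := (mem_harmPoly.1 hQ').1.sum_X_mul_pderiv
      have e2 := (mem_harmPoly.1 hQ).1.sum_X_mul_pderiv
      rw [one_smul] at e1 e2
      rw [← e1, ← e2, Finset.smul_sum]
      exact Finset.sum_congr rfl fun l _ => by rw [hd, mul_smul_comm]
    rw [e, hQQ, map_smul]

/-- Away from the poles, an intertwinor that is the identity on `V(0,ε)` determines all others on
the K-types of parity `ε`, up to a constant. -/
lemma IsIntertwinor.exists_eq_smul {A B : KFinite p q →ₗ[ℂ] KFinite p q}
    (hA : IsIntertwinor hp hq r A) (hB : IsIntertwinor hp hq r B) (hε : ε = 0 ∨ ε = 1)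
    (hr : NoPole p q ε r) (h1 : ∀ φ ∈ kTypeSub p q (0, ε), B φ = φ) :
    ∃ c : ℂ, ∀ j k : ℕ, (j + k) % 2 = ε → ∀ φ ∈ kTypeSub p q (j, k), A φ = c • B φ := by
  obtain ⟨c, hc⟩ := hA.exists_scalar_base hε hr
  refine ⟨c, fun j k hjk φ hφ => ?_⟩
  have := (hA.sub_smul hB c).kTypeSub_le_ker hr (fun φ hφ => by
    simp [hc φ hφ, h1 φ hφ]) hjk hφ
  simpa [sub_eq_zero] using this

end Unique

end

/-! ### Schur's lemma for spherical harmonics -/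

section Schur

variable {d : ℕ} {s t : Fin (d + 1)}

/-- The variable `z = x_s + i x_t`, whose powers are highest weight vectors. -/
def hwVar (s t : Fin (d + 1)) : MvPolynomial (Fin (d + 1)) ℂ := X s + C Complex.I * X t

/-- The weight operator `z ∂_z - z̄ ∂_z̄`, a complex multiple of the rotation in the plane of `x_s`
and `x_t`. -/
def weightOp (s t : Fin (d + 1)) :
    Derivation ℂ (MvPolynomial (Fin (d + 1)) ℂ) (MvPolynomial (Fin (d + 1)) ℂ) :=
  Complex.I • angular s t

/-- The operators `z ∂_m - 2 x_m ∂_z̄`, which raise the weight by one. -/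
def weightRaise (s t m : Fin (d + 1)) :
    Derivation ℂ (MvPolynomial (Fin (d + 1)) ℂ) (MvPolynomial (Fin (d + 1)) ℂ) :=
  angular m s + Complex.I • angular m t

lemma weightOp_apply (P : MvPolynomial (Fin (d + 1)) ℂ) :
    weightOp s t P = C Complex.I * (X t * pderiv s P - X s * pderiv t P) := by
  simp [weightOp, angular_apply, smul_eq_C_mul]

lemma weightRaise_apply (m : Fin (d + 1)) (P : MvPolynomial (Fin (d + 1)) ℂ) :
    weightRaise s t m P =
      hwVar s t * pderiv m P - X m * (pderiv s P + C Complex.I * pderiv t P) := by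
  simp only [weightRaise, angular_apply, hwVar, Derivation.add_apply, Derivation.smul_apply,
    smul_eq_C_mul]
  ring

lemma C_I_mul_C_I : (C Complex.I * C Complex.I : MvPolynomial (Fin (d + 1)) ℂ) = -1 := by
  rw [← C_mul, Complex.I_mul_I, C_neg, C_1]

lemma weightOp_X_self (h : s ≠ t) : weightOp s t (X s) = C Complex.I * X t := by
  simp [weightOp_apply, pderiv_X_of_ne h]

lemma weightOp_X_other (h : s ≠ t) : weightOp s t (X t) = -(C Complex.I * X s) := by
  simp [weightOp_apply, pderiv_X_of_ne h.symm]

lemma weightOp_X_of_ne {m : Fin (d + 1)} (hs : m ≠ s) (ht : m ≠ t) : weightOp s t (X m) = 0 := by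
  simp [weightOp_apply, pderiv_X_of_ne hs, pderiv_X_of_ne ht]

/-- `weightRaise` raises the weight by one: `[weightOp, weightRaise] = weightRaise`. -/
lemma weightRaise_weight (hst : s ≠ t) {m : Fin (d + 1)} (hs : m ≠ s) (ht : m ≠ t)
    (P : MvPolynomial (Fin (d + 1)) ℂ) : weightOp s t (weightRaise s t m P) =
      weightRaise s t m (weightOp s t P) + weightRaise s t m P := by
  have : ⁅weightOp s t, weightRaise s t m⁆ = weightRaise s t m := by
    refine derivation_ext fun i => ?_
    rw [Derivation.commutator_apply]
    have e1 : ∀ c : ℂ, weightOp s t (C c) = 0 := fun c => by simp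
    have e2 : ∀ c : ℂ, weightRaise s t m (C c) = 0 := fun c => by simp
    have r1 : weightRaise s t m (X s) = -X m := by
      simp [weightRaise_apply, pderiv_X_of_ne hs.symm, pderiv_X_of_ne hst]
    have r2 : weightRaise s t m (X t) = -(C Complex.I * X m) := by
      simp [weightRaise_apply, pderiv_X_of_ne ht.symm, pderiv_X_of_ne hst.symm]; ring
    have r3 : weightRaise s t m (X m) = hwVar s t := by
      simp [weightRaise_apply, pderiv_X_of_ne hs, pderiv_X_of_ne ht]
    have hI := C_I_mul_C_I (d := d)
    by_cases his : i = s
    · subst his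
      rw [weightOp_X_self hst, r1, Derivation.leibniz, r2, e2, map_neg, weightOp_X_of_ne hs ht]
      simp only [smul_eq_mul]
      linear_combination X m * hI
    by_cases hit : i = t
    · subst hit
      rw [weightOp_X_other hst, r2, map_neg, map_neg, Derivation.leibniz, Derivation.leibniz, r1,
        e1, e2, weightOp_X_of_ne hs ht]
      simp
    by_cases him : i = m
    · subst him
      rw [weightOp_X_of_ne hs ht, r3, map_zero, hwVar, map_add, Derivation.leibniz, e1,
        weightOp_X_self hst, weightOp_X_other hst]
      simp only [smul_eq_mul]
      linear_combination -X s * hI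
    · have : weightRaise s t m (X i) = 0 := by
        simp [weightRaise_apply, pderiv_X_of_ne his, pderiv_X_of_ne hit, pderiv_X_of_ne him]
      rw [weightOp_X_of_ne his hit, this, map_zero, map_zero, sub_zero]
  have h := congrArg (fun D => D P) this
  simp only [Derivation.commutator_apply] at h
  linear_combination h

lemma weightOp_hwVar (h : s ≠ t) : weightOp s t (hwVar s t) = hwVar s t := by
  have hI := C_I_mul_C_I (d := d)
  rw [hwVar, map_add, Derivation.leibniz, weightOp_X_self h, weightOp_X_other h]
  simp only [weightOp_apply, smul_eq_mul, pderiv_C]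
  linear_combination -X s * hI

lemma weightOp_hwVar_pow (h : s ≠ t) (j : ℕ) :
    weightOp s t (hwVar s t ^ j) = (j : ℂ) • hwVar s t ^ j := by
  rw [Derivation.leibniz_pow, weightOp_hwVar h]
  rcases j with - | j
  · simp
  · rw [Nat.add_sub_cancel, smul_eq_mul, ← pow_succ, Nat.cast_smul_eq_nsmul]

lemma weightRaise_hwVar_pow (hst : s ≠ t) {m : Fin (d + 1)} (hs : m ≠ s) (ht : m ≠ t) (j : ℕ) :
    weightRaise s t m (hwVar s t ^ j) = 0 := by
  have : weightRaise s t m (hwVar s t) = 0 := by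
    have hI := C_I_mul_C_I (d := d)
    rw [weightRaise_apply]
    simp [hwVar, pderiv_X_of_ne hs.symm, pderiv_X_of_ne ht.symm, pderiv_X_of_ne hst,
      pderiv_X_of_ne hst.symm, hI]
  rw [Derivation.leibniz_pow, this, smul_zero, smul_zero]

lemma hwVar_ne_zero (hst : s ≠ t) : hwVar s t ≠ 0 := by
  intro h
  have := congrArg (pderiv s) h
  simp [hwVar, pderiv_X_of_ne hst.symm] at this

/-- The polynomial whose roots are the possible weights `-N, …, N` in degree `N`. -/
def weightPoly (N : ℕ) : Polynomial ℂ :=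
  ∏ w ∈ Finset.Icc (-(N : ℤ)) N, (Polynomial.X - Polynomial.C (w : ℂ))

lemma aeval_apply_eigen {M : Type*} [AddCommGroup M] [Module ℂ M] {f : Module.End ℂ M} {c : ℂ}
    {x : M} (h : f x = c • x) (u : Polynomial ℂ) :
    Polynomial.aeval f u x = u.eval c • x := by
  by_cases hx : x = 0
  · simp [hx]
  · exact Module.End.aeval_apply_of_hasEigenvector
      ⟨Module.End.mem_eigenspace_iff.2 h, hx⟩

/-- In degree `N` the weight operator is diagonalizable with weights in `[-N, N]`. -/
lemma mem_iSup_weight (hst : s ≠ t) {N : ℕ} {P : MvPolynomial (Fin (d + 1)) ℂ}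
    (hP : P.IsHomogeneous N) : P ∈ ⨆ (w : ℤ) (_ : w ∈ Finset.Icc (-(N : ℤ)) N),
      Module.End.eigenspace (weightOp s t).toLinearMap (w : ℂ) := by
  set G : ℕ → Submodule ℂ (MvPolynomial (Fin (d + 1)) ℂ) := fun N =>
    ⨆ (w : ℤ) (_ : w ∈ Finset.Icc (-(N : ℤ)) N),
      Module.End.eigenspace (weightOp s t).toLinearMap (w : ℂ) with hG
  have hmul : ∀ (N : ℕ) (L : MvPolynomial (Fin (d + 1)) ℂ) (e : ℤ), |e| ≤ 1 →
      weightOp s t L = (e : ℂ) • L → ∀ Q ∈ G N, L * Q ∈ G (N + 1) := by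
    intro N L e he hL Q hQ
    have : G N ≤ (G (N + 1)).comap (LinearMap.mulLeft ℂ L) := by
      refine iSup₂_le fun w hw R hR => ?_
      have hm : w + e ∈ Finset.Icc (-((N + 1 : ℕ) : ℤ)) (N + 1 : ℕ) := by
        rw [Finset.mem_Icc] at hw ⊢
        rw [abs_le] at he
        push_cast
        constructor <;> linarith [hw.1, hw.2, he.1, he.2]
      refine Submodule.mem_iSup_of_mem (w + e) (Submodule.mem_iSup_of_mem hm ?_)
      rw [Module.End.mem_eigenspace_iff] at hR ⊢
      have hR' : weightOp s t R = (w : ℂ) • R := hR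
      change weightOp s t (L * R) = _ • (L * R)
      rw [Derivation.leibniz, hL, hR']
      simp only [smul_eq_mul, smul_eq_C_mul]
      push_cast
      rw [C_add]
      ring
    exact this hQ
  have hI := C_I_mul_C_I (d := d)
  -- `z̄` has weight `-1`, and `x_s`, `x_t` are combinations of `z` and `z̄`
  have hbar : weightOp s t (X s - C Complex.I * X t) =
      ((-1 : ℤ) : ℂ) • (X s - C Complex.I * X t) := by
    rw [map_sub, Derivation.leibniz, weightOp_X_self hst, weightOp_X_other hst]
    simp only [weightOp_apply, smul_eq_mul, pderiv_C, smul_eq_C_mul]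
    push_cast
    rw [C_neg, C_1]
    linear_combination X s * hI
  have hX : ∀ (N : ℕ) (i : Fin (d + 1)), ∀ Q ∈ G N, X i * Q ∈ G (N + 1) := by
    intro N i Q hQ
    have h1 := hmul N _ 1 (by simp) (by simpa using weightOp_hwVar hst) Q hQ
    have h2 := hmul N _ (-1) (by simp) hbar Q hQ
    by_cases his : i = s
    · subst his
      have := (G (N + 1)).smul_mem (1 / 2 : ℂ) (add_mem h1 h2)
      convert this using 1
      have h2 : (C (1 / 2) * 2 : MvPolynomial (Fin (d + 1)) ℂ) = 1 := by
        rw [← map_ofNat (C (σ := Fin (d + 1)) (R := ℂ)) 2, ← C_mul]; norm_num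
      rw [smul_eq_C_mul, hwVar]
      linear_combination -X i * Q * h2
    by_cases hit : i = t
    · subst hit
      have := (G (N + 1)).smul_mem (-Complex.I / 2 : ℂ) (sub_mem h1 h2)
      convert this using 1
      have h2 : (C (-Complex.I / 2) * 2 * C Complex.I : MvPolynomial (Fin (d + 1)) ℂ) = 1 := by
        rw [← map_ofNat (C (σ := Fin (d + 1)) (R := ℂ)) 2, ← C_mul, ← C_mul,
          show -Complex.I / 2 * 2 * Complex.I = 1 by linear_combination -Complex.I_mul_I, C_1]
      rw [smul_eq_C_mul, hwVar]
      linear_combination -X i * Q * h2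
    · exact hmul N _ 0 (by simp) (by rw [weightOp_X_of_ne his hit]; simp) Q hQ
  have main : ∀ (N : ℕ) (P : MvPolynomial (Fin (d + 1)) ℂ), P.IsHomogeneous N → P ∈ G N := by
    intro N
    induction N with
    | zero =>
      intro P hP
      refine Submodule.mem_iSup_of_mem 0 (Submodule.mem_iSup_of_mem (by simp) ?_)
      rw [Module.End.mem_eigenspace_iff]
      change weightOp s t P = _
      simp [weightOp_apply, pderiv_eq_zero_of_degree_zero hP]
    | succ N ih =>
      intro P hP
      have h := hP.sum_X_mul_pderiv
      rw [← Nat.cast_smul_eq_nsmul ℂ] at h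
      have h0 : ((N + 1 : ℕ) : ℂ) ≠ 0 := Nat.cast_ne_zero.2 N.succ_ne_zero
      refine ((G (N + 1)).smul_mem_iff h0).1 (h ▸ ?_)
      exact (G (N + 1)).sum_mem fun i _ => hX N i _ (ih _ hP.pderiv)
  exact main N P hP

lemma aeval_weightPoly (hst : s ≠ t) {N : ℕ} {P : MvPolynomial (Fin (d + 1)) ℂ}
    (hP : P.IsHomogeneous N) :
    Polynomial.aeval (R := ℂ) (weightOp s t).toLinearMap (weightPoly N) P = 0 := by
  have : (⨆ (w : ℤ) (_ : w ∈ Finset.Icc (-(N : ℤ)) N),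
      Module.End.eigenspace (weightOp s t).toLinearMap (w : ℂ)) ≤
      LinearMap.ker (Polynomial.aeval (R := ℂ) (weightOp s t).toLinearMap (weightPoly N)) := by
    refine iSup₂_le fun w hw Q hQ => ?_
    rw [LinearMap.mem_ker, aeval_apply_eigen (Module.End.mem_eigenspace_iff.1 hQ), weightPoly,
      Polynomial.eval_prod, Finset.prod_eq_zero hw (by simp), zero_smul]
  exact this (mem_iSup_weight hst hP)

/-- Weights in degree `N` have absolute value at most `N`. -/
lemma eq_zero_of_weight (hst : s ≠ t) {N : ℕ} {P : MvPolynomial (Fin (d + 1)) ℂ}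
    (hP : P.IsHomogeneous N) {w : ℤ} (hw : (N : ℤ) < |w|)
    (h : weightOp s t P = (w : ℂ) • P) : P = 0 := by
  have h1 := aeval_weightPoly hst hP
  rw [aeval_apply_eigen (c := (w : ℂ)) h] at h1
  refine (smul_eq_zero.1 h1).resolve_left ?_
  rw [weightPoly, Polynomial.eval_prod, ← ne_eq, Finset.prod_ne_zero_iff]
  intro v hv
  simp only [Polynomial.eval_sub, Polynomial.eval_X, Polynomial.eval_C, sub_ne_zero]
  intro e
  have e' : w = v := by exact_mod_cast e
  rw [Finset.mem_Icc] at hv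
  have := abs_le.2 hv
  rw [← e'] at this
  omega

/-- A homogeneous polynomial that depends on `z` only is a multiple of a power of `z`. -/
lemma exists_eq_smul_hwVar_pow {j : ℕ} {P : MvPolynomial (Fin (d + 1)) ℂ} (hst : s ≠ t)
    (hP : P.IsHomogeneous j) (h1 : ∀ m, m ≠ s → m ≠ t → pderiv m P = 0)
    (h2 : pderiv s P + C Complex.I * pderiv t P = 0) : ∃ c : ℂ, P = c • hwVar s t ^ j := by
  induction j generalizing P with
  | zero =>
    obtain ⟨a, rfl⟩ : ∃ a, P = C a := ⟨_, (totalDegree_eq_zero_iff_eq_C.1 (by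
      simpa using hP.totalDegree_le))⟩
    exact ⟨a, by rw [pow_zero, smul_eq_C_mul, mul_one]⟩
  | succ j ih =>
    obtain ⟨c, hc⟩ := ih (P := pderiv s P) hP.pderiv
      (fun m hs ht => by rw [pderiv_comm', h1 m hs ht, map_zero])
      (by
        have := congrArg (pderiv s) h2
        rw [map_zero, map_add, pderiv_C_mul, pderiv_comm' s t] at this
        exact this)
    have h3 : pderiv t P = C Complex.I * pderiv s P := by
      linear_combination -C Complex.I * h2 + pderiv t P * C_I_mul_C_I (d := d)
    have h4 : ∑ i, X i * pderiv i P = X s * pderiv s P + X t * pderiv t P := by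
      refine Eq.trans ?_ (Finset.sum_pair (f := fun i => X i * pderiv i P) hst)
      refine (Finset.sum_subset (Finset.subset_univ _) fun m _ hm => ?_).symm
      simp only [Finset.mem_insert, Finset.mem_singleton, not_or] at hm
      rw [h1 m hm.1 hm.2, mul_zero]
    have h5 := hP.sum_X_mul_pderiv
    have h0 : ((j + 1 : ℕ) : ℂ) ≠ 0 := Nat.cast_ne_zero.2 j.succ_ne_zero
    refine ⟨((j + 1 : ℕ) : ℂ)⁻¹ * c, ?_⟩
    rw [mul_smul, eq_inv_smul_iff₀ h0, Nat.cast_smul_eq_nsmul, ← h5, h4, h3, hc]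
    simp only [smul_eq_C_mul, hwVar]
    ring

/-- The highest weight vectors among the harmonic polynomials of degree `j` are the multiples
of `z ^ j`. For `P` killed by the raising operators, harmonicity forces `∂_z̄ P` to have
weight `-(d + j - 2)`, which does not occur in degree `j - 1` when `d ≥ 2`. -/
lemma exists_eq_smul_of_weightRaise {j : ℕ} (hd : 2 ≤ d) (hst : s ≠ t)
    {P : MvPolynomial (Fin (d + 1)) ℂ} (hP : P ∈ harmPoly d j)
    (h : ∀ m, m ≠ s → m ≠ t → weightRaise s t m P = 0) : ∃ c : ℂ, P = c • hwVar s t ^ j := by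
  have hP' := mem_harmPoly.1 hP
  rcases Nat.eq_zero_or_pos j with rfl | hj
  · exact exists_eq_smul_hwVar_pow hst hP'.1
      (fun m _ _ => pderiv_eq_zero_of_degree_zero hP'.1 m)
      (by simp [pderiv_eq_zero_of_degree_zero hP'.1])
  set g := pderiv s P + C Complex.I * pderiv t P with hg
  have hgh : g.IsHomogeneous (j - 1) := by
    refine hP'.1.pderiv.add ?_
    have := (isHomogeneous_C (Fin (d + 1)) Complex.I).mul (hP'.1.pderiv (i := t))
    rwa [zero_add] at this
  have h1 : ∀ m, m ≠ s → m ≠ t → hwVar s t * pderiv m P = X m * g := by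
    intro m hs ht
    have := h m hs ht
    rw [weightRaise_apply] at this
    exact sub_eq_zero.1 this
  have h2 : ∀ m, m ≠ s → m ≠ t → hwVar s t * pderiv m (pderiv m P) = g + X m * pderiv m g := by
    intro m hs ht
    have := congrArg (pderiv m) (h1 m hs ht)
    rw [Derivation.leibniz, Derivation.leibniz, pderiv_X_self] at this
    have hz : pderiv m (hwVar s t) = 0 := by
      simp [hwVar, pderiv_X_of_ne hs.symm, pderiv_X_of_ne ht.symm]
    rw [hz] at this
    simp only [smul_eq_mul, mul_zero, add_zero, mul_one] at this
    rw [this]; ring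
  set F : Finset (Fin (d + 1)) := Finset.univ \ {s, t} with hF
  have hsplit : ∀ f : Fin (d + 1) → MvPolynomial (Fin (d + 1)) ℂ,
      ∑ i, f i = ∑ i ∈ F, f i + (f s + f t) := by
    intro f
    rw [← Finset.sum_pair hst, hF, Finset.sum_sdiff (Finset.subset_univ _)]
  have hcard : (F.card : ℂ) = d - 1 := by
    rw [hF, Finset.card_sdiff_of_subset (Finset.subset_univ _), Finset.card_pair hst,
      Finset.card_univ, Fintype.card_fin]
    have : d + 1 - 2 = d - 1 := by omega
    rw [this]; push_cast [show 1 ≤ d by omega]; rfl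
  have h3 : hwVar s t * ∑ m ∈ F, pderiv m (pderiv m P) =
      ((d : ℂ) - 1) • g + ∑ m ∈ F, X m * pderiv m g := by
    rw [Finset.mul_sum, ← hcard, Nat.cast_smul_eq_nsmul, ← Finset.sum_const,
      ← Finset.sum_add_distrib]
    refine Finset.sum_congr rfl fun m hm => ?_
    simp only [hF, Finset.mem_sdiff, Finset.mem_insert, Finset.mem_singleton, not_or] at hm
    exact h2 m hm.2.1 hm.2.2
  have h4 := hsplit fun i => pderiv i (pderiv i P)
  rw [← polyLaplacian_apply, hP'.2] at h4
  have h5 := hsplit fun i => X i * pderiv i g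
  rw [hgh.sum_X_mul_pderiv, ← Nat.cast_smul_eq_nsmul ℂ] at h5
  have hI := C_I_mul_C_I (d := d)
  have e1 : pderiv s g = pderiv s (pderiv s P) + C Complex.I * pderiv s (pderiv t P) := by
    rw [hg, map_add, pderiv_C_mul]
  have e2 : pderiv t g = pderiv s (pderiv t P) + C Complex.I * pderiv t (pderiv t P) := by
    rw [hg, map_add, pderiv_C_mul, pderiv_comm' t s]
  -- sum `h2` over `m`; the Laplace equation removes the second derivatives, Euler's identity for
  -- `g` the remaining first ones
  have hw : weightOp s t g = ((-(d + j - 2 : ℤ) : ℤ) : ℂ) • g := by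
    rw [weightOp_apply]
    simp only [smul_eq_C_mul] at h3 h5 ⊢
    push_cast [hj] at h5 ⊢
    simp only [map_sub, map_add, map_neg, map_natCast, map_ofNat, map_one] at h3 h5 ⊢
    have e3 : pderiv s g - C Complex.I * pderiv t g =
        pderiv s (pderiv s P) + pderiv t (pderiv t P) := by
      rw [e1, e2]
      linear_combination -pderiv t (pderiv t P) * hI
    have hz : hwVar s t = X s + C Complex.I * X t := rfl
    rw [hz] at h3
    linear_combination -h3 + (X s + C Complex.I * X t) * e3 - (X s + C Complex.I * X t) * h4 + h5 +
      X t * pderiv t g * hI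
  have hg0 : g = 0 := eq_zero_of_weight hst hgh (by
    rw [abs_neg, abs_of_nonneg (by omega)]; omega) hw
  refine exists_eq_smul_hwVar_pow hst hP'.1 (fun m hs ht => ?_) hg0
  have := h1 m hs ht
  rw [hg0, mul_zero] at this
  exact (mul_eq_zero.1 this).resolve_left (hwVar_ne_zero hst)

lemma weightOp_mem_of_angular_mem {W : Submodule ℂ (MvPolynomial (Fin (d + 1)) ℂ)}
    (hW : ∀ i m, ∀ P ∈ W, angular i m P ∈ W) {P : MvPolynomial (Fin (d + 1)) ℂ} (hP : P ∈ W) :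
    weightOp s t P ∈ W :=
  W.smul_mem _ (hW _ _ _ hP)

lemma weightRaise_mem_of_angular_mem {W : Submodule ℂ (MvPolynomial (Fin (d + 1)) ℂ)}
    (hW : ∀ i m, ∀ P ∈ W, angular i m P ∈ W) (m : Fin (d + 1))
    {P : MvPolynomial (Fin (d + 1)) ℂ} (hP : P ∈ W) : weightRaise s t m P ∈ W :=
  W.add_mem (hW _ _ _ hP) (W.smul_mem _ (hW _ _ _ hP))

lemma aeval_mem_of_map_mem {M : Type*} [AddCommGroup M] [Module ℂ M] {f : Module.End ℂ M}
    {W : Submodule ℂ M} (hW : ∀ x ∈ W, f x ∈ W) (u : Polynomial ℂ) {x : M} (hx : x ∈ W) :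
    Polynomial.aeval f u x ∈ W := by
  induction u using Polynomial.induction_on generalizing x with
  | C a => simpa [Module.algebraMap_end_apply] using W.smul_mem a hx
  | add u v hu hv => simpa using W.add_mem (hu hx) (hv hx)
  | monomial n a h =>
    rw [pow_succ, ← mul_assoc, map_mul, Polynomial.aeval_X, Module.End.mul_apply]
    exact h (hW x hx)

/-- An invariant subspace with a non-zero vector killed by a product of factors `f - w` contains an
eigenvector of `f`. -/
lemma exists_eigenvector_of_prod {M : Type*} [AddCommGroup M] [Module ℂ M] {f : Module.End ℂ M}
    {W : Submodule ℂ M} (hW : ∀ x ∈ W, f x ∈ W) (F : Finset ℤ) {x : M} (hx : x ∈ W) (h0 : x ≠ 0)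
    (h : Polynomial.aeval f (∏ w ∈ F, (Polynomial.X - Polynomial.C (w : ℂ))) x = 0) :
    ∃ w : ℤ, ∃ y ∈ W, y ≠ 0 ∧ f y = (w : ℂ) • y := by
  induction F using Finset.induction_on with
  | empty => simp at h; exact absurd h h0
  | insert a F ha ih =>
    by_cases h1 : Polynomial.aeval f (∏ w ∈ F, (Polynomial.X - Polynomial.C (w : ℂ))) x = 0
    · exact ih h1
    · refine ⟨a, _, aeval_mem_of_map_mem hW _ hx, h1, ?_⟩
      rw [Finset.prod_insert ha, map_mul, Module.End.mul_apply, map_sub, Polynomial.aeval_X,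
        Polynomial.aeval_C, LinearMap.sub_apply, Module.algebraMap_end_apply, sub_eq_zero] at h
      exact h

/-- Every non-zero invariant subspace of the harmonic polynomials of degree `j` contains the
highest weight vector: a vector of maximal weight is killed by the raising operators. -/
lemma hwVar_pow_mem {j : ℕ} (hd : 2 ≤ d) (hst : s ≠ t)
    {W : Submodule ℂ (MvPolynomial (Fin (d + 1)) ℂ)} (hWj : W ≤ harmPoly d j)
    (hW : ∀ i m, ∀ P ∈ W, angular i m P ∈ W) (hW0 : W ≠ ⊥) : hwVar s t ^ j ∈ W := by
  obtain ⟨P, hP, hP0⟩ := (Submodule.ne_bot_iff W).1 hW0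
  have hex : ∃ w : ℤ, ∃ Q ∈ W, Q ≠ 0 ∧ weightOp s t Q = (w : ℂ) • Q :=
    exists_eigenvector_of_prod (f := (weightOp s t).toLinearMap)
      (fun x hx => weightOp_mem_of_angular_mem hW hx) (Finset.Icc (-(j : ℤ)) j) hP hP0
      (aeval_weightPoly hst (mem_harmPoly.1 (hWj hP)).1)
  obtain ⟨w, ⟨Q, hQ, hQ0, hQw⟩, hmax⟩ := Int.exists_greatest_of_bdd ⟨(j : ℤ), fun w hw => by
    obtain ⟨Q, hQ, hQ0, hQw⟩ := hw
    by_contra hlt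
    refine hQ0 (eq_zero_of_weight hst (mem_harmPoly.1 (hWj hQ)).1 ?_ hQw)
    exact lt_of_lt_of_le (not_le.1 hlt) (le_abs_self w)⟩ hex
  obtain ⟨c, rfl⟩ := exists_eq_smul_of_weightRaise hd hst (hWj hQ) fun m hs ht => by
    by_contra hne
    have := hmax (w + 1) ⟨_, weightRaise_mem_of_angular_mem hW m hQ, hne, by
      rw [weightRaise_weight hst hs ht, hQw, Derivation.map_smul]
      push_cast
      rw [add_smul, one_smul]⟩
    omega
  exact (W.smul_mem_iff fun hc => hQ0 (by rw [hc, zero_smul])).1 hQ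

/-- Schur's lemma: for `d ≥ 2`, an operator on the harmonic polynomials of degree `j` that commutes
with the infinitesimal rotations is a scalar. -/
lemma exists_scalar_of_comm_angular {j : ℕ} (hd : 2 ≤ d)
    {T : MvPolynomial (Fin (d + 1)) ℂ →ₗ[ℂ] MvPolynomial (Fin (d + 1)) ℂ}
    (hT : ∀ P ∈ harmPoly d j, T P ∈ harmPoly d j)
    (hc : ∀ i m, ∀ P ∈ harmPoly d j, T (angular i m P) = angular i m (T P)) :
    ∃ c : ℂ, ∀ P ∈ harmPoly d j, T P = c • P := by
  by_cases hbot : harmPoly d j = ⊥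
  · exact ⟨0, fun P hP => by rw [hbot, Submodule.mem_bot] at hP; simp [hP]⟩
  obtain ⟨s, t, hst⟩ : ∃ s t : Fin (d + 1), s ≠ t :=
    ⟨⟨0, by omega⟩, ⟨1, by omega⟩, by simp⟩
  set v := hwVar s t ^ j with hv
  have hang : ∀ i m, ∀ P ∈ harmPoly d j, angular i m P ∈ harmPoly d j :=
    fun i m P hP => angular_mem i m hP
  have hvm : v ∈ harmPoly d j := hwVar_pow_mem hd hst le_rfl hang hbot
  obtain ⟨c, hcv⟩ := exists_eq_smul_of_weightRaise hd hst (hT v hvm) fun m hs ht => by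
    have h1 : weightRaise s t m (T v) = T (weightRaise s t m v) := by
      simp only [weightRaise, Derivation.add_apply, Derivation.smul_apply, map_add, map_smul,
        hc _ _ v hvm]
    rw [h1, hv, weightRaise_hwVar_pow hst hs ht, map_zero]
  refine ⟨c, ?_⟩
  set S := T - c • LinearMap.id with hS
  have hSapp : ∀ P, S P = T P - c • P := fun P => by simp [hS]
  have hSm : ∀ P ∈ harmPoly d j, S P ∈ harmPoly d j := fun P hP => by
    rw [hSapp]; exact sub_mem (hT P hP) (Submodule.smul_mem _ _ hP)
  have hSc : ∀ i m, ∀ P ∈ harmPoly d j, S (angular i m P) = angular i m (S P) := by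
    intro i m P hP
    rw [hSapp, hSapp, hc i m P hP, map_sub, Derivation.map_smul]
  have hSv : S v = 0 := by rw [hSapp, hcv, sub_self]
  by_contra hne
  have hW0 : (harmPoly d j).map S ≠ ⊥ := by
    intro h
    refine hne fun P hP => ?_
    have : S P ∈ (harmPoly d j).map S := Submodule.mem_map_of_mem hP
    rw [h, Submodule.mem_bot, hSapp] at this
    exact sub_eq_zero.1 this
  -- the image of `S`, if non-zero, contains the highest weight vector `v`, say `v = S f`
  obtain ⟨f, hf, hfv⟩ : v ∈ (harmPoly d j).map S := by
    refine hwVar_pow_mem hd hst (Submodule.map_le_iff_le_comap.2 hSm) ?_ hW0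
    rintro i m _ ⟨P, hP, rfl⟩
    exact ⟨_, hang i m P hP, hSc i m P hP⟩
  have hwm : ∀ P ∈ harmPoly d j, (weightOp s t).toLinearMap P ∈ harmPoly d j :=
    fun P hP => weightOp_mem_of_angular_mem hang hP
  have hSw : ∀ (u : Polynomial ℂ) (P : MvPolynomial (Fin (d + 1)) ℂ), P ∈ harmPoly d j →
      S (Polynomial.aeval (R := ℂ) (weightOp s t).toLinearMap u P) =
        Polynomial.aeval (R := ℂ) (weightOp s t).toLinearMap u (S P) := by
    intro u
    induction u using Polynomial.induction_on with
    | C a => intro P _; simp [Module.algebraMap_end_apply]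
    | add u v hu hv => intro P hP; simp [hu P hP, hv P hP]
    | monomial n a h =>
      intro P hP
      rw [pow_succ, ← mul_assoc, map_mul, Polynomial.aeval_X, Module.End.mul_apply,
        Module.End.mul_apply, h _ (hwm P hP)]
      congr 1
      change S (Complex.I • angular s t P) = Complex.I • angular s t (S P)
      rw [map_smul, hSc _ _ P hP]
  -- project `f` to weight `j`
  set u : Polynomial ℂ := ∏ w ∈ Finset.Ico (-(j : ℤ)) j, (Polynomial.X - Polynomial.C (w : ℂ))
    with hu
  set f₁ := Polynomial.aeval (R := ℂ) (weightOp s t).toLinearMap u f with hf₁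
  have hf₁m : f₁ ∈ harmPoly d j := aeval_mem_of_map_mem hwm u hf
  have hf₁w : weightOp s t f₁ = ((j : ℤ) : ℂ) • f₁ := by
    have h1 := aeval_weightPoly hst (mem_harmPoly.1 hf).1
    rw [weightPoly, ← Finset.Ico_insert_right (by omega), Finset.prod_insert (by simp),
      map_mul, Module.End.mul_apply, map_sub, Polynomial.aeval_X, Polynomial.aeval_C,
      LinearMap.sub_apply, Module.algebraMap_end_apply, sub_eq_zero] at h1
    exact h1
  obtain ⟨b, hb⟩ := exists_eq_smul_of_weightRaise hd hst hf₁m fun m hs ht => by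
    refine eq_zero_of_weight hst (N := j) (w := j + 1)
      (mem_harmPoly.1 (weightRaise_mem_of_angular_mem hang m hf₁m)).1 ?_ ?_
    · rw [abs_of_nonneg (by omega)]; omega
    · rw [weightRaise_weight hst hs ht, hf₁w, Derivation.map_smul]
      push_cast
      rw [add_smul, one_smul]
  have h1 : S f₁ = 0 := by rw [hb, map_smul, ← hv, hSv, smul_zero]
  rw [hf₁, hSw u f hf, hfv, aeval_apply_eigen (weightOp_hwVar_pow hst j)] at h1
  rcases smul_eq_zero.1 h1 with h2 | h2
  · rw [hu, Polynomial.eval_prod, Finset.prod_eq_zero_iff] at h2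
    obtain ⟨w, hw, h3⟩ := h2
    simp only [Polynomial.eval_sub, Polynomial.eval_X, Polynomial.eval_C, sub_eq_zero] at h3
    have h4 : (j : ℤ) = w := by exact_mod_cast h3
    rw [Finset.mem_Ico] at hw
    omega
  · exact pow_ne_zero j (hwVar_ne_zero hst) h2

end Schur

section

/-! ### Intertwinors act by scalars on the K-types -/

lemma eval_mul_of_isHomogeneous {d j : ℕ} {P : MvPolynomial (Fin (d + 1)) ℂ}
    (hP : P.IsHomogeneous j) (c : ℂ) (x : Fin (d + 1) → ℂ) :
    eval (fun i => c * x i) P = c ^ j * eval x P := by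
  rw [eval_eq', eval_eq', Finset.mul_sum]
  refine Finset.sum_congr rfl fun m hm => ?_
  have h : ∑ i, m i = j := by
    have := hP (mem_support_iff.1 hm)
    rw [← this, Finsupp.weight_apply, Finsupp.sum_fintype _ _ (by simp)]
    simp
  simp only [mul_pow, Finset.prod_mul_distrib, Finset.prod_pow_eq_pow_sum, h]
  ring

/-- A homogeneous polynomial is determined by its restriction to the unit sphere. -/
lemma eq_zero_of_restrictSph {d j : ℕ} {P : MvPolynomial (Fin (d + 1)) ℂ}
    (hP : P.IsHomogeneous j) (h : restrictSph d P = 0) : P = 0 := by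
  -- test the polynomial on the box of points with positive real coordinates
  refine funext_set (fun _ => Complex.ofReal '' Set.Ioi (0 : ℝ))
    (fun _ => (Set.Ioi_infinite 0).image Complex.ofReal_injective.injOn) fun x hx => ?_
  have hx' : ∀ i, ∃ y : ℝ, 0 < y ∧ (y : ℂ) = x i := fun i => hx i (Set.mem_univ i)
  choose y hy hyx using hx'
  set v : EuclideanSpace ℝ (Fin (d + 1)) := WithLp.toLp 2 y with hv
  have hv0 : v ≠ 0 := by
    intro h0
    have := congrArg (fun w : EuclideanSpace ℝ (Fin (d + 1)) => w 0) h0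
    simp [hv] at this
    exact (hy 0).ne' this
  have h1 := congrFun h ⟨‖v‖⁻¹ • v, by simpa using norm_smul_inv_norm (𝕜 := ℝ) hv0⟩
  have h2 : x = fun i => (‖v‖ : ℂ) * (((‖v‖⁻¹ • v) i : ℝ) : ℂ) := by
    ext i
    have : ‖v‖ * (‖v‖⁻¹ * y i) = y i := mul_inv_cancel_left₀ (norm_ne_zero_iff.2 hv0) _
    rw [← hyx i, ← this]
    push_cast
    simp [hv]
  rw [map_zero, h2, eval_mul_of_isHomogeneous hP]
  rw [restrictSph_apply] at h1
  rw [h1]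
  simp

/-- Schur's lemma for maps from harmonic polynomials to functions on the sphere. -/
lemma exists_scalar_of_restrictSph {d j : ℕ} (hd : 2 ≤ d)
    {F : MvPolynomial (Fin (d + 1)) ℂ →ₗ[ℂ] (Sph d → ℂ)}
    (hF : ∀ P ∈ harmPoly d j, ∃ R ∈ harmPoly d j, F P = restrictSph d R ∧
      ∀ i m, F (angular i m P) = restrictSph d (angular i m R)) :
    ∃ c : ℂ, ∀ P ∈ harmPoly d j, F P = c • restrictSph d P := by
  have hinj : ∀ P ∈ harmPoly d j, ∀ R ∈ harmPoly d j,
      restrictSph d P = restrictSph d R → P = R := fun P hP R hR h =>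
    sub_eq_zero.1 (eq_zero_of_restrictSph (mem_harmPoly.1 (sub_mem hP hR)).1
      (by rw [map_sub, h, sub_self]))
  choose! T hTm hT hTa using hF
  let T₀ : harmPoly d j →ₗ[ℂ] MvPolynomial (Fin (d + 1)) ℂ :=
    { toFun := fun P => T P
      map_add' := fun P Q => hinj _ (hTm _ (P + Q).2) _ (add_mem (hTm _ P.2) (hTm _ Q.2)) (by
        rw [← hT _ (P + Q).2, map_add, ← hT _ P.2, ← hT _ Q.2, Submodule.coe_add, map_add])
      map_smul' := fun c P => hinj _ (hTm _ (c • P).2) _ (Submodule.smul_mem _ c (hTm _ P.2)) (by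
        rw [← hT _ (c • P).2, Submodule.coe_smul, RingHom.id_apply, map_smul, map_smul,
          ← hT _ P.2]) }
  obtain ⟨T₁, hT₁⟩ := T₀.exists_extend
  have hT₁' : ∀ P ∈ harmPoly d j, T₁ P = T P := fun P hP => LinearMap.congr_fun hT₁ ⟨P, hP⟩
  obtain ⟨c, hc⟩ := exists_scalar_of_comm_angular (j := j) hd (T := T₁)
    (fun P hP => by rw [hT₁' P hP]; exact hTm P hP) fun i m P hP => by
      rw [hT₁' P hP, hT₁' _ (angular_mem i m hP)]
      exact hinj _ (hTm _ (angular_mem i m hP)) _ (angular_mem i m (hTm P hP))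
        (by rw [← hTa P hP, ← hT _ (angular_mem i m hP)])
  refine ⟨c, fun P hP => ?_⟩
  rw [hT P hP, ← hT₁' P hP, hc P hP, map_smul]

variable {p q : ℕ} {hp : 1 ≤ p} {hq : 1 ≤ q} {r : ℂ} {A : KFinite p q →ₗ[ℂ] KFinite p q}

/-- Restriction of a function to `S^p × {v}`. -/
def sliceLeft (v : Sph q) : KFinite p q →ₗ[ℂ] (Sph p → ℂ) where
  toFun φ := fun u => (φ : Prd p q → ℂ) (u, v)
  map_add' _ _ := rfl
  map_smul' _ _ := rfl

/-- Restriction of a function to `{u} × S^q`. -/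
def sliceRight (u : Sph p) : KFinite p q →ₗ[ℂ] (Sph q → ℂ) where
  toFun φ := fun v => (φ : Prd p q → ℂ) (u, v)
  map_add' _ _ := rfl
  map_smul' _ _ := rfl

lemma sliceLeft_tens (P : MvPolynomial (Fin (p + 1)) ℂ) (Q : MvPolynomial (Fin (q + 1)) ℂ)
    (v : Sph q) : sliceLeft v (tens hp hq P Q) = restrictSph p (restrictSph q Q v • P) := by
  ext u
  rw [map_smul, Pi.smul_apply, smul_eq_mul, mul_comm]
  rfl

lemma sliceRight_tens (P : MvPolynomial (Fin (p + 1)) ℂ) (Q : MvPolynomial (Fin (q + 1)) ℂ)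
    (u : Sph p) : sliceRight u (tens hp hq P Q) = restrictSph q (restrictSph p P u • Q) := by
  ext v
  rw [map_smul, Pi.smul_apply, smul_eq_mul]
  rfl

/-- The slices of a function in `V(j,k)` are harmonic, compatibly with rotations of the first
sphere. -/
lemma exists_sliceLeft {j k : ℕ} (v : Sph q) {φ : KFinite p q} (hφ : φ ∈ kTypeSub p q (j, k)) :
    ∃ R ∈ harmPoly p j, sliceLeft v φ = restrictSph p R ∧
      ∀ i m, sliceLeft v (confOp hp hq 0 (rotLeft p q i m) φ) =
        restrictSph p (angular i m R) := by
  let N : Submodule ℂ (KFinite p q) :=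
    { carrier := {φ | ∃ R ∈ harmPoly p j, sliceLeft v φ = restrictSph p R ∧
        ∀ i m, sliceLeft v (confOp hp hq 0 (rotLeft p q i m) φ) = restrictSph p (angular i m R)}
      add_mem' := by
        rintro φ ψ ⟨R, hR, h1, h2⟩ ⟨R', hR', h1', h2'⟩
        exact ⟨R + R', add_mem hR hR', by rw [map_add, map_add, h1, h1'], fun i m => by
          rw [map_add, map_add, map_add, map_add, h2, h2']⟩
      zero_mem' := ⟨0, zero_mem _, by simp, by simp⟩
      smul_mem' := by
        rintro c φ ⟨R, hR, h1, h2⟩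
        exact ⟨c • R, Submodule.smul_mem _ c hR, by rw [map_smul, map_smul, h1], fun i m => by
          rw [map_smul, map_smul, Derivation.map_smul, map_smul, h2]⟩ }
  refine kTypeSub_le (N := N) hp hq (fun P hP Q hQ => ?_) hφ
  refine ⟨restrictSph q Q v • P, Submodule.smul_mem _ _ hP, sliceLeft_tens P Q v, fun i m => ?_⟩
  rw [confOp_rotLeft hp hq 0 i m hP hQ, sliceLeft_tens, Derivation.map_smul]

/-- The slices of a function in `V(j,k)` are harmonic, compatibly with rotations of the second
sphere. -/
lemma exists_sliceRight {j k : ℕ} (u : Sph p) {φ : KFinite p q} (hφ : φ ∈ kTypeSub p q (j, k)) :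
    ∃ R ∈ harmPoly q k, sliceRight u φ = restrictSph q R ∧
      ∀ i m, sliceRight u (confOp hp hq 0 (rotRight p q i m) φ) =
        restrictSph q (angular i m R) := by
  let N : Submodule ℂ (KFinite p q) :=
    { carrier := {φ | ∃ R ∈ harmPoly q k, sliceRight u φ = restrictSph q R ∧
        ∀ i m, sliceRight u (confOp hp hq 0 (rotRight p q i m) φ) = restrictSph q (angular i m R)}
      add_mem' := by
        rintro φ ψ ⟨R, hR, h1, h2⟩ ⟨R', hR', h1', h2'⟩
        exact ⟨R + R', add_mem hR hR', by rw [map_add, map_add, h1, h1'], fun i m => by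
          rw [map_add, map_add, map_add, map_add, h2, h2']⟩
      zero_mem' := ⟨0, zero_mem _, by simp, by simp⟩
      smul_mem' := by
        rintro c φ ⟨R, hR, h1, h2⟩
        exact ⟨c • R, Submodule.smul_mem _ c hR, by rw [map_smul, map_smul, h1], fun i m => by
          rw [map_smul, map_smul, Derivation.map_smul, map_smul, h2]⟩ }
  refine kTypeSub_le (N := N) hp hq (fun P hP Q hQ => ?_) hφ
  refine ⟨restrictSph p P u • Q, Submodule.smul_mem _ _ hQ, sliceRight_tens P Q u, fun i m => ?_⟩
  rw [confOp_rotRight hp hq 0 i m hP hQ, sliceRight_tens, Derivation.map_smul]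

/-- For `p, q ≥ 2`, an intertwinor acts by a scalar on each K-type: by Schur's lemma in each factor,
`A (P ⊗ Q)` is proportional to `P` in the first variable and to `Q` in the second. -/
lemma IsIntertwinor.exists_scalar (hA : IsIntertwinor hp hq r A) (hp2 : 2 ≤ p) (hq2 : 2 ≤ q)
    (j k : ℕ) : ∃ c : ℂ, ∀ φ ∈ kTypeSub p q (j, k), A φ = c • φ := by
  have hl : ∀ Q ∈ harmPoly q k, ∀ v : Sph q, ∃ c : ℂ, ∀ P ∈ harmPoly p j,
      sliceLeft v (A (tens hp hq P Q)) = c • restrictSph p P := by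
    intro Q hQ v
    refine exists_scalar_of_restrictSph hp2
      (F := sliceLeft v ∘ₗ A ∘ₗ (tens hp hq).flip Q) fun P hP => ?_
    obtain ⟨R, hR, h1, h2⟩ := exists_sliceLeft (hp := hp) (hq := hq) v
      (hA.map_kTypeSub (tens_mem_kTypeSub hp hq hP hQ))
    refine ⟨R, hR, h1, fun i m => ?_⟩
    rw [← h2, ← hA.comm_rotLeft, confOp_rotLeft hp hq 0 i m hP hQ]
    rfl
  have hr : ∀ P ∈ harmPoly p j, ∀ u : Sph p, ∃ c : ℂ, ∀ Q ∈ harmPoly q k,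
      sliceRight u (A (tens hp hq P Q)) = c • restrictSph q Q := by
    intro P hP u
    refine exists_scalar_of_restrictSph hq2
      (F := sliceRight u ∘ₗ A ∘ₗ tens hp hq P) fun Q hQ => ?_
    obtain ⟨R, hR, h1, h2⟩ := exists_sliceRight (hp := hp) (hq := hq) u
      (hA.map_kTypeSub (tens_mem_kTypeSub hp hq hP hQ))
    refine ⟨R, hR, h1, fun i m => ?_⟩
    rw [← h2, ← hA.comm_rotRight, confOp_rotRight hp hq 0 i m hP hQ]
    rfl
  suffices h : ∃ c : ℂ, ∀ P ∈ harmPoly p j, ∀ Q ∈ harmPoly q k,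
      A (tens hp hq P Q) = c • tens hp hq P Q by
    obtain ⟨c, hc⟩ := h
    exact ⟨c, fun φ hφ => LinearMap.mem_eqLocus.1 <| kTypeSub_le
      (N := LinearMap.eqLocus A (c • LinearMap.id)) hp hq
      (fun P hP Q hQ => LinearMap.mem_eqLocus.2 (hc P hP Q hQ)) hφ⟩
  by_cases h0 : ∃ P ∈ harmPoly p j, ∃ u, restrictSph p P u ≠ 0
  · obtain ⟨P₀, hP₀, u₀, hu₀⟩ := h0
    obtain ⟨b, hb⟩ := hr P₀ hP₀ u₀
    refine ⟨b / restrictSph p P₀ u₀, fun P hP Q hQ => Subtype.ext (funext fun z => ?_)⟩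
    obtain ⟨c, hc⟩ := hl Q hQ z.2
    have h1 : (A (tens hp hq P Q) : Prd p q → ℂ) z = c * restrictSph p P z.1 :=
      congrFun (hc P hP) z.1
    have h2 : (A (tens hp hq P₀ Q) : Prd p q → ℂ) (u₀, z.2) = c * restrictSph p P₀ u₀ :=
      congrFun (hc P₀ hP₀) u₀
    have h3 : (A (tens hp hq P₀ Q) : Prd p q → ℂ) (u₀, z.2) = b * restrictSph q Q z.2 :=
      congrFun (hb Q hQ) z.2
    rw [h1, Submodule.coe_smul, Pi.smul_apply, tens_apply, smul_eq_mul]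
    field_simp
    linear_combination restrictSph p P z.1 * (h3 - h2)
  · push Not at h0
    refine ⟨0, fun P hP Q hQ => ?_⟩
    have : tens hp hq P Q = 0 := Subtype.ext (funext fun z => by
      rw [tens_apply, h0 P hP z.1, zero_mul]; rfl)
    rw [this, map_zero, smul_zero]

/-! ### The Gamma quotient -/

lemma spectralNum_up {ε : ℕ} {j k : ℕ}
    (h : (shift q k + shift p j + 1 + r) / 2 ≠ 0) : spectralNum p q ε r (j + 1) (k + 1) =
      (shift q k + shift p j + 1 + r) / 2 * spectralNum p q ε r j k := by
  have e1 : (shift q (k + 1) + shift p (j + 1) + 1 + r) / 2 =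
      (shift q k + shift p j + 1 + r) / 2 + 1 := by
    simp only [shift]; push_cast; ring
  have e2 : shift q (k + 1) - shift p (j + 1) = shift q k - shift p j := by
    simp only [shift]; push_cast; ring
  rw [spectralNum, e1, e2, Complex.Gamma_add_one _ h, spectralNum]
  ring

lemma spectralNum_right {ε : ℕ} {j k : ℕ}
    (h : (shift q k - shift p (j + 1) + 1 + r) / 2 ≠ 0) : spectralNum p q ε r j (k + 1) =
      (shift q k - shift p (j + 1) + 1 + r) / 2 * spectralNum p q ε r (j + 1) k := by
  have e1 : (shift q (k + 1) - shift p j + 1 + r) / 2 =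
      (shift q k - shift p (j + 1) + 1 + r) / 2 + 1 := by
    simp only [shift]; push_cast; ring
  have e2 : shift q (k + 1) + shift p j = shift q k + shift p (j + 1) := by
    simp only [shift]; push_cast; ring
  rw [spectralNum, e1, e2, Complex.Gamma_add_one _ h, spectralNum]
  ring

variable {ε : ℕ}

lemma spectralZ_up (h : NoPole p q ε r) {j k : ℕ} (hjk : (j + k) % 2 = ε) :
    (j + k + (((p : ℂ) + q) / 2 - r)) * spectralZ p q ε r (j + 1) (k + 1) =
      (j + k + (((p : ℂ) + q) / 2 + r)) * spectralZ p q ε r j k := by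
  obtain ⟨h1, h2, -, -⟩ := h j k hjk 0
  rw [Nat.cast_zero, neg_zero] at h1 h2
  rw [sub_eq_add_neg] at h2
  rw [spectralZ, spectralNum_up h1, spectralNum_up h2, mul_div_mul_comm, spectralZ]
  have e1 : (j + k + (((p : ℂ) + q) / 2 - r)) = 2 * ((shift q k + shift p j + 1 + -r) / 2) := by
    simp only [shift]; ring
  have e2 : (j + k + (((p : ℂ) + q) / 2 + r)) = 2 * ((shift q k + shift p j + 1 + r) / 2) := by
    simp only [shift]; ring
  rw [e1, e2]
  generalize (shift q k + shift p j + 1 + -r) / 2 = a at *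
  generalize (shift q k + shift p j + 1 + r) / 2 = b at *
  rw [← mul_assoc, mul_assoc 2 a, mul_div_cancel₀ b h2]

lemma spectralZ_right (h : NoPole p q ε r) {j k : ℕ} (hjk : (j + 1 + k) % 2 = ε) :
    (k + q - j - (((p : ℂ) + q) / 2 - r)) * spectralZ p q ε r (j + 1) k =
      (k + q - j - (((p : ℂ) + q) / 2 + r)) * spectralZ p q ε r j (k + 1) := by
  obtain ⟨-, -, h1, h2⟩ := h (j + 1) k hjk 0
  rw [Nat.cast_zero, neg_zero] at h1 h2
  rw [sub_eq_add_neg _ r] at h2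
  rw [spectralZ, spectralZ, spectralNum_right h1, spectralNum_right h2, mul_div_mul_comm]
  have e1 : (k + q - j - (((p : ℂ) + q) / 2 - r)) =
      2 * ((shift q k - shift p (j + 1) + 1 + r) / 2) := by
    simp only [shift]; push_cast; ring
  have e2 : (k + q - j - (((p : ℂ) + q) / 2 + r)) =
      2 * ((shift q k - shift p (j + 1) + 1 + -r) / 2) := by
    simp only [shift]; push_cast; ring
  rw [e1, e2]
  generalize (shift q k - shift p (j + 1) + 1 + -r) / 2 = a at *
  generalize (shift q k - shift p (j + 1) + 1 + r) / 2 = b at *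
  rw [← mul_assoc, mul_assoc 2 a, mul_div_cancel₀ b h2]

lemma spectralZ_base (h : NoPole p q ε r) (hε : ε = 0 ∨ ε = 1) : spectralZ p q ε r 0 ε = 1 := by
  have hm := h 0 ε (by omega)
  have e1 : shift q ε + shift p 0 + 1 = ε + ((p : ℂ) + q) / 2 := by
    simp only [shift]; push_cast; ring
  have e2 : shift q ε - shift p 0 + 1 = ε - ((p : ℂ) - q) / 2 + 1 := by
    simp only [shift]; push_cast; ring
  rw [e1, e2] at hm
  have g1 := Complex.Gamma_ne_zero fun m => (hm m).1
  have g2 := Complex.Gamma_ne_zero fun m => (hm m).2.1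
  have g3 := Complex.Gamma_ne_zero fun m => (hm m).2.2.1
  have g4 := Complex.Gamma_ne_zero fun m => (hm m).2.2.2
  rw [spectralZ, spectralNum, spectralNum, e1, e2, sub_neg_eq_add, sub_neg_eq_add,
    ← sub_eq_add_neg, ← sub_eq_add_neg, div_eq_one_iff_eq]
  · ring
  · exact mul_ne_zero (mul_ne_zero (mul_ne_zero g2 g4) g3) g1

/-- Every multiple of the Gamma quotient is the spectral function of an intertwinor on the K-types
of parity `ε`; the intertwinor is taken to vanish on those of the other parity. -/
lemma exists_isIntertwinor_spectralZ (hp : 1 ≤ p) (hq : 1 ≤ q) (h : NoPole p q ε r) (c : ℂ) :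
    ∃ A : KFinite p q →ₗ[ℂ] KFinite p q, IsIntertwinor hp hq r A ∧
      ∀ j k : ℕ, (j + k) % 2 = ε → ∀ φ ∈ kTypeSub p q (j, k),
        A φ = (c * spectralZ p q ε r j k) • φ := by
  obtain ⟨A, hA, hs⟩ := exists_isIntertwinor hp hq (r := r)
    (μ := fun i => if (i.1 + i.2) % 2 = ε then c * spectralZ p q ε r i.1 i.2 else 0)
    (fun j k => by
      have e : (j + 1 + (k + 1)) % 2 = (j + k) % 2 := by omega
      simp only [e]
      split_ifs with hjk
      · linear_combination c * spectralZ_up h hjk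
      · simp)
    (fun j k => by
      have e : (j + (k + 1)) % 2 = (j + 1 + k) % 2 := by congr 1; ring
      simp only [e]
      split_ifs with hjk
      · linear_combination c * spectralZ_right h hjk
      · simp)
  exact ⟨A, hA, fun j k hjk φ hφ => by simpa [hjk] using hs (j, k) φ hφ⟩

end

end SphereProduct

end

open SphereProduct

theorem mainTheorem1 (p q : ℕ) (hp : 1 ≤ p) (hq : 1 ≤ q) (r : ℂ) :
    (2 ≤ p → 2 ≤ q → ∀ A : KFinite p q →ₗ[ℂ] KFinite p q, IsIntertwinor hp hq r A →
      ∃ μ : ℕ → ℕ → ℂ, ∀ j k : ℕ, ∀ φ : KFinite p q, (φ : Prd p q → ℂ) ∈ KType p q j k →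
        A φ = μ j k • φ) ∧
    ∀ ε : ℕ, ε = 0 ∨ ε = 1 → NoPole p q ε r →
      spectralZ p q ε r 0 ε = 1 ∧
      (∀ A : KFinite p q →ₗ[ℂ] KFinite p q, IsIntertwinor hp hq r A →
        ∃ c : ℂ, ∀ j k : ℕ, (j + k) % 2 = ε →
          ∀ φ : KFinite p q, (φ : Prd p q → ℂ) ∈ KType p q j k →
            A φ = (c * spectralZ p q ε r j k) • φ) ∧
      (∀ c : ℂ, ∃ A : KFinite p q →ₗ[ℂ] KFinite p q, IsIntertwinor hp hq r A ∧
        ∀ j k : ℕ, (j + k) % 2 = ε →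
          ∀ φ : KFinite p q, (φ : Prd p q → ℂ) ∈ KType p q j k →
            A φ = (c * spectralZ p q ε r j k) • φ) := by
  constructor
  · intro hp2 hq2 A hA
    choose μ hμ using hA.exists_scalar hp2 hq2
    exact ⟨μ, fun j k φ hφ => hμ j k φ hφ⟩
  · intro ε hε hr
    have hbase := spectralZ_base hr hε
    refine ⟨hbase, fun A hA => ?_, fun c => exists_isIntertwinor_spectralZ hp hq hr c⟩
    obtain ⟨B, hB, hs⟩ := exists_isIntertwinor_spectralZ hp hq hr 1
    obtain ⟨c, hc⟩ := hA.exists_eq_smul hB hε hr fun φ hφ => by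
      rw [hs 0 ε (by omega) φ hφ, hbase, mul_one, one_smul]
    refine ⟨c, fun j k hjk φ hφ => ?_⟩
    rw [hc j k hjk φ hφ, hs j k hjk φ hφ, smul_smul, one_mul]
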